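/- Let $\Omega\subset\mathbb R^2$ be a simply connected polygonal domain, i.e. a bounded simply connected open set with $\operatorname{int}\overline\Omega=\Omega$ whose boundary $\Gamma$ is a simple closed polygon. Let the open edges of $\Gamma$ be distributed among three disjoint sets $\Gamma_c,\Gamma_s,\Gamma_f$ with $|\Gamma_c\cup\Gamma_s|>0$, and let $\Gamma_{cs}:=\overline\Gamma_c\cup\overline\Gamma_s$ be connected. Write $(\cdot,\cdot)$ for the $L^2(\Omega)$ inner product, $\|\cdot\|_s$ for the $H^s(\Omega)$ norm, $\operatorname{rot}\theta=\partial_1\theta_2-\partial_2\theta_1$, and let $\mathbf n$, $\mathbf t$ be the unit normal and tangent on $\Gamma$. In the sense of traces, set $$H^2_\Gamma(\Omega)=\{v\in H^2(\Omega): v|_{\Gamma_c\cup\Gamma_s}=0,\ \partial_n v|_{\Gamma_c}=0\},\qquad \Theta_\Gamma(\Omega)=\{\theta\in H^1(\Omega)^2:\theta|_{\Gamma_c}=0,\ \mathbf t\cdot\theta|_{\Gamma_s}=0\}.$$ Let $\mathcal T$ be a conforming partition of $\Omega$ into finitely many nondegenerate triangles (two distinct triangles that meet share exactly a common vertex or a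 common edge), let $p\ge 1$, and let $\mathcal P_k(K)$ denote the polynomials of degree at most $k$ on $K$. Set $$W^p=\{v\in C^1(\Omega): v|_K\in\mathcal P_p(K)\ \forall K\in\mathcal T\},\qquad W^p_\Gamma=W^p\cap H^2_\Gamma(\Omega),$$ $$\tilde W^p_\Gamma=\{v\in C(\overline\Omega): v|_K\in\mathcal P_p(K)\ \forall K\in\mathcal T,\ v|_{\Gamma_{cs}}=0\},\qquad G^{p-1}_\Gamma=\{\theta\in\Theta_\Gamma(\Omega):\theta|_K\in\mathcal P_{p-1}(K)^2\ \forall K\in\mathcal T\}.$$ Let $a$ be a bilinear form on $H^1(\Omega)^2$ for which there are constants $M,\alpha>0$ with $|a(\theta,\psi)|\le M\|\theta\|_1\|\psi\|_1$ and $a(\theta,\theta)\ge 0$ for all $\theta,\psi\in H^1(\Omega)^2$, and $a(\operatorname{grad}u,\operatorname{grad}u)\ge\alpha\|u\|_2^2$ for all $u\in H^2_\Gamma(\Omega)$. Let $F$ be a linear functional that is defined on $H^2_\Gamma(\Omega)$ and on $\tilde W^p_\Gamma$ (on a linear space of functions containing both) and is bounded on $H^2_\Gamma(\Omega)$ in the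 $H^2(\Omega)$ norm. Then there is a unique $w_p\in W^p_\Gamma$ with $a(\operatorname{grad}w_p,\operatorname{grad}v)=F(v)$ for all $v\in W^p_\Gamma$ (the Morgan–Scott approximation). Moreover, there is a unique tuple $$(\tilde z_p,\theta_{p-1},r_{p-2},\tilde w_p)\in \tilde W^p_\Gamma\times G^{p-1}_\Gamma\times\operatorname{rot}G^{p-1}_\Gamma\times\tilde W^p_\Gamma$$ satisfying 1. $(\operatorname{grad}\tilde z_p,\operatorname{grad}\tilde v)=F(\tilde v)$ for all $\tilde v\in\tilde W^p_\Gamma$; 2. $a(\theta_{p-1},\psi)+(\operatorname{rot}\psi,r_{p-2})=(\operatorname{grad}\tilde z_p,\psi)$ for all $\psi\in G^{p-1}_\Gamma$, and $(\operatorname{rot}\theta_{p-1},s)=0$ for all $s\in\operatorname{rot}G^{p-1}_\Gamma$; 3. $(\operatorname{grad}\tilde w_p,\operatorname{grad}v)=(\theta_{p-1},\operatorname{grad}v)$ for all $v\in\tilde W^p_\Gamma$. This solution satisfies $\operatorname{grad}\tilde w_p=\theta_{p-1}$ and $\tilde w_p=w_p$. -/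

import Mathlib

open MeasureTheory Filter Topology Metric
open scoped ContDiff

noncomputable section

namespace MorganScott

/-- The Euclidean plane. -/
abbrev Plane : Type := EuclideanSpace ℝ (Fin 2)

/-! ### Sobolev spaces -/

/-- The Hilbert space `L²(Ω)`. -/
abbrev L2 (Ω : Set Plane) : Type := Lp ℝ 2 (volume.restrict Ω)

/-- `g` is the weak partial derivative of `u` in the `i`-th coordinate direction on `Ω`
(test functions in `C_c^∞(Ω)`). -/
def HasWeakPartial (Ω : Set Plane) (i : Fin 2) (u g : L2 Ω) : Prop :=
  ∀ φ : Plane → ℝ, ContDiff ℝ ∞ φ → HasCompactSupport φ → tsupport φ ⊆ Ω →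
    ∫ x in Ω, u x * fderiv ℝ φ x (EuclideanSpace.single i 1) = -∫ x in Ω, g x * φ x

theorem integrable_mul_test {Ω : Set Plane} (u : L2 Ω) {ψ : Plane → ℝ}
    (hψ : Continuous ψ) (hc : HasCompactSupport ψ) :
    Integrable (fun x => u x * ψ x) (volume.restrict Ω) := by
  have h1 : MemLp (u : Plane → ℝ) 2 (volume.restrict Ω) := Lp.memLp u
  have h2 : MemLp ψ 2 (volume.restrict Ω) := hψ.memLp_of_hasCompactSupport hc
  exact h1.integrable_mul h2

theorem integrable_mul_fderiv_test {Ω : Set Plane} (u : L2 Ω) {φ : Plane → ℝ}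
    (hφ : ContDiff ℝ ∞ φ) (hc : HasCompactSupport φ) (e : Plane) :
    Integrable (fun x => u x * fderiv ℝ φ x e) (volume.restrict Ω) := by
  refine integrable_mul_test u ?_ (hc.fderiv_apply (𝕜 := ℝ) e)
  exact (hφ.continuous_fderiv (by simp)).clm_apply continuous_const

theorem HasWeakPartial.add {Ω : Set Plane} {i : Fin 2} {u u' g g' : L2 Ω}
    (h : HasWeakPartial Ω i u g) (h' : HasWeakPartial Ω i u' g') :
    HasWeakPartial Ω i (u + u') (g + g') := by
  intro φ hφ hc hs
  have e1 : ∫ x in Ω, (u + u' : L2 Ω) x * fderiv ℝ φ x (EuclideanSpace.single i 1) =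
      ∫ x in Ω, (u x * fderiv ℝ φ x (EuclideanSpace.single i 1) +
        u' x * fderiv ℝ φ x (EuclideanSpace.single i 1)) := by
    refine integral_congr_ae ?_
    filter_upwards [Lp.coeFn_add u u'] with x hx
    rw [hx, Pi.add_apply, add_mul]
  have e2 : ∫ x in Ω, (g + g' : L2 Ω) x * φ x = ∫ x in Ω, (g x * φ x + g' x * φ x) := by
    refine integral_congr_ae ?_
    filter_upwards [Lp.coeFn_add g g'] with x hx
    rw [hx, Pi.add_apply, add_mul]
  rw [e1, e2, integral_add (integrable_mul_fderiv_test u hφ hc _)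
    (integrable_mul_fderiv_test u' hφ hc _),
    integral_add (integrable_mul_test g hφ.continuous hc)
    (integrable_mul_test g' hφ.continuous hc), h φ hφ hc hs, h' φ hφ hc hs]
  ring

theorem HasWeakPartial.smul {Ω : Set Plane} {i : Fin 2} {u g : L2 Ω} (c : ℝ)
    (h : HasWeakPartial Ω i u g) : HasWeakPartial Ω i (c • u) (c • g) := by
  intro φ hφ hc hs
  have e1 : ∫ x in Ω, (c • u : L2 Ω) x * fderiv ℝ φ x (EuclideanSpace.single i 1) =
      ∫ x in Ω, c * (u x * fderiv ℝ φ x (EuclideanSpace.single i 1)) := by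
    refine integral_congr_ae ?_
    filter_upwards [Lp.coeFn_smul c u] with x hx
    rw [hx, Pi.smul_apply, smul_eq_mul, mul_assoc]
  have e2 : ∫ x in Ω, (c • g : L2 Ω) x * φ x = ∫ x in Ω, c * (g x * φ x) := by
    refine integral_congr_ae ?_
    filter_upwards [Lp.coeFn_smul c g] with x hx
    rw [hx, Pi.smul_apply, smul_eq_mul, mul_assoc]
  rw [e1, e2, integral_const_mul, integral_const_mul, h φ hφ hc hs]
  ring

theorem HasWeakPartial.zero (Ω : Set Plane) (i : Fin 2) :
    HasWeakPartial Ω i (0 : L2 Ω) 0 := by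
  intro φ _ _ _
  have e1 : ∫ x in Ω, (0 : L2 Ω) x * fderiv ℝ φ x (EuclideanSpace.single i 1) = 0 := by
    refine integral_eq_zero_of_ae ?_
    filter_upwards [Lp.coeFn_zero ℝ 2 (volume.restrict Ω)] with x hx
    rw [hx]; simp
  have e2 : ∫ x in Ω, (0 : L2 Ω) x * φ x = 0 := by
    refine integral_eq_zero_of_ae ?_
    filter_upwards [Lp.coeFn_zero ℝ 2 (volume.restrict Ω)] with x hx
    rw [hx]; simp
  rw [e1, e2, neg_zero]

/-- On an open set the weak partial derivative is unique. -/
theorem HasWeakPartial.unique {Ω : Set Plane} (hΩ : IsOpen Ω) {i : Fin 2} {u g g' : L2 Ω}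
    (h : HasWeakPartial Ω i u g) (h' : HasWeakPartial Ω i u g') : g = g' := by
  have hint : ∀ f : L2 Ω, LocallyIntegrableOn (f : Plane → ℝ) Ω volume := fun f => by
    have : LocallyIntegrable (f : Plane → ℝ) (volume.restrict Ω) :=
      (Lp.memLp f).locallyIntegrable (by norm_num)
    exact locallyIntegrableOn_of_locallyIntegrable_restrict this
  have key := hΩ.ae_eq_zero_of_integral_contDiff_smul_eq_zero
    ((hint g).sub (hint g')) (fun φ hφ hc hs => by
      have hz : ∀ x, x ∉ Ω → φ x • ((g : Plane → ℝ) - g') x = 0 := fun x hx => by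
        rw [image_eq_zero_of_notMem_tsupport (fun hx' => hx (hs hx')), zero_smul]
      rw [← setIntegral_eq_integral_of_forall_compl_eq_zero hz]
      have e : ∀ x, φ x • ((g : Plane → ℝ) - g') x = g x * φ x - g' x * φ x := fun x => by
        simp only [Pi.sub_apply, smul_eq_mul]; ring
      simp only [e]
      rw [integral_sub (integrable_mul_test g hφ.continuous hc)
        (integrable_mul_test g' hφ.continuous hc)]
      have a1 := h φ hφ hc hs
      have a2 := h' φ hφ hc hs
      linarith)
  refine Lp.ext ?_
  rw [EventuallyEq, ae_restrict_iff' hΩ.measurableSet]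
  filter_upwards [key] with x hx hxΩ
  exact sub_eq_zero.mp (hx hxΩ)

/-- The Sobolev space `H¹(Ω)`. -/
def H1 (Ω : Set Plane) : Submodule ℝ (L2 Ω) where
  carrier := {u | ∀ i, ∃ g, HasWeakPartial Ω i u g}
  add_mem' := fun hu hv i => by
    obtain ⟨g, hg⟩ := hu i
    obtain ⟨g', hg'⟩ := hv i
    exact ⟨g + g', hg.add hg'⟩
  zero_mem' := fun i => ⟨0, HasWeakPartial.zero Ω i⟩
  smul_mem' := fun c u hu i => by
    obtain ⟨g, hg⟩ := hu i
    exact ⟨c • g, hg.smul c⟩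

open Classical in
/-- The weak partial derivative `∂ᵢ u ∈ L²(Ω)` (with value `0` if there is none). -/
def weakPartial {Ω : Set Plane} (i : Fin 2) (u : L2 Ω) : L2 Ω :=
  if h : ∃ g, HasWeakPartial Ω i u g then h.choose else 0

/-- The space `H¹(Ω)²` of vector fields. -/
abbrev VecH1 (Ω : Set Plane) : Type := Fin 2 → H1 Ω

/-- The Sobolev space `H²(Ω)`. -/
def H2 (Ω : Set Plane) : Set (L2 Ω) :=
  {u | u ∈ H1 Ω ∧ ∀ i, weakPartial i u ∈ H1 Ω}

/-- The gradient `H²(Ω) → H¹(Ω)²`. -/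
def grad {Ω : Set Plane} (u : H2 Ω) : VecH1 Ω := fun i => ⟨weakPartial i u.1, u.2.2 i⟩

/-- `rot θ = ∂₁ θ₂ - ∂₂ θ₁` (components numbered from `0` in the code). -/
def rot {Ω : Set Plane} (θ : VecH1 Ω) : L2 Ω :=
  weakPartial 0 (θ 1 : L2 Ω) - weakPartial 1 (θ 0 : L2 Ω)

/-- The norm of `H¹(Ω)²`. -/
def normVecH1 {Ω : Set Plane} (θ : VecH1 Ω) : ℝ :=
  Real.sqrt (∑ i, ‖(θ i : L2 Ω)‖ ^ 2 + ∑ i, ∑ j, ‖weakPartial j (θ i : L2 Ω)‖ ^ 2)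

/-- The norm of `H²(Ω)`. -/
def normH2 {Ω : Set Plane} (u : H2 Ω) : ℝ :=
  Real.sqrt (‖(u : L2 Ω)‖ ^ 2 + ∑ i, ‖weakPartial i (u : L2 Ω)‖ ^ 2 +
    ∑ i, ∑ j, ‖weakPartial j (weakPartial i (u : L2 Ω))‖ ^ 2)

/-- The `L²(Ω)` inner product `(grad u, grad v)`. -/
def gradInner {Ω : Set Plane} (u v : L2 Ω) : ℝ :=
  ∑ i, inner ℝ (weakPartial i u) (weakPartial i v)

/-- The `L²(Ω)` inner product `(θ, grad v)`. -/
def vecInnerGrad {Ω : Set Plane} (θ : VecH1 Ω) (v : L2 Ω) : ℝ :=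
  ∑ i, inner ℝ (θ i : L2 Ω) (weakPartial i v)

/-- The function `u` on `Ω` has boundary trace `g` on `S ⊆ ∂Ω`: for almost every `x ∈ S`
(with respect to arc length) the mean of `|u - g x|` over `Ω ∩ B(x, r)` tends to `0` as `r → 0`.
For `u ∈ H¹(Ω)` and `Ω` Lipschitz, the image of `u` under the trace operator
`H¹(Ω) → L²(∂Ω)` has this property on `∂Ω`, and the property determines it
almost everywhere. -/
def HasTraceOn (Ω : Set Plane) (u : Plane → ℝ) (S : Set Plane) (g : Plane → ℝ) : Prop :=
  ∀ᵐ x ∂((Measure.hausdorffMeasure 1 : Measure Plane).restrict S),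
    Tendsto (fun r : ℝ => ⨍⁻ y, ‖u y - g x‖ₑ ∂(volume.restrict (ball x r ∩ Ω))) (𝓝[>] 0) (𝓝 0)

/-! ### The polygonal domain and its boundary -/

section Polygon

variable {n : ℕ} [NeZero n]

/-- The `i`-th open edge of the closed polygon with vertices `V 0, …, V (n - 1)`
(addition in `Fin n` is cyclic). -/
def edge (V : Fin n → Plane) (i : Fin n) : Set Plane := openSegment ℝ (V i) (V (i + 1))

/-- The unit tangent vector on the `i`-th edge. -/
def tangent (V : Fin n → Plane) (i : Fin n) : Plane :=
  ‖V (i + 1) - V i‖⁻¹ • (V (i + 1) - V i)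

/-- A unit normal vector on the `i`-th edge (the tangent rotated by `-π/2`). -/
def normal (V : Fin n → Plane) (i : Fin n) : Plane := !₂[tangent V i 1, -tangent V i 0]

/-- `Ω` is the simply connected polygonal domain bounded by the simple closed polygon with
vertices `V 0, …, V (n - 1)`. The last condition says that `Ω` has no slits. -/
structure IsPolygonalDomain (Ω : Set Plane) (V : Fin n → Plane) : Prop where
  three_le : 3 ≤ n
  vertices_injective : Function.Injective V
  vertex_notMem_edge : ∀ i j, V j ∉ edge V i
  edges_disjoint : ∀ i j, i ≠ j → Disjoint (edge V i) (edge V j)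
  isOpen : IsOpen Ω
  isBounded : Bornology.IsBounded Ω
  simplyConnected : SimplyConnectedSpace Ω
  frontier_eq : frontier Ω = ⋃ i, segment ℝ (V i) (V (i + 1))
  interior_closure : interior (closure Ω) = Ω

/-- The type of boundary condition prescribed on an edge. -/
inductive BoundaryType where
  | clamped
  | simplySupported
  | free

/-- The union of the open edges that carry the boundary condition `b`: this is
`Γ_c`, `Γ_s` or `Γ_f`. -/
def boundaryPart (V : Fin n → Plane) (bc : Fin n → BoundaryType) (b : BoundaryType) :
    Set Plane := ⋃ i, ⋃ _ : bc i = b, edge V i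

/-- `Γ_cs`, the union of the closures of `Γ_c` and `Γ_s`. -/
def gammaCS (V : Fin n → Plane) (bc : Fin n → BoundaryType) : Set Plane :=
  closure (boundaryPart V bc .clamped) ∪ closure (boundaryPart V bc .simplySupported)

/-- `H²_Γ(Ω)`: the `v ∈ H²(Ω)` with `v = 0` on `Γ_c ∪ Γ_s` and `∂ₙ v = 0` on `Γ_c`. -/
def H2Gamma (Ω : Set Plane) (V : Fin n → Plane) (bc : Fin n → BoundaryType) : Set (H2 Ω) :=
  {v | HasTraceOn Ω (v : L2 Ω)
        (boundaryPart V bc .clamped ∪ boundaryPart V bc .simplySupported) 0 ∧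
      ∀ i, bc i = .clamped →
        HasTraceOn Ω (fun y => ∑ j, normal V i j * (grad v j : L2 Ω) y) (edge V i) 0}

/-- `Θ_Γ(Ω)`: the `θ ∈ H¹(Ω)²` with `θ = 0` on `Γ_c` and `t · θ = 0` on `Γ_s`. -/
def ThetaGamma (Ω : Set Plane) (V : Fin n → Plane) (bc : Fin n → BoundaryType) :
    Set (VecH1 Ω) :=
  {θ | (∀ j, HasTraceOn Ω (θ j : L2 Ω) (boundaryPart V bc .clamped) 0) ∧
      ∀ i, bc i = .simplySupported →
        HasTraceOn Ω (fun y => ∑ j, tangent V i j * (θ j : L2 Ω) y) (edge V i) 0}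

end Polygon

/-! ### Meshes and finite element spaces -/

/-- `T` is a conforming partition of `Ω` into triangles; a triangle is given by the set of its
three vertices. The closed triangles cover `closure Ω`, and two distinct ones meet in the convex
hull of their common vertices, that is, in a common vertex, a common edge or not at all.
(Shape regularity is a condition on families of meshes; each single mesh has it.) -/
structure IsMesh (T : Finset (Finset Plane)) (Ω : Set Plane) : Prop where
  card_eq : ∀ K ∈ T, K.card = 3
  affineIndependent : ∀ K ∈ T, AffineIndependent ℝ (fun x : K => (x : Plane))
  cover : ⋃ K ∈ T, convexHull ℝ (K : Set Plane) = closure Ω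
  conforming : ∀ K ∈ T, ∀ K' ∈ T, K ≠ K' →
    convexHull ℝ (K : Set Plane) ∩ convexHull ℝ (K' : Set Plane) =
      convexHull ℝ ((K : Set Plane) ∩ (K' : Set Plane))

/-- The polynomial function on the plane given by `P`. -/
def polyFun (P : MvPolynomial (Fin 2) ℝ) (x : Plane) : ℝ := MvPolynomial.eval (fun i => x i) P

section Spaces

variable {n : ℕ} [NeZero n]

/-- The Morgan-Scott space `W^p`: `C¹` functions that are polynomials of degree at most `p` on
each triangle. -/
def WSpace (Ω : Set Plane) (T : Finset (Finset Plane)) (p : ℕ) : Set (L2 Ω) :=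
  {v | ∃ f : Plane → ℝ, v =ᵐ[volume.restrict Ω] f ∧ ContDiffOn ℝ 1 f Ω ∧
    ∀ K ∈ T, ∃ P : MvPolynomial (Fin 2) ℝ, P.totalDegree ≤ p ∧
      ∀ x ∈ convexHull ℝ (K : Set Plane), f x = polyFun P x}

/-- `W^p_Γ = W^p ∩ H²_Γ(Ω)`. -/
def WGamma (Ω : Set Plane) (V : Fin n → Plane) (bc : Fin n → BoundaryType)
    (T : Finset (Finset Plane)) (p : ℕ) : Set (H2 Ω) :=
  {v | (v : L2 Ω) ∈ WSpace Ω T p ∧ v ∈ H2Gamma Ω V bc}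

/-- `W̃^p_Γ`: continuous functions that are polynomials of degree at most `p` on each triangle
and vanish on `Γ_cs`. -/
def WTilde (Ω : Set Plane) (V : Fin n → Plane) (bc : Fin n → BoundaryType)
    (T : Finset (Finset Plane)) (p : ℕ) : Set (L2 Ω) :=
  {v | ∃ f : Plane → ℝ, v =ᵐ[volume.restrict Ω] f ∧ ContinuousOn f (closure Ω) ∧
    (∀ K ∈ T, ∃ P : MvPolynomial (Fin 2) ℝ, P.totalDegree ≤ p ∧
      ∀ x ∈ convexHull ℝ (K : Set Plane), f x = polyFun P x) ∧
    ∀ x ∈ gammaCS V bc, f x = 0}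

/-- `G^k_Γ`: the fields in `Θ_Γ(Ω)` whose components are polynomials of degree at most `k` on
each triangle. -/
def GGamma (Ω : Set Plane) (V : Fin n → Plane) (bc : Fin n → BoundaryType)
    (T : Finset (Finset Plane)) (k : ℕ) : Set (VecH1 Ω) :=
  {θ | θ ∈ ThetaGamma Ω V bc ∧
    ∀ K ∈ T, ∀ j, ∃ P : MvPolynomial (Fin 2) ℝ, P.totalDegree ≤ k ∧
      (θ j : L2 Ω) =ᵐ[(volume.restrict Ω).restrict (convexHull ℝ (K : Set Plane))] polyFun P}

/-- The `H²`-conforming Galerkin problem on `W^p_Γ`: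
`w ∈ W^p_Γ` and `a(grad w, grad v) = F(v)` for all `v ∈ W^p_Γ`. The functional `F` is defined on
a linear space `D` of functions. -/
def IsGalerkinSolution (Ω : Set Plane) (V : Fin n → Plane) (bc : Fin n → BoundaryType)
    (T : Finset (Finset Plane)) (p : ℕ) (a : LinearMap.BilinForm ℝ (VecH1 Ω))
    (D : Submodule ℝ (L2 Ω)) (F : D →ₗ[ℝ] ℝ) (hD : ∀ v ∈ H2Gamma Ω V bc, (v : L2 Ω) ∈ D)
    (w : H2 Ω) : Prop :=
  w ∈ WGamma Ω V bc T p ∧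
    ∀ (v : H2 Ω) (hv : v ∈ WGamma Ω V bc T p), a (grad w) (grad v) = F ⟨v, hD v hv.2⟩

/-- The tuple `(z, θ, r, w)` solves the three-step scheme. -/
structure IsSchemeSolution (Ω : Set Plane) (V : Fin n → Plane) (bc : Fin n → BoundaryType)
    (T : Finset (Finset Plane)) (p : ℕ) (a : LinearMap.BilinForm ℝ (VecH1 Ω))
    (D : Submodule ℝ (L2 Ω)) (F : D →ₗ[ℝ] ℝ) (hD : ∀ v ∈ WTilde Ω V bc T p, v ∈ D)
    (z : L2 Ω) (θ : VecH1 Ω) (r : L2 Ω) (w : L2 Ω) : Prop where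
  z_mem : z ∈ WTilde Ω V bc T p
  θ_mem : θ ∈ GGamma Ω V bc T (p - 1)
  r_mem : r ∈ rot '' GGamma Ω V bc T (p - 1)
  w_mem : w ∈ WTilde Ω V bc T p
  poisson : ∀ (v : L2 Ω) (hv : v ∈ WTilde Ω V bc T p), gradInner z v = F ⟨v, hD v hv⟩
  stokes : ∀ ψ ∈ GGamma Ω V bc T (p - 1),
    a θ ψ + inner ℝ (rot ψ) r = vecInnerGrad ψ z
  rot_free : ∀ s ∈ rot '' GGamma Ω V bc T (p - 1), inner ℝ (rot θ) s = 0
  projection : ∀ v ∈ WTilde Ω V bc T p, gradInner w v = vecInnerGrad θ v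

end Spaces

end MorganScott

end

/-!
The gradient maps `W^p_Γ` onto the space of rotation-free fields in `G^{p-1}_Γ`; once this is known,
the theorem is finite-dimensional linear algebra.

*Gradients of Morgan-Scott functions lie in `G^{p-1}_Γ`* (`grad_mem_GGamma`, `rot_grad_eq_zero`).
The weak derivatives of a piecewise polynomial are computed triangle by triangle
(`HasWeakPartial.isPiecewiseAE`). A zero trace of a function that is continuous up to the boundary
holds pointwise (`IsPiecewise.eq_zero_of_hasTraceOn`), so its tangential derivative has zero trace
as well (`hasTraceOn_tangent_of_eq_zero`); on `Γ_c` the normal derivative gives the other component.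

*Every rotation-free field `θ` in `G^{p-1}_Γ` is such a gradient* (`exists_grad_eq`).
- The weak derivatives of a component of `θ` are bounded. Its mollifications are therefore Lipschitz
  with a uniform constant, and the polynomials on the triangles around a point of `Ω` agree there
  (`polyFun_eq_of_mem_H1`).
- At a boundary point `Ω` is locally a connected sector (`IsPolygonalDomain.exists_sector`), and the
  agreement extends to `closure Ω` (`polyFun_eq_of_agree`). So `θ` has a representative that is
  continuous up to the boundary.
- On each triangle `θ` is closed and has a polynomial potential of degree at most `p`
  (`exists_polynomial_potential`). On small balls these fit together after subtraction of constants,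
  and the germs of the local potentials form a covering space of the simply connected `Ω`. It has a
  section (`exists_glue`), which is a global potential (`exists_potential`, `exists_C1_potential`).
- The potential has vanishing tangential derivative along the edges of `Γ_cs`
  (`IsPiecewise.eq_on_segment`), so it is constant on each of them and takes finitely many values on
  the connected set `Γ_cs`. It is constant there, and the constant is normalized to zero.

*Linear algebra.* By coercivity and the above, the form `a` is definite on the rotation-free part of
`G^{p-1}_Γ` (`definite_on_rotFree`), and the Poisson form is definite on `W̃^p_Γ`
(`gradForm_definite`). Definite forms represent functionals (`exists_of_definite`), and a functional
that vanishes on the kernel of `rot` is represented by a multiplier in its range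
(`exists_multiplier`); this gives a solution of the scheme. Conversely, a solution has `rot θ = 0`,
hence `θ = grad u` with `u ∈ W^p_Γ`. Testing the second step with `grad v`, where the multiplier drops
out, and using the first step shows that `u` is the Galerkin solution; the third step returns `u`
(`IsSchemeSolution.exists_galerkin`).
-/

noncomputable section

namespace MorganScott

/-! ### Polynomials in two variables -/

/-- The linear functional on the plane with coefficients `c`. -/
def covec (c : Fin 2 → ℝ) : Plane →L[ℝ] ℝ := ∑ i, c i • EuclideanSpace.proj i

theorem covec_apply (c : Fin 2 → ℝ) (v : Plane) : covec c v = ∑ i, c i * v i := by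
  simp [covec]

theorem covec_single (c : Fin 2 → ℝ) (i : Fin 2) : covec c (EuclideanSpace.single i 1) = c i := by
  rw [covec_apply]
  simp

theorem continuous_covec : Continuous covec := by
  unfold covec
  fun_prop

/-- The differential of `polyFun P` at `x`. -/
def polyDiff (P : MvPolynomial (Fin 2) ℝ) (x : Plane) : Plane →L[ℝ] ℝ :=
  covec fun i => polyFun (MvPolynomial.pderiv i P) x

theorem polyFun_add (P Q : MvPolynomial (Fin 2) ℝ) (x : Plane) :
    polyFun (P + Q) x = polyFun P x + polyFun Q x := by
  simp [polyFun]

theorem polyFun_sub (P Q : MvPolynomial (Fin 2) ℝ) (x : Plane) :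
    polyFun (P - Q) x = polyFun P x - polyFun Q x := by
  simp [polyFun]

theorem polyFun_C (c : ℝ) (x : Plane) : polyFun (MvPolynomial.C c) x = c := by
  simp [polyFun]

theorem polyFun_smul (c : ℝ) (P : MvPolynomial (Fin 2) ℝ) (x : Plane) :
    polyFun (c • P) x = c * polyFun P x := by
  simp [polyFun, MvPolynomial.smul_eval]

theorem hasFDerivAt_polyFun (P : MvPolynomial (Fin 2) ℝ) (x : Plane) :
    HasFDerivAt (polyFun P) (polyDiff P x) x := by
  induction P using MvPolynomial.induction_on with
  | C a =>
    have h : polyFun (MvPolynomial.C a) = fun _ => a := funext fun y => polyFun_C a y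
    have h' : polyDiff (MvPolynomial.C a) x = 0 := by
      ext v
      simp [polyDiff, covec_apply, polyFun]
    rw [h, h']
    exact hasFDerivAt_const a x
  | add P Q hP hQ =>
    have h : polyFun (P + Q) = fun y => polyFun P y + polyFun Q y :=
      funext fun y => polyFun_add P Q y
    have h' : polyDiff (P + Q) x = polyDiff P x + polyDiff Q x := by
      ext v
      simp only [polyDiff, covec_apply, map_add, polyFun_add, _root_.add_apply,
        add_mul, Finset.sum_add_distrib]
    rw [h, h']
    exact hP.add hQ
  | mul_X P j hP =>
    have h : polyFun (P * MvPolynomial.X j) = fun y => polyFun P y * y j :=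
      funext fun y => by simp [polyFun]
    have h' : polyDiff (P * MvPolynomial.X j) x =
        polyFun P x • (EuclideanSpace.proj j : Plane →L[ℝ] ℝ) + x j • polyDiff P x := by
      ext v
      simp only [polyDiff, covec_apply, MvPolynomial.pderiv_mul, polyFun, map_add, map_mul,
        MvPolynomial.eval_X, _root_.add_apply, _root_.smul_apply,
        smul_eq_mul, PiLp.proj_apply, Fin.sum_univ_two, MvPolynomial.pderiv_X]
      fin_cases j <;> simp <;> ring
    rw [h, h']
    exact hP.mul (EuclideanSpace.proj j : Plane →L[ℝ] ℝ).hasFDerivAt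

theorem continuous_polyFun (P : MvPolynomial (Fin 2) ℝ) : Continuous (polyFun P) :=
  continuous_iff_continuousAt.2 fun x => (hasFDerivAt_polyFun P x).continuousAt

theorem fderiv_polyFun (P : MvPolynomial (Fin 2) ℝ) : fderiv ℝ (polyFun P) = polyDiff P :=
  funext fun x => (hasFDerivAt_polyFun P x).fderiv

theorem continuous_polyDiff (P : MvPolynomial (Fin 2) ℝ) : Continuous (polyDiff P) :=
  continuous_covec.comp (continuous_pi fun _ => continuous_polyFun _)

theorem contDiff_polyFun (P : MvPolynomial (Fin 2) ℝ) : ContDiff ℝ 1 (polyFun P) := by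
  rw [contDiff_one_iff_fderiv, fderiv_polyFun]
  exact ⟨fun x => (hasFDerivAt_polyFun P x).differentiableAt, continuous_polyDiff P⟩

theorem totalDegree_pderiv_le {P : MvPolynomial (Fin 2) ℝ} {k : ℕ} (h : P.totalDegree ≤ k)
    (i : Fin 2) : (MvPolynomial.pderiv i P).totalDegree ≤ k - 1 := by
  rw [MvPolynomial.totalDegree, Finset.sup_le_iff]
  intro m hm
  rw [MvPolynomial.mem_support_iff, MvPolynomial.coeff_pderiv] at hm
  have h1 : m + Finsupp.single i 1 ∈ P.support :=
    MvPolynomial.mem_support_iff.2 fun h0 => hm (by rw [h0]; simp)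
  have h2 := MvPolynomial.le_totalDegree h1
  rw [Finsupp.sum_add_index' (fun _ => rfl) (fun _ _ _ => rfl)] at h2
  simp only [Finsupp.sum_single_index] at h2
  omega

/-- The antiderivative of a polynomial in the variable `i` without terms free of that variable. -/
def polyInt (i : Fin 2) : MvPolynomial (Fin 2) ℝ →ₗ[ℝ] MvPolynomial (Fin 2) ℝ :=
  (MvPolynomial.basisMonomials (Fin 2) ℝ).constr ℝ fun m =>
    MvPolynomial.monomial (m + Finsupp.single i 1) ((m i : ℝ) + 1)⁻¹

theorem polyInt_monomial (i : Fin 2) (m : Fin 2 →₀ ℕ) (c : ℝ) :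
    polyInt i (MvPolynomial.monomial m c) =
      MvPolynomial.monomial (m + Finsupp.single i 1) (c * ((m i : ℝ) + 1)⁻¹) := by
  have h : MvPolynomial.monomial m c = c • MvPolynomial.basisMonomials (Fin 2) ℝ m := by
    simp [MvPolynomial.smul_monomial]
  rw [h, map_smul, polyInt, Module.Basis.constr_basis, MvPolynomial.smul_monomial, smul_eq_mul]

theorem pderiv_polyInt (i : Fin 2) (P : MvPolynomial (Fin 2) ℝ) :
    MvPolynomial.pderiv i (polyInt i P) = P := by
  induction P using MvPolynomial.induction_on' with
  | monomial m c =>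
    rw [polyInt_monomial, MvPolynomial.pderiv_monomial]
    have h : ((m i : ℝ) + 1) ≠ 0 := by positivity
    simp [mul_assoc, inv_mul_cancel₀ h]
  | add P Q hP hQ => rw [map_add, map_add, hP, hQ]

theorem pderiv_polyInt_comm {i j : Fin 2} (hij : i ≠ j) (P : MvPolynomial (Fin 2) ℝ) :
    MvPolynomial.pderiv j (polyInt i P) = polyInt i (MvPolynomial.pderiv j P) := by
  induction P using MvPolynomial.induction_on' with
  | monomial m c =>
    rw [polyInt_monomial, MvPolynomial.pderiv_monomial, MvPolynomial.pderiv_monomial,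
      polyInt_monomial]
    have h1 : (m + Finsupp.single i 1 : Fin 2 →₀ ℕ) j = m j := by simp [hij]
    have h2 : (m - Finsupp.single j 1 : Fin 2 →₀ ℕ) i = m i := by simp [hij.symm]
    rw [h1, h2]
    rcases Nat.eq_zero_or_pos (m j) with h0 | h0
    · simp [h0]
    · have h3 : m + Finsupp.single i 1 - Finsupp.single j 1 =
          m - Finsupp.single j 1 + Finsupp.single i 1 := by
        ext l
        simp only [Finsupp.coe_tsub, Finsupp.coe_add, Pi.sub_apply, Pi.add_apply,
          Finsupp.single_apply]
        split_ifs <;> subst_vars <;> omega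
      rw [h3]
      congr 1
      ring
  | add P Q hP hQ => simp only [map_add, hP, hQ]

theorem totalDegree_polyInt_le {P : MvPolynomial (Fin 2) ℝ} {k : ℕ} (h : P.totalDegree ≤ k)
    (i : Fin 2) : (polyInt i P).totalDegree ≤ k + 1 := by
  rw [P.as_sum, map_sum]
  refine MvPolynomial.totalDegree_finsetSum_le fun m hm => ?_
  rw [polyInt_monomial]
  refine (MvPolynomial.totalDegree_monomial_le _ _).trans ?_
  rw [Finsupp.sum_add_index' (fun _ => rfl) (fun _ _ _ => rfl)]
  have hm' : (m.sum fun _ => id) ≤ k := (MvPolynomial.le_totalDegree hm).trans h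
  simpa [Finsupp.sum_single_index] using hm'

/-- A closed polynomial vector field is the gradient of a polynomial. -/
theorem exists_polynomial_potential {P : Fin 2 → MvPolynomial (Fin 2) ℝ} {k : ℕ}
    (hdeg : ∀ i, (P i).totalDegree ≤ k)
    (hclosed : MvPolynomial.pderiv 0 (P 1) = MvPolynomial.pderiv 1 (P 0)) :
    ∃ Q : MvPolynomial (Fin 2) ℝ, Q.totalDegree ≤ k + 1 ∧
      ∀ i, MvPolynomial.pderiv i Q = P i := by
  -- integrate in the first variable; the error in the second one does not depend on the first
  set Q₀ := polyInt 0 (P 0) with hQ₀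
  set R := P 1 - MvPolynomial.pderiv 1 Q₀ with hR
  have hR0 : MvPolynomial.pderiv 0 R = 0 := by
    rw [hR, map_sub, hclosed, hQ₀, pderiv_polyInt_comm (by decide), pderiv_polyInt, sub_self]
  have hQdeg : Q₀.totalDegree ≤ k + 1 := totalDegree_polyInt_le (hdeg 0) 0
  have hRdeg : R.totalDegree ≤ k :=
    (MvPolynomial.totalDegree_sub _ _).trans
      (max_le (hdeg 1) (by simpa using totalDegree_pderiv_le hQdeg 1))
  refine ⟨Q₀ + polyInt 1 R, ?_, fun i => ?_⟩
  · exact (MvPolynomial.totalDegree_add _ _).trans (max_le hQdeg (totalDegree_polyInt_le hRdeg 1))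
  · fin_cases i
    · change MvPolynomial.pderiv 0 _ = P 0
      rw [map_add, hQ₀, pderiv_polyInt, pderiv_polyInt_comm (by decide), hR0, map_zero, add_zero]
    · change MvPolynomial.pderiv 1 _ = P 1
      rw [map_add, pderiv_polyInt, hR]
      ring

/-- Two polynomials that agree on a nonempty open set are equal. -/
theorem polynomial_eq_of_eqOn_open {P Q : MvPolynomial (Fin 2) ℝ} {U : Set Plane}
    (hU : IsOpen U) (hne : U.Nonempty) (h : ∀ x ∈ U, polyFun P x = polyFun Q x) : P = Q := by
  obtain ⟨x, hx⟩ := hne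
  have hU' : IsOpen (WithLp.toLp 2 ⁻¹' U : Set (Fin 2 → ℝ)) :=
    hU.preimage (PiLp.continuous_toLp 2 _)
  have hx' : WithLp.ofLp x ∈ (WithLp.toLp 2 ⁻¹' U : Set (Fin 2 → ℝ)) := hx
  obtain ⟨ε, hε, hb⟩ := Metric.isOpen_iff.1 hU' _ hx'
  refine MvPolynomial.funext_set (fun i => ball (x i) ε) (fun i => ?_) fun y hy => ?_
  · rw [Real.ball_eq_Ioo]
    exact Set.Ioo_infinite (by linarith)
  · have hy' : y ∈ ball (WithLp.ofLp x) ε := by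
      rw [ball_pi _ hε]
      exact hy
    exact h _ (hb hy')

/-! ### Finite closed covers -/

section ClosedCover

variable {ι : Type*} {T : Finset ι}

theorem continuousOn_biUnion_finset {X Y : Type*} [TopologicalSpace X] [TopologicalSpace Y]
    {C : ι → Set X} {f : X → Y} (hC : ∀ K ∈ T, IsClosed (C K))
    (hf : ∀ K ∈ T, ContinuousOn f (C K)) : ContinuousOn f (⋃ K ∈ T, C K) := by
  have h : (⋃ K ∈ T, C K) = ⋃ K : T, C K := by
    ext x
    simp
  rw [h]
  exact (locallyFinite_of_finite _).continuousOn_iUnion (fun K => hC K K.2) fun K => hf K K.2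

theorem hasFDerivWithinAt_biUnion_finset {E F : Type*} [NormedAddCommGroup E] [NormedSpace ℝ E]
    [NormedAddCommGroup F] [NormedSpace ℝ F] {C : ι → Set E} {f : E → F} {f' : E →L[ℝ] F} {x : E}
    (hC : ∀ K ∈ T, IsClosed (C K)) (hf : ∀ K ∈ T, x ∈ C K → HasFDerivWithinAt f f' (C K) x) :
    HasFDerivWithinAt f f' (⋃ K ∈ T, C K) x := by
  classical
  induction T using Finset.induction_on with
  | empty => simp
  | insert K T _ ih =>
    rw [Finset.set_biUnion_insert]
    refine HasFDerivWithinAt.union ?_ (ih (fun K' hK' => hC K' (Finset.mem_insert_of_mem hK'))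
      fun K' hK' => hf K' (Finset.mem_insert_of_mem hK'))
    by_cases hx : x ∈ C K
    · exact hf K (Finset.mem_insert_self _ _) hx
    · refine HasFDerivWithinAt.of_notMem_closure ?_
      rwa [(hC K (Finset.mem_insert_self _ _)).closure_eq]

/-- Points near `x` lie only in those members of a finite family of closed sets that contain
`x`. -/
theorem eventually_mem_imp_mem {X : Type*} [TopologicalSpace X] {C : ι → Set X}
    (hC : ∀ K ∈ T, IsClosed (C K)) (x : X) : ∀ᶠ y in 𝓝 x, ∀ K ∈ T, y ∈ C K → x ∈ C K := by
  rw [Filter.eventually_all_finset]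
  intro K hK
  by_cases hx : x ∈ C K
  · exact Eventually.of_forall fun _ _ => hx
  · filter_upwards [(hC K hK).isOpen_compl.mem_nhds hx] with y hy hy'
    exact absurd hy' hy

/-- A function that is `L`-Lipschitz on each of finitely many closed sets covering a segment is
`L`-Lipschitz along that segment. -/
theorem abs_sub_le_of_segment_subset {E : Type*} [NormedAddCommGroup E] [NormedSpace ℝ E]
    {C : ι → Set E} {f : E → ℝ} {L : ℝ} (hC : ∀ K ∈ T, IsClosed (C K))
    (hf : ∀ K ∈ T, ∀ x ∈ C K, ∀ y ∈ C K, |f x - f y| ≤ L * dist x y) {x y : E}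
    (hxy : segment ℝ x y ⊆ ⋃ K ∈ T, C K) : |f x - f y| ≤ L * dist x y := by
  set γ : ℝ → E := ⇑(AffineMap.lineMap (k := ℝ) x y) with hγ
  have hγc : Continuous γ := AffineMap.lineMap_continuous
  have hγm : ∀ t ∈ Set.Icc (0 : ℝ) 1, γ t ∈ ⋃ K ∈ T, C K := fun t ht =>
    hxy (by rw [segment_eq_image_lineMap ℝ x y]; exact ⟨t, ht, rfl⟩)
  have hγd : ∀ s t, dist (γ s) (γ t) = |s - t| * dist x y := fun s t => by
    rw [hγ, dist_lineMap_lineMap, Real.dist_eq]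
  have hfc : ContinuousOn f (⋃ K ∈ T, C K) := by
    refine continuousOn_biUnion_finset hC fun K hK => ?_
    have hL : LipschitzOnWith (Real.toNNReal L) f (C K) := by
      refine LipschitzOnWith.of_dist_le_mul fun u hu v hv => ?_
      rw [Real.dist_eq]
      refine (hf K hK u hu v hv).trans ?_
      gcongr
      exact Real.le_coe_toNNReal L
    exact hL.continuousOn
  have hfγ : ContinuousOn (fun t => f (γ t)) (Set.Icc 0 1) := hfc.comp hγc.continuousOn hγm
  -- continuous induction along the segment
  have hsub : Set.Icc (0 : ℝ) 1 ⊆ {t | |f (γ t) - f x| ≤ L * dist x y * t} := by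
    refine IsClosed.Icc_subset_of_forall_exists_gt ?_ ?_ ?_
    · have := (isClosed_Icc (a := (0 : ℝ)) (b := 1)).isClosed_le
        ((hfγ.sub continuousOn_const).abs : ContinuousOn (fun t => |f (γ t) - f x|) _)
        (by fun_prop : ContinuousOn (fun t => L * dist x y * t) (Set.Icc 0 1))
      convert this using 1
      ext t
      simp only [Set.mem_inter_iff, Set.mem_ofPred_eq]
      tauto
    · simp [hγ]
    · rintro t ⟨ht, ht0, ht1⟩ z (hz : t < z)
      -- some member of the cover contains points arbitrarily close to `γ t` on its right
      have hK : ∃ K ∈ T, ∃ᶠ s in 𝓝[>] t, γ s ∈ C K := by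
        by_contra hcon
        have hall : ∀ᶠ s in 𝓝[>] t, ∀ K ∈ T, γ s ∉ C K := by
          rw [Filter.eventually_all_finset]
          intro K hK
          by_contra h
          exact hcon ⟨K, hK, h⟩
        obtain ⟨s, hs, hs'⟩ := (hall.and (Ioo_mem_nhdsGT ht1)).exists
        have := hγm s ⟨ht0.trans hs'.1.le, hs'.2.le⟩
        simp only [Set.mem_iUnion] at this
        obtain ⟨K, hK, hsK⟩ := this
        exact hs K hK hsK
      obtain ⟨K, hK, hfr⟩ := hK
      have htK : γ t ∈ C K := by
        have : γ t ∈ closure (C K) := by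
          rw [mem_closure_iff_frequently]
          exact (hγc.tendsto t).frequently (hfr.filter_mono nhdsWithin_le_nhds)
        rwa [(hC K hK).closure_eq] at this
      obtain ⟨s, hsK, hs⟩ := (hfr.and_eventually (Ioo_mem_nhdsGT hz)).exists
      refine ⟨s, ?_, hs.1, hs.2.le⟩
      have h1 := hf K hK _ hsK _ htK
      rw [hγd, abs_of_pos (sub_pos.2 hs.1)] at h1
      have h2 := abs_sub_le (f (γ s)) (f (γ t)) (f x)
      simp only [Set.mem_ofPred_eq] at ht ⊢
      nlinarith
  have h1 := hsub (Set.right_mem_Icc.2 zero_le_one)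
  simp only [Set.mem_ofPred_eq, hγ, AffineMap.lineMap_apply_one, mul_one] at h1
  rwa [abs_sub_comm]

theorem eq_of_isPreconnected_of_finite_image {X : Type*} [TopologicalSpace X] {S : Set X}
    (hS : IsPreconnected S) {f : X → ℝ} (hf : ContinuousOn f S) (hfin : (f '' S).Finite) {x y : X}
    (hx : x ∈ S) (hy : y ∈ S) : f x = f y :=
  hS.constant_of_mapsTo hfin.isDiscrete hf (Set.mapsTo_image f S) hx hy

end ClosedCover

/-! ### Triangles of a mesh -/

/-- The closed triangle with vertex set `K`. -/
abbrev tri (K : Finset Plane) : Set Plane := convexHull ℝ (K : Set Plane)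

theorem isCompact_tri (K : Finset Plane) : IsCompact (tri K) :=
  Set.Finite.isCompact_convexHull (𝕜 := ℝ) K.finite_toSet

theorem isClosed_tri (K : Finset Plane) : IsClosed (tri K) := (isCompact_tri K).isClosed

theorem convex_tri (K : Finset Plane) : Convex ℝ (tri K) := convex_convexHull ℝ _

theorem volume_tri_diff_interior (K : Finset Plane) : volume (tri K \ interior (tri K)) = 0 := by
  have h := (convex_tri K).addHaar_frontier (volume : Measure Plane)
  rwa [frontier, (isClosed_tri K).closure_eq] at h

namespace IsMesh

variable {T : Finset (Finset Plane)} {Ω : Set Plane} {K : Finset Plane}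

theorem interior_nonempty (hT : IsMesh T Ω) (hK : K ∈ T) : (interior (tri K)).Nonempty := by
  rw [interior_convexHull_nonempty_iff_affineSpan_eq_top]
  have h := (hT.affineIndependent K hK).affineSpan_eq_top_iff_card_eq_finrank_add_one.2
    (by simp [hT.card_eq K hK])
  simpa using h

theorem closure_interior (hT : IsMesh T Ω) (hK : K ∈ T) : closure (interior (tri K)) = tri K := by
  rw [(convex_tri K).closure_interior_eq_closure_of_nonempty_interior (hT.interior_nonempty hK),
    (isClosed_tri K).closure_eq]

theorem tri_subset (hT : IsMesh T Ω) (hK : K ∈ T) : tri K ⊆ closure Ω := by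
  rw [← hT.cover]
  exact Set.subset_biUnion_of_mem (u := fun K : Finset Plane => tri K) hK

theorem interior_subset (hT : IsMesh T Ω) (hΩ : interior (closure Ω) = Ω) (hK : K ∈ T) :
    interior (tri K) ⊆ Ω := by
  rw [← hΩ]
  exact interior_mono (hT.tri_subset hK)

theorem exists_mem (hT : IsMesh T Ω) {x : Plane} (hx : x ∈ closure Ω) : ∃ K ∈ T, x ∈ tri K := by
  rw [← hT.cover] at hx
  simpa using hx

theorem ae_exists_mem_interior (hT : IsMesh T Ω) :
    ∀ᵐ x ∂(volume : Measure Plane), x ∈ closure Ω → ∃ K ∈ T, x ∈ interior (tri K) := by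
  have h : ∀ᵐ x ∂(volume : Measure Plane), ∀ K ∈ T, x ∉ tri K \ interior (tri K) := by
    rw [Filter.eventually_all_finset]
    exact fun K _ => measure_eq_zero_iff_ae_notMem.1 (volume_tri_diff_interior K)
  filter_upwards [h] with x hx hxΩ
  obtain ⟨K, hK, hxK⟩ := hT.exists_mem hxΩ
  exact ⟨K, hK, by_contra fun hn => hx K hK ⟨hxK, hn⟩⟩

theorem ae_of_ae_interior (hT : IsMesh T Ω) (hΩo : IsOpen Ω) {p : Plane → Prop}
    (h : ∀ K ∈ T, ∀ᵐ x ∂(volume : Measure Plane), x ∈ interior (tri K) → p x) :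
    ∀ᵐ x ∂(volume.restrict Ω), p x := by
  rw [ae_restrict_iff' hΩo.measurableSet]
  filter_upwards [hT.ae_exists_mem_interior, (Filter.eventually_all_finset T).2 h]
    with x hx h' hxΩ
  obtain ⟨K, hK, hxK⟩ := hx (subset_closure hxΩ)
  exact h' K hK hxK

end IsMesh

/-- `f` agrees with the polynomial `P K` on every closed triangle `K` of the mesh. -/
def IsPiecewise (T : Finset (Finset Plane)) (P : Finset Plane → MvPolynomial (Fin 2) ℝ)
    (f : Plane → ℝ) : Prop := ∀ K ∈ T, ∀ x ∈ tri K, f x = polyFun (P K) x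

/-- `f` agrees almost everywhere in `Ω` with the polynomial `P K` on every triangle `K` of the
mesh. -/
def IsPiecewiseAE (T : Finset (Finset Plane)) (Ω : Set Plane)
    (P : Finset Plane → MvPolynomial (Fin 2) ℝ) (f : Plane → ℝ) : Prop :=
  ∀ K ∈ T, ∀ᵐ x ∂(volume.restrict Ω), x ∈ tri K → f x = polyFun (P K) x

section Piecewise

variable {T : Finset (Finset Plane)} {Ω : Set Plane} {P : Finset Plane → MvPolynomial (Fin 2) ℝ}
  {f : Plane → ℝ}

theorem IsPiecewise.continuousOn (hT : IsMesh T Ω) (hf : IsPiecewise T P f) :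
    ContinuousOn f (closure Ω) := by
  rw [← hT.cover]
  exact continuousOn_biUnion_finset (fun K _ => isClosed_tri K) fun K hK =>
    (continuous_polyFun (P K)).continuousOn.congr (hf K hK)

theorem IsPiecewise.hasFDerivAt_interior (hf : IsPiecewise T P f) {K : Finset Plane} (hK : K ∈ T)
    {x : Plane} (hx : x ∈ interior (tri K)) : HasFDerivAt f (polyDiff (P K) x) x :=
  (hasFDerivAt_polyFun (P K) x).congr_of_eventuallyEq
    (by filter_upwards [mem_interior_iff_mem_nhds.1 hx] with y hy using hf K hK y hy)

/-- If the differentials of the pieces agree at an inner point, then `f` is differentiable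
there. -/
theorem IsPiecewise.hasFDerivAt (hT : IsMesh T Ω) (hf : IsPiecewise T P f) {x : Plane}
    (hx : closure Ω ∈ 𝓝 x) {f' : Plane →L[ℝ] ℝ} (h : ∀ K ∈ T, x ∈ tri K → polyDiff (P K) x = f') :
    HasFDerivAt f f' x := by
  refine HasFDerivWithinAt.hasFDerivAt ?_ hx
  rw [← hT.cover]
  refine hasFDerivWithinAt_biUnion_finset (fun K _ => isClosed_tri K) fun K hK hxK => ?_
  rw [← h K hK hxK]
  exact (hasFDerivAt_polyFun (P K) x).hasFDerivWithinAt.congr (hf K hK) (hf K hK x hxK)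

end Piecewise

/-! ### Weak derivatives of piecewise polynomials -/

theorem exists_abs_le_on_tri (T : Finset (Finset Plane)) {G : Finset Plane → Plane → ℝ}
    (hG : ∀ K ∈ T, Continuous (G K)) :
    ∃ C : ℝ, 0 ≤ C ∧ ∀ K ∈ T, ∀ x ∈ tri K, |G K x| ≤ C := by
  have h : ∀ K ∈ T, ∃ C : ℝ, ∀ x ∈ tri K, |G K x| ≤ C := fun K hK => by
    obtain ⟨C, hC⟩ := (isCompact_tri K).exists_bound_of_continuousOn (hG K hK).continuousOn
    exact ⟨C, hC⟩
  choose! c hc using h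
  refine ⟨∑ K ∈ T, |c K|, Finset.sum_nonneg fun _ _ => abs_nonneg _, fun K hK x hx => ?_⟩
  exact ((hc K hK x hx).trans (le_abs_self _)).trans
    (Finset.single_le_sum (f := fun K => |c K|) (fun _ _ => abs_nonneg _) hK)

theorem exists_lipschitz_on_tri (T : Finset (Finset Plane)) {G : Finset Plane → Plane → ℝ}
    (hG : ∀ K ∈ T, ContDiff ℝ 1 (G K)) :
    ∃ L : ℝ, 0 ≤ L ∧ ∀ K ∈ T, ∀ x ∈ tri K, ∀ y ∈ tri K, |G K x - G K y| ≤ L * dist x y := by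
  obtain ⟨L, hL0, hL⟩ := exists_abs_le_on_tri T (G := fun K x => ‖fderiv ℝ (G K) x‖)
    fun K hK => ((hG K hK).continuous_fderiv (by simp)).norm
  refine ⟨L, hL0, fun K hK x hx y hy => ?_⟩
  have := (convex_tri K).norm_image_sub_le_of_norm_fderiv_le (𝕜 := ℝ) (f := G K) (C := L)
    (fun z _ => ((hG K hK).differentiable (by simp)) z)
    (fun z hz => by simpa using hL K hK z hz) hy hx
  rwa [Real.norm_eq_abs, ← dist_eq_norm] at this

section PiecewiseDerivative

variable {T : Finset (Finset Plane)} {Ω : Set Plane} {P : Finset Plane → MvPolynomial (Fin 2) ℝ}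

theorem isPiecewiseAE_of_ae_interior {f : Plane → ℝ}
    (h : ∀ K ∈ T, ∀ᵐ x ∂(volume : Measure Plane), x ∈ interior (tri K) → f x = polyFun (P K) x) :
    IsPiecewiseAE T Ω P f := by
  intro K hK
  refine ae_restrict_of_ae ?_
  filter_upwards [h K hK, measure_eq_zero_iff_ae_notMem.1 (volume_tri_diff_interior K)]
    with x hx hx' hxK
  exact hx (by_contra fun hn => hx' ⟨hxK, hn⟩)

theorem IsPiecewise.isPiecewiseAE {f : Plane → ℝ} (hf : IsPiecewise T P f) {u : Plane → ℝ}
    (hu : u =ᵐ[volume.restrict Ω] f) : IsPiecewiseAE T Ω P u := by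
  intro K hK
  filter_upwards [hu] with x hx hxK
  rw [hx, hf K hK x hxK]

theorem locallyIntegrableOn_L2 (f : L2 Ω) : LocallyIntegrableOn (f : Plane → ℝ) Ω volume := by
  have : LocallyIntegrable (f : Plane → ℝ) (volume.restrict Ω) :=
    (Lp.memLp f).locallyIntegrable (by norm_num)
  exact locallyIntegrableOn_of_locallyIntegrable_restrict this

/-- The weak derivative of a piecewise polynomial function is computed piecewise. -/
theorem HasWeakPartial.isPiecewiseAE (hT : IsMesh T Ω) (hΩ : interior (closure Ω) = Ω)
    {i : Fin 2} {u g : L2 Ω} (h : HasWeakPartial Ω i u g)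
    (hu : IsPiecewiseAE T Ω P u) :
    IsPiecewiseAE T Ω (fun K => MvPolynomial.pderiv i (P K)) g := by
  refine isPiecewiseAE_of_ae_interior fun K hK => ?_
  set U := interior (tri K) with hU
  set R := MvPolynomial.pderiv i (P K) with hR
  set e : Plane := EuclideanSpace.single i 1 with he
  have hUΩ : U ⊆ Ω := hT.interior_subset hΩ hK
  have hloc : LocallyIntegrableOn (fun x => g x - polyFun R x) U volume :=
    ((locallyIntegrableOn_L2 g).mono_set hUΩ).sub
      ((continuous_polyFun R).locallyIntegrable.locallyIntegrableOn U)
  have key := isOpen_interior.ae_eq_zero_of_integral_contDiff_smul_eq_zero hloc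
    fun φ hφ hc hs => ?_
  · filter_upwards [key] with x hx hxU
    exact sub_eq_zero.1 (hx hxU)
  have hφ0 : ∀ x, x ∉ U → φ x = 0 := fun x hx =>
    image_eq_zero_of_notMem_tsupport fun h' => hx (hs h')
  have hdφ0 : ∀ x, x ∉ U → fderiv ℝ φ x e = 0 := fun x hx => by
    have : fderiv ℝ φ x = 0 := by
      by_contra h0
      exact hx (hs (support_fderiv_subset ℝ h0))
    rw [this]
    rfl
  have hdc : Continuous fun x => fderiv ℝ φ x e :=
    (hφ.continuous_fderiv (by simp)).clm_apply continuous_const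
  have hdcs : HasCompactSupport fun x => fderiv ℝ φ x e := hc.fderiv_apply (𝕜 := ℝ) e
  have hPd : ∀ x, fderiv ℝ (polyFun (P K)) x e = polyFun R x := fun x => by
    rw [fderiv_polyFun, polyDiff, he, covec_single]
  have hRφ : Integrable (fun x => polyFun R x * φ x) volume :=
    ((continuous_polyFun R).mul hφ.continuous).integrable_of_hasCompactSupport hc.mul_left
  -- integration by parts for the polynomial
  have hparts : ∫ x, polyFun (P K) x * fderiv ℝ φ x e = -∫ x, polyFun R x * φ x := by
    have := integral_mul_fderiv_eq_neg_fderiv_mul_of_integrable (𝕜 := ℝ) (μ := volume)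
      (f := polyFun (P K)) (g := φ) (v := e) ?_ ?_ ?_
      (fun x _ => (hasFDerivAt_polyFun (P K) x).differentiableAt)
      (fun x _ => hφ.differentiable (by simp) x)
    · simpa only [hPd] using this
    · simp only [hPd]
      exact hRφ
    · exact ((continuous_polyFun _).mul hdc).integrable_of_hasCompactSupport hdcs.mul_left
    · exact ((continuous_polyFun _).mul hφ.continuous).integrable_of_hasCompactSupport hc.mul_left
  have h1 := h φ hφ hc (hs.trans hUΩ)
  have h2 : ∫ x in Ω, u x * fderiv ℝ φ x e = ∫ x, polyFun (P K) x * fderiv ℝ φ x e := by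
    rw [← setIntegral_eq_integral_of_forall_compl_eq_zero (s := Ω)
      (f := fun x => polyFun (P K) x * fderiv ℝ φ x e)
      fun x hx => by rw [hdφ0 x fun h' => hx (hUΩ h'), mul_zero]]
    refine integral_congr_ae ?_
    filter_upwards [hu K hK] with x hx
    by_cases hxU : x ∈ U
    · simp only [hx (interior_subset hxU)]
    · simp only [hdφ0 x hxU, mul_zero]
  have h3 : ∫ x, φ x • (g x - polyFun R x) =
      (∫ x in Ω, g x * φ x) - ∫ x, polyFun R x * φ x := by
    rw [← setIntegral_eq_integral_of_forall_compl_eq_zero (s := Ω) (f := fun x => polyFun R x * φ x)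
      fun x hx => by rw [hφ0 x fun h' => hx (hUΩ h'), mul_zero],
      ← setIntegral_eq_integral_of_forall_compl_eq_zero (s := Ω)
        (f := fun x => φ x • (g x - polyFun R x))
      fun x hx => by rw [hφ0 x fun h' => hx (hUΩ h'), zero_smul],
      ← integral_sub (integrable_mul_test g hφ.continuous hc) hRφ.restrict]
    refine integral_congr_ae (Eventually.of_forall fun x => ?_)
    simp only [smul_eq_mul]
    ring
  rw [h3]
  rw [h2, hparts] at h1
  linarith

/-- A continuous piecewise polynomial function has weak derivatives in `L²`: its product with a
test function is Lipschitz on the whole plane, so that the integral of the derivative of the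
product vanishes. -/
theorem IsPiecewise.exists_hasWeakPartial (hT : IsMesh T Ω)
    (hΩo : IsOpen Ω) (hΩb : Bornology.IsBounded Ω) {f : Plane → ℝ} (hf : IsPiecewise T P f)
    {u : L2 Ω} (hu : u =ᵐ[volume.restrict Ω] f) (i : Fin 2) : ∃ g, HasWeakPartial Ω i u g := by
  set e : Plane := EuclideanSpace.single i 1 with he
  have hfin : IsFiniteMeasure (volume.restrict Ω : Measure Plane) :=
    ⟨by rw [Measure.restrict_apply_univ]; exact hΩb.measure_lt_top⟩
  obtain ⟨C, hC0, hC⟩ := exists_abs_le_on_tri T (G := fun K => polyFun (MvPolynomial.pderiv i (P K)))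
    fun K _ => continuous_polyFun _
  have hmem : MemLp (fun x => fderiv ℝ f x e) 2 (volume.restrict Ω) := by
    refine MemLp.of_bound (measurable_fderiv_apply_const ℝ f e).aestronglyMeasurable C ?_
    refine hT.ae_of_ae_interior hΩo fun K hK => Eventually.of_forall fun x hx => ?_
    rw [(hf.hasFDerivAt_interior hK hx).fderiv, polyDiff, he, covec_single]
    exact hC K hK x (interior_subset hx)
  refine ⟨hmem.toLp _, fun φ hφ hc hs => ?_⟩
  have hφ0 : ∀ x, x ∉ Ω → φ x = 0 := fun x hx =>
    image_eq_zero_of_notMem_tsupport fun h' => hx (hs h')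
  obtain ⟨L, hL0, hL⟩ := exists_lipschitz_on_tri T (G := fun K x => polyFun (P K) x * φ x)
    fun K _ => (contDiff_polyFun _).mul (hφ.of_le (by simp))
  set h : Plane → ℝ := fun x => f x * φ x with hh
  have hlip : LipschitzWith (Real.toNNReal L) h := by
    refine LipschitzWith.of_dist_le_mul fun x y => ?_
    rw [Real.dist_eq, Real.coe_toNNReal L hL0]
    -- the plane is covered by the triangles and the complement of `Ω`, where `h` vanishes
    refine abs_sub_le_of_segment_subset (T := T.insertNone)
      (C := fun o => o.elim Ωᶜ fun K => tri K) ?_ ?_ ?_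
    · rintro (_ | K) _
      · exact hΩo.isClosed_compl
      · exact isClosed_tri K
    · rintro (_ | K) hK x hx y hy
      · have hx0 : h x = 0 := by rw [hh]; simp only; rw [hφ0 x hx, mul_zero]
        have hy0 : h y = 0 := by rw [hh]; simp only; rw [hφ0 y hy, mul_zero]
        rw [hx0, hy0, sub_zero, abs_zero]
        positivity
      · have hK' : K ∈ T := Finset.some_mem_insertNone.1 hK
        simp only [hh, hf K hK' x hx, hf K hK' y hy]
        exact hL K hK' x hx y hy
    · intro z _
      by_cases hz : z ∈ Ω
      · obtain ⟨K, hK, hzK⟩ := hT.exists_mem (subset_closure hz)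
        exact Set.mem_biUnion (x := some K) (Finset.some_mem_insertNone.2 hK) hzK
      · exact Set.mem_biUnion (x := none) Finset.none_mem_insertNone hz
  have hint := LipschitzWith.integral_lineDeriv_mul_eq (μ := (volume : Measure Plane))
    (LipschitzWith.const (1 : ℝ)) hlip hc.mul_left (-e)
  have hconst : ∀ x : Plane, lineDeriv ℝ (fun _ : Plane => (1 : ℝ)) x (-e) = 0 := fun x =>
    ((hasFDerivAt_const (1 : ℝ) x).hasLineDerivAt (-e)).lineDeriv
  simp only [neg_neg, mul_one, hconst, zero_mul, integral_zero] at hint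
  have hline : ∀ x, x ∉ Ω → lineDeriv ℝ h x e = 0 := fun x hx => by
    have h0 : h =ᶠ[𝓝 x] fun _ => 0 := by
      have : φ =ᶠ[𝓝 x] 0 := notMem_tsupport_iff_eventuallyEq.1 fun h' => hx (hs h')
      filter_upwards [this] with y hy
      simp [hh, hy]
    have h1 : HasFDerivAt h (0 : Plane →L[ℝ] ℝ) x :=
      (hasFDerivAt_const (0 : ℝ) x).congr_of_eventuallyEq h0
    rw [(h1.hasLineDerivAt e).lineDeriv]
    rfl
  have hprod : ∀ᵐ x ∂(volume.restrict Ω),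
      lineDeriv ℝ h x e = u x * fderiv ℝ φ x e + hmem.toLp _ x * φ x := by
    filter_upwards [hu, hmem.coeFn_toLp, hT.ae_of_ae_interior hΩo
      (p := fun x => DifferentiableAt ℝ f x) fun K hK => Eventually.of_forall fun x hx =>
        (hf.hasFDerivAt_interior hK hx).differentiableAt] with x hx1 hx2 hx3
    have h1 : HasFDerivAt h _ x := hx3.hasFDerivAt.mul (hφ.differentiable (by simp) x).hasFDerivAt
    rw [(h1.hasLineDerivAt e).lineDeriv, hx1, hx2]
    simp [mul_comm]
  rw [← setIntegral_eq_integral_of_forall_compl_eq_zero (s := Ω) hline,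
    integral_congr_ae hprod, integral_add (integrable_mul_fderiv_test u hφ hc e)
      (integrable_mul_test _ hφ.continuous hc)] at hint
  linarith

end PiecewiseDerivative

/-! ### Continuity of piecewise polynomials in `H¹` across the mesh -/

theorem eq_covec (D : Plane →L[ℝ] ℝ) : D = covec fun i => D (EuclideanSpace.single i 1) := by
  ext w
  have hw : w = ∑ i, w i • (EuclideanSpace.single i 1 : Plane) := by
    ext j
    fin_cases j <;> simp
  conv_lhs => rw [hw]
  rw [map_sum, covec_apply]
  exact Finset.sum_congr rfl fun i _ => by rw [map_smul, smul_eq_mul, mul_comm]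

theorem norm_covec_le {c : Fin 2 → ℝ} {L : ℝ} (hL : ∀ i, |c i| ≤ L) : ‖covec c‖ ≤ 2 * L := by
  have hL0 : 0 ≤ L := (abs_nonneg _).trans (hL 0)
  refine ContinuousLinearMap.opNorm_le_bound _ (by linarith) fun w => ?_
  have hw : ∀ i, |c i * w i| ≤ L * ‖w‖ := fun i => by
    rw [abs_mul]
    have : |w i| ≤ ‖w‖ := by simpa using PiLp.norm_apply_le w i
    gcongr
    exact hL i
  rw [covec_apply, Fin.sum_univ_two, Real.norm_eq_abs]
  have := abs_add_le (c 0 * w 0) (c 1 * w 1)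
  linarith [hw 0, hw 1]

/-- A function with bounded weak partial derivatives is almost everywhere Lipschitz on balls well
inside `Ω`: its mollifications are Lipschitz with the same constant, and they converge almost
everywhere. -/
theorem exists_ae_lipschitz_of_weakPartial_bounded {Ω : Set Plane} (hΩo : IsOpen Ω) {u : L2 Ω}
    {g : Fin 2 → L2 Ω} (hg : ∀ i, HasWeakPartial Ω i u (g i)) {L : ℝ} (hL0 : 0 ≤ L)
    (hL : ∀ i, ∀ᵐ x ∂(volume.restrict Ω), |g i x| ≤ L) {x₀ : Plane} {r : ℝ} (hr : 0 < r)
    (hball : ball x₀ (2 * r) ⊆ Ω) :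
    ∃ s : Set Plane, (∀ᵐ x ∂(volume : Measure Plane), x ∈ s) ∧
      ∀ x ∈ s ∩ ball x₀ r, ∀ y ∈ s ∩ ball x₀ r, |u x - u y| ≤ 2 * L * dist x y := by
  -- only the values of `u` in `Ω` are meaningful
  set v : Plane → ℝ := Ω.indicator u with hv
  have hvloc : LocallyIntegrable v volume :=
    ((memLp_indicator_iff_restrict hΩo.measurableSet).2 (Lp.memLp u)).locallyIntegrable
      (by norm_num)
  set φ : ℕ → ContDiffBump (0 : Plane) := fun n =>
    { rIn := r / (n + 2) / 2
      rOut := r / (n + 2)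
      rIn_pos := by positivity
      rIn_lt_rOut := half_lt_self (by positivity) } with hφ
  have hrOut : ∀ n, (φ n).rOut < r := fun n => by
    have : (0 : ℝ) ≤ n := n.cast_nonneg
    exact div_lt_self hr (by linarith)
  have hlim : Tendsto (fun n => (φ n).rOut) atTop (𝓝 0) :=
    (tendsto_const_nhds.div_atTop
      (tendsto_atTop_add_const_right _ _ tendsto_natCast_atTop_atTop))
  have hconv := ContDiffBump.ae_convolution_tendsto_right_of_locallyIntegrable (φ := φ)
    (l := atTop) (K := 2) (g := v) (μ := volume) hlim
    (Eventually.of_forall fun n => by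
      change r / (n + 2) ≤ 2 * (r / (n + 2) / 2)
      linarith) hvloc
  refine ⟨{x | Tendsto (fun n => convolution ((φ n).normed volume) v
    (ContinuousLinearMap.lsmul ℝ ℝ) volume x) atTop (𝓝 (v x))}, hconv, ?_⟩
  rintro x ⟨hx, hxb⟩ y ⟨hy, hyb⟩
  rw [Set.mem_ofPred_eq] at hx hy
  set B := (ContinuousLinearMap.lsmul ℝ ℝ : ℝ →L[ℝ] ℝ →L[ℝ] ℝ) with hB
  have hcd : ∀ n, ContDiff ℝ ∞ ((φ n).normed volume) := fun n => (φ n).contDiff_normed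
  have hcs : ∀ n, HasCompactSupport ((φ n).normed (volume : Measure Plane)) :=
    fun n => (φ n).hasCompactSupport_normed
  have hder : ∀ n z, HasFDerivAt (convolution ((φ n).normed volume) v B volume)
      (convolution v (fderiv ℝ ((φ n).normed volume)) (B.flip.precompR Plane) volume z) z := by
    intro n z
    rw [← convolution_flip]
    exact (hcs n).hasFDerivAt_convolution_right B.flip hvloc ((hcd n).of_le (by simp)) z
  have hbound : ∀ n, ∀ z ∈ ball x₀ r,
      ‖convolution v (fderiv ℝ ((φ n).normed volume)) (B.flip.precompR Plane) volume z‖ ≤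
        2 * L := by
    intro n z hz
    rw [eq_covec (convolution v _ _ _ z)]
    refine norm_covec_le fun i => ?_
    set e : Plane := EuclideanSpace.single i 1 with he
    rw [convolution_precompR_apply B.flip hvloc ((hcs n).fderiv ℝ)
      ((hcd n).continuous_fderiv (by simp))]
    set ψ := (φ n).normed (volume : Measure Plane) with hψ
    -- the derivative of the mollification is `g i` tested against a translate of the mollifier
    set χ : Plane → ℝ := fun t => ψ (z - t) with hχ
    have hχd : ContDiff ℝ ∞ χ := (hcd n).comp (contDiff_const.sub contDiff_id)
    have hχs : tsupport χ ⊆ closedBall z (φ n).rOut := by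
      refine closure_minimal (fun t ht => ?_) isClosed_closedBall
      have h1 : z - t ∈ tsupport ψ := subset_tsupport _ ht
      rw [hψ, ContDiffBump.tsupport_normed_eq, mem_closedBall_zero_iff] at h1
      rwa [mem_closedBall', dist_eq_norm]
    have hχc : HasCompactSupport χ :=
      HasCompactSupport.of_support_subset_isCompact (isCompact_closedBall z (φ n).rOut)
        ((subset_tsupport χ).trans hχs)
    have hχΩ : tsupport χ ⊆ Ω := hχs.trans fun t ht => hball <| by
      rw [mem_ball] at hz ⊢
      rw [mem_closedBall] at ht
      linarith [dist_triangle t z x₀, hrOut n]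
    have hχ' : ∀ t, fderiv ℝ χ t e = -fderiv ℝ ψ (z - t) e := fun t => by
      have h1 : HasFDerivAt χ ((fderiv ℝ ψ (z - t)).comp (-ContinuousLinearMap.id ℝ Plane)) t :=
        (((hcd n).differentiable (by simp)) (z - t)).hasFDerivAt.comp t
          ((hasFDerivAt_id t).const_sub z)
      rw [h1.fderiv]
      simp
    have h1 : convolution v (fun a => fderiv ℝ ψ a e) B.flip volume z =
        ∫ t in Ω, g i t * χ t := by
      have h2 := hg i χ hχd hχc hχΩ
      rw [convolution_def]
      have h3 : ∀ t, B.flip (v t) (fderiv ℝ ψ (z - t) e) =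
          -Ω.indicator (fun t => u t * fderiv ℝ χ t e) t := fun t => by
        by_cases ht : t ∈ Ω
        · simp [hv, hB, ht, hχ', mul_comm]
        · simp [hv, hB, ht]
      simp_rw [h3]
      rw [integral_neg, integral_indicator hΩo.measurableSet, h2, neg_neg]
    rw [h1]
    have hχ0 : ∀ t, 0 ≤ χ t := fun t => (φ n).nonneg_normed _
    have hχi : Integrable χ volume := hχd.continuous.integrable_of_hasCompactSupport hχc
    calc |∫ t in Ω, g i t * χ t| ≤ ∫ t in Ω, L * χ t := by
          rw [← Real.norm_eq_abs]
          refine norm_integral_le_of_norm_le (hχi.const_mul L).restrict ?_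
          filter_upwards [hL i] with t ht
          rw [norm_mul, Real.norm_eq_abs, Real.norm_of_nonneg (hχ0 t)]
          exact mul_le_mul_of_nonneg_right ht (hχ0 t)
      _ = L * ∫ t in Ω, χ t := integral_const_mul _ _
      _ ≤ L * ∫ t, χ t := by
          exact mul_le_mul_of_nonneg_left
            (setIntegral_le_integral hχi (Eventually.of_forall hχ0)) hL0
      _ = L := by
          rw [hχ, integral_sub_left_eq_self ψ volume z, (φ n).integral_normed, mul_one]
  have hlip : ∀ n, |convolution ((φ n).normed volume) v B volume x -
      convolution ((φ n).normed volume) v B volume y| ≤ 2 * L * dist x y := fun n => by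
    have := (convex_ball x₀ r).norm_image_sub_le_of_norm_hasFDerivWithin_le
      (fun z _ => (hder n z).hasFDerivWithinAt) (hbound n) hyb hxb
    rwa [Real.norm_eq_abs, ← dist_eq_norm] at this
  have hxΩ : x ∈ Ω := hball (ball_subset_ball (by linarith) hxb)
  have hyΩ : y ∈ Ω := hball (ball_subset_ball (by linarith) hyb)
  have := le_of_tendsto ((hx.sub hy).abs) (Eventually.of_forall hlip)
  simpa [hv, hxΩ, hyΩ] using this

/-- The pieces of a piecewise polynomial function in `H¹(Ω)` agree at the points of `Ω`: such a
function is almost everywhere Lipschitz near `x`, and each triangle at `x` has inner points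
arbitrarily close to `x`. -/
theorem polyFun_eq_of_mem_H1 {T : Finset (Finset Plane)} {Ω : Set Plane}
    {P : Finset Plane → MvPolynomial (Fin 2) ℝ} (hT : IsMesh T Ω)
    (hΩ : interior (closure Ω) = Ω) {u : L2 Ω} (hu : u ∈ H1 Ω) (hP : IsPiecewiseAE T Ω P u)
    {K K' : Finset Plane} (hK : K ∈ T) (hK' : K' ∈ T) {x : Plane} (hx : x ∈ Ω) (hxK : x ∈ tri K)
    (hxK' : x ∈ tri K') : polyFun (P K) x = polyFun (P K') x := by
  have hΩo : IsOpen Ω := hΩ ▸ isOpen_interior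
  choose g hg using hu
  obtain ⟨C, hC0, hC⟩ : ∃ C : ℝ, 0 ≤ C ∧ ∀ i, ∀ᵐ x ∂(volume.restrict Ω), |g i x| ≤ C := by
    have h : ∀ i, ∃ C : ℝ, 0 ≤ C ∧ ∀ᵐ x ∂(volume.restrict Ω), |g i x| ≤ C := fun i => by
      obtain ⟨C, hC0, hC⟩ := exists_abs_le_on_tri T
        (G := fun K => polyFun (MvPolynomial.pderiv i (P K))) fun K _ => continuous_polyFun _
      refine ⟨C, hC0, ?_⟩
      have h1 := (hg i).isPiecewiseAE hT hΩ hP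
      have h2 : ∀ᵐ x ∂(volume.restrict Ω), ∀ K ∈ T, x ∈ tri K →
          g i x = polyFun (MvPolynomial.pderiv i (P K)) x := by
        rw [Filter.eventually_all_finset]
        exact h1
      filter_upwards [h2, ae_restrict_mem hΩo.measurableSet] with y hy hyΩ
      obtain ⟨K, hK, hyK⟩ := hT.exists_mem (subset_closure hyΩ)
      rw [hy K hK hyK]
      exact hC K hK y hyK
    choose C hC0 hC using h
    refine ⟨C 0 + C 1, add_nonneg (hC0 0) (hC0 1), fun i => ?_⟩
    filter_upwards [hC i] with y hy
    refine hy.trans ?_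
    fin_cases i
    · simpa using hC0 1
    · simpa using hC0 0
  obtain ⟨R, hR, hRΩ⟩ := Metric.isOpen_iff.1 hΩo x hx
  obtain ⟨s, hs, hlip⟩ := exists_ae_lipschitz_of_weakPartial_bounded hΩo hg hC0 hC
    (half_pos hR) (x₀ := x) (by rwa [mul_div_cancel₀ R two_ne_zero])
  -- points of `K` near `x` at which `u` is given by the polynomial on `K`
  have hfreq : ∀ K ∈ T, x ∈ tri K → ∀ ε > 0, ∃ y ∈ s ∩ ball x (R / 2), dist y x < ε ∧
      u y = polyFun (P K) y := by
    intro K hK hxK ε hε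
    have hxc : x ∈ closure (interior (tri K)) := by rwa [hT.closure_interior hK]
    obtain ⟨z, hz, hzx⟩ := Metric.mem_closure_iff.1 hxc (min ε (R / 2)) (by positivity)
    have hW : IsOpen (interior (tri K) ∩ ball x (min ε (R / 2))) := isOpen_interior.inter isOpen_ball
    have hzW : z ∈ interior (tri K) ∩ ball x (min ε (R / 2)) := ⟨hz, by rwa [mem_ball']⟩
    have hae : ∀ᵐ y ∂(volume : Measure Plane), y ∈ s ∧ (y ∈ Ω → y ∈ tri K →
        u y = polyFun (P K) y) :=
      hs.and ((ae_restrict_iff' hΩo.measurableSet).1 (hP K hK))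
    obtain ⟨y, hyW, hys, hyu⟩ :=
      (Measure.dense_of_ae hae).inter_open_nonempty _ hW ⟨z, hzW⟩
    have hyb := mem_ball.1 hyW.2
    exact ⟨y, ⟨hys, mem_ball.2 (hyb.trans_le (min_le_right _ _))⟩,
      hyb.trans_le (min_le_left _ _),
      hyu (hT.interior_subset hΩ hK hyW.1) (interior_subset hyW.1)⟩
  refine eq_of_abs_sub_le_all fun δ hδ => ?_
  have hcont : ∀ K : Finset Plane, ∃ ε > 0, ∀ y, dist y x < ε →
      |polyFun (P K) y - polyFun (P K) x| < δ / 4 := fun K => by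
    have := Metric.continuous_iff.1 (continuous_polyFun (P K)) x (δ / 4) (by positivity)
    simpa only [Real.dist_eq] using this
  obtain ⟨ε₁, hε₁, h₁⟩ := hcont K
  obtain ⟨ε₂, hε₂, h₂⟩ := hcont K'
  set η := δ / (8 * (2 * C + 1)) with hη
  have hη0 : 0 < η := by positivity
  obtain ⟨y, hys, hyx, hyu⟩ := hfreq K hK hxK (min ε₁ η) (by positivity)
  obtain ⟨z, hzs, hzx, hzu⟩ := hfreq K' hK' hxK' (min ε₂ η) (by positivity)
  have h3 := hlip y hys z hzs
  rw [hyu, hzu] at h3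
  have h4 : dist y z ≤ 2 * η := by
    have := dist_triangle_right y z x
    linarith [min_le_right ε₁ η, min_le_right ε₂ η]
  have h5 : 2 * C * dist y z ≤ δ / 4 := by
    have h6 : (2 * C + 1) * (2 * η) = δ / 4 := by
      rw [hη]
      field_simp
      norm_num
    nlinarith [dist_nonneg (x := y) (y := z)]
  have h6 := abs_lt.1 (h₁ y (hyx.trans_le (min_le_left _ _)))
  have h7 := abs_lt.1 (h₂ z (hzx.trans_le (min_le_left _ _)))
  have h8 := abs_le.1 (h3.trans h5)
  rw [abs_le]
  constructor <;> linarith [h6.1, h6.2, h7.1, h7.2, h8.1, h8.2]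

/-! ### The domain near a boundary point -/

/-- The determinant of two plane vectors. -/
def det2 (a b : Plane) : ℝ := a 0 * b 1 - a 1 * b 0

theorem subset_or_disjoint_of_disjoint_frontier {X : Type*} [TopologicalSpace X] {Ω A : Set X}
    (hΩo : IsOpen Ω) (hA : IsPreconnected A) (h : Disjoint A (frontier Ω)) :
    A ⊆ Ω ∨ Disjoint A Ω := by
  have hcov : A ⊆ Ω ∪ (closure Ω)ᶜ := fun x hx => by
    by_cases hxΩ : x ∈ Ω
    · exact Or.inl hxΩ
    · refine Or.inr fun hc => Set.disjoint_left.1 h hx ?_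
      rw [frontier, hΩo.interior_eq]
      exact ⟨hc, hxΩ⟩
  have hdisj : A ∩ (Ω ∩ (closure Ω)ᶜ) = ∅ := by
    ext x
    simp only [Set.mem_inter_iff, Set.mem_compl_iff, Set.mem_empty_iff_false, iff_false]
    exact fun hx => hx.2.2 (subset_closure hx.2.1)
  rcases isPreconnected_iff_subset_of_disjoint.1 hA _ _ hΩo isClosed_closure.isOpen_compl hcov hdisj
    with h1 | h1
  · exact Or.inl h1
  · exact Or.inr (Set.disjoint_left.2 fun x hx hxΩ => h1 hx (subset_closure hxΩ))

/-- If the boundary splits a ball about a boundary point into at most two connected parts, then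
the part of the ball inside `Ω` is connected, since `Ω` cannot lie on both sides. -/
theorem isPreconnected_inter_of_two_sides {Ω D A B : Set Plane} {x : Plane} (hΩo : IsOpen Ω)
    (hΩ : interior (closure Ω) = Ω) (hx : x ∈ frontier Ω) (hD : D ∈ 𝓝 x)
    (hA : IsPreconnected A) (hB : IsPreconnected B) (hAD : A ⊆ D) (hBD : B ⊆ D)
    (hAf : Disjoint A (frontier Ω)) (hBf : Disjoint B (frontier Ω))
    (hcov : D ⊆ A ∪ B ∪ frontier Ω) : IsPreconnected (Ω ∩ D) := by
  have hsub : Ω ∩ D ⊆ A ∪ B := fun y hy => by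
    rcases hcov hy.2 with h | h
    · exact h
    · rw [frontier, hΩo.interior_eq] at h
      exact absurd hy.1 h.2
  rcases subset_or_disjoint_of_disjoint_frontier hΩo hA hAf with hA' | hA' <;>
    rcases subset_or_disjoint_of_disjoint_frontier hΩo hB hBf with hB' | hB'
  · exfalso
    have hDc : D ⊆ closure Ω := fun y hy => by
      rcases hcov hy with (h | h) | h
      · exact subset_closure (hA' h)
      · exact subset_closure (hB' h)
      · exact frontier_subset_closure h
    have : x ∈ interior (closure Ω) := mem_interior_iff_mem_nhds.2 (mem_of_superset hD hDc)
    rw [hΩ] at this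
    rw [frontier, hΩo.interior_eq] at hx
    exact hx.2 this
  · have : Ω ∩ D = A := Set.Subset.antisymm
      (fun y hy => (hsub hy).resolve_right fun h => Set.disjoint_left.1 hB' h hy.1)
      fun y hy => ⟨hA' hy, hAD hy⟩
    rwa [this]
  · have : Ω ∩ D = B := Set.Subset.antisymm
      (fun y hy => (hsub hy).resolve_left fun h => Set.disjoint_left.1 hA' h hy.1)
      fun y hy => ⟨hB' hy, hBD hy⟩
    rwa [this]
  · have : Ω ∩ D = ∅ := Set.eq_empty_of_forall_notMem fun y hy => by
      rcases hsub hy with h | h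
      · exact Set.disjoint_left.1 hA' h hy.1
      · exact Set.disjoint_left.1 hB' h hy.1
    rw [this]
    exact isPreconnected_empty

theorem mem_segment_iff_exists_ray {x p y : Plane} (hy : dist y x < dist p x) :
    y ∈ segment ℝ x p ↔ ∃ s : ℝ, 0 ≤ s ∧ y = x + s • (p - x) := by
  rw [segment_eq_image']
  constructor
  · rintro ⟨s, hs, rfl⟩
    exact ⟨s, hs.1, rfl⟩
  · rintro ⟨s, hs, rfl⟩
    refine ⟨s, ⟨hs, ?_⟩, rfl⟩
    rw [dist_eq_norm, dist_eq_norm, add_sub_cancel_left, norm_smul, Real.norm_of_nonneg hs] at hy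
    by_contra! h
    nlinarith [norm_nonneg (p - x)]

section Polygon

variable {n : ℕ} [NeZero n] {Ω : Set Plane} {V : Fin n → Plane}

theorem mem_edge_or_eq_of_mem_segment {i : Fin n} {x : Plane}
    (hx : x ∈ segment ℝ (V i) (V (i + 1))) : x ∈ edge V i ∨ x = V i ∨ x = V (i + 1) := by
  rw [← insert_endpoints_openSegment] at hx
  rcases hx with h | h | h
  · exact Or.inr (Or.inl h)
  · exact Or.inr (Or.inr h)
  · exact Or.inl h

theorem IsPolygonalDomain.succ_ne (hΩ : IsPolygonalDomain Ω V) (i : Fin n) : i + 1 ≠ i := by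
  obtain ⟨m, rfl⟩ : ∃ m, n = m + 2 := ⟨n - 2, by have := hΩ.three_le; omega⟩
  intro h
  simp at h

theorem IsPolygonalDomain.vertex_ne (hΩ : IsPolygonalDomain Ω V) (i : Fin n) :
    V (i + 1) ≠ V i := fun h => hΩ.succ_ne i (hΩ.vertices_injective h)

/-- Near a boundary point `x` the boundary consists of two segments with end point `x` that point
in different directions. -/
theorem IsPolygonalDomain.exists_segments (hΩ : IsPolygonalDomain Ω V) {x : Plane}
    (hx : x ∈ frontier Ω) : ∃ p q : Plane, p ≠ x ∧ q ≠ x ∧ ¬ SameRay ℝ (p - x) (q - x) ∧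
      ∀ᶠ y in 𝓝 x, y ∈ frontier Ω ↔ y ∈ segment ℝ x p ∨ y ∈ segment ℝ x q := by
  have hloc : ∀ᶠ y in 𝓝 x, ∀ j ∈ Finset.univ, y ∈ segment ℝ (V j) (V (j + 1)) →
      x ∈ segment ℝ (V j) (V (j + 1)) :=
    eventually_mem_imp_mem (fun j _ => by
      rw [← convexHull_pair]
      exact ((Set.toFinite _).isCompact_convexHull ℝ).isClosed) x
  rw [hΩ.frontier_eq] at hx
  obtain ⟨i, hi⟩ := Set.mem_iUnion.1 hx
  by_cases hv : ∃ i, x = V i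
  · -- a vertex, with its two edges
    obtain ⟨i, rfl⟩ := hv
    have hk : i - 1 + 1 = i := sub_add_cancel i 1
    have hk' : i - 1 ≠ i := fun h => hΩ.succ_ne (i - 1) (by rw [hk, h])
    have hne1 := hΩ.vertex_ne i
    have hne2 : V (i - 1) ≠ V i := fun h => hk' (hΩ.vertices_injective h)
    refine ⟨V (i + 1), V (i - 1), hne1, hne2, fun hray => ?_, ?_⟩
    · obtain ⟨a, b, ha, hb, hab⟩ := hray.exists_pos (sub_ne_zero.2 hne1) (sub_ne_zero.2 hne2)
      set c := a + b + 1 with hc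
      have hcpos : 0 < c := by positivity
      have h1 : V i + (a / c) • (V (i + 1) - V i) ∈ edge V i := by
        rw [edge, openSegment_eq_image']
        exact ⟨a / c, ⟨by positivity, by rw [div_lt_one hcpos]; linarith⟩, rfl⟩
      have h2 : V i + (a / c) • (V (i + 1) - V i) ∈ edge V (i - 1) := by
        rw [edge, hk, openSegment_symm, openSegment_eq_image']
        refine ⟨b / c, ⟨by positivity, by rw [div_lt_one hcpos]; linarith⟩, ?_⟩
        simp only
        rw [div_eq_inv_mul, div_eq_inv_mul, mul_smul, mul_smul, hab]
      exact Set.disjoint_left.1 (hΩ.edges_disjoint i (i - 1) hk'.symm) h1 h2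
    · filter_upwards [hloc] with y hy
      rw [hΩ.frontier_eq, Set.mem_iUnion]
      constructor
      · rintro ⟨j, hj⟩
        rcases mem_edge_or_eq_of_mem_segment (hy j (Finset.mem_univ j) hj) with h | h | h
        · exact absurd h (hΩ.vertex_notMem_edge j i)
        · rw [← hΩ.vertices_injective h] at hj
          exact Or.inl hj
        · have : i - 1 = j := by rw [hΩ.vertices_injective h, add_sub_cancel_right]
          rw [← this, hk, segment_symm] at hj
          exact Or.inr hj
      · rintro (h | h)
        · exact ⟨i, h⟩
        · refine ⟨i - 1, ?_⟩
          rwa [hk, segment_symm]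
  · -- a point of an open edge
    push Not at hv
    have hxe : x ∈ edge V i := by
      rcases mem_edge_or_eq_of_mem_segment hi with h | h | h
      · exact h
      · exact absurd h (hv i)
      · exact absurd h (hv (i + 1))
    refine ⟨V i, V (i + 1), (hv i).symm, (hv (i + 1)).symm, fun hray => ?_, ?_⟩
    · obtain ⟨a, b, ha, hb, hab⟩ := hray.exists_pos (sub_ne_zero.2 (hv i).symm)
        (sub_ne_zero.2 (hv (i + 1)).symm)
      rw [edge, openSegment_eq_image'] at hxe
      obtain ⟨t, ht, rfl⟩ := hxe
      have h0 : (a * t + b * (1 - t)) • (V (i + 1) - V i) = 0 := by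
        have h1 := sub_eq_zero.2 hab
        rw [← neg_eq_zero, ← h1]
        module
      rcases smul_eq_zero.1 h0 with h | h
      · have := mul_pos ha ht.1
        have := mul_pos hb (sub_pos.2 ht.2)
        linarith
      · exact hΩ.vertex_ne i (sub_eq_zero.1 h)
    · filter_upwards [hloc] with y hy
      have hsplit : y ∈ segment ℝ (V i) (V (i + 1)) ↔
          y ∈ segment ℝ x (V i) ∨ y ∈ segment ℝ x (V (i + 1)) := by
        constructor
        · rw [edge, openSegment_eq_image'] at hxe
          obtain ⟨t, ht, rfl⟩ := hxe
          rw [segment_eq_image']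
          rintro ⟨s, hs, rfl⟩
          have h1t : 0 < 1 - t := sub_pos.2 ht.2
          rcases le_total s t with hst | hst
          · left
            rw [segment_symm, segment_eq_image']
            refine ⟨s / t, ⟨div_nonneg hs.1 ht.1.le, (div_le_one ht.1).2 hst⟩, ?_⟩
            simp only
            rw [add_sub_cancel_left, smul_smul, div_mul_cancel₀ _ ht.1.ne']
          · right
            rw [segment_eq_image']
            refine ⟨(s - t) / (1 - t), ⟨div_nonneg (by linarith) h1t.le,
              (div_le_one h1t).2 (by linarith [hs.2])⟩, ?_⟩
            have : (s - t) / (1 - t) * (1 - t) = s - t := div_mul_cancel₀ _ h1t.ne'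
            simp only
            rw [show V (i + 1) - (V i + t • (V (i + 1) - V i)) =
              (1 - t) • (V (i + 1) - V i) by module, smul_smul, this]
            module
        · have hc : Convex ℝ (segment ℝ (V i) (V (i + 1))) := convex_segment _ _
          rintro (h | h)
          · exact hc.segment_subset hi (left_mem_segment ℝ _ _) h
          · exact hc.segment_subset hi (right_mem_segment ℝ _ _) h
      rw [hΩ.frontier_eq, Set.mem_iUnion, ← hsplit]
      constructor
      · rintro ⟨j, hj⟩
        have hj' : x ∈ edge V j := by
          rcases mem_edge_or_eq_of_mem_segment (hy j (Finset.mem_univ j) hj) with h | h | h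
          · exact h
          · exact absurd h (hv j)
          · exact absurd h (hv (j + 1))
        have : j = i := by
          by_contra hji
          exact Set.disjoint_left.1 (hΩ.edges_disjoint j i hji) hj' hxe
        rwa [this] at hj
      · exact fun h => ⟨i, h⟩

/-- Near a boundary point `x` the boundary consists of two different rays from `x`. -/
theorem IsPolygonalDomain.exists_rays (hΩ : IsPolygonalDomain Ω V) {x : Plane}
    (hx : x ∈ frontier Ω) : ∃ d₁ d₂ : Plane, d₁ ≠ 0 ∧ d₂ ≠ 0 ∧ ¬ SameRay ℝ d₁ d₂ ∧
      ∀ᶠ y in 𝓝 x, y ∈ frontier Ω ↔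
        (∃ s : ℝ, 0 ≤ s ∧ y = x + s • d₁) ∨ ∃ s : ℝ, 0 ≤ s ∧ y = x + s • d₂ := by
  obtain ⟨p, q, hp, hq, hpq, h⟩ := hΩ.exists_segments hx
  refine ⟨p - x, q - x, sub_ne_zero.2 hp, sub_ne_zero.2 hq, hpq, ?_⟩
  filter_upwards [h, ball_mem_nhds x (dist_pos.2 hp), ball_mem_nhds x (dist_pos.2 hq)]
    with y hy h1 h2
  rw [hy, mem_segment_iff_exists_ray h1, mem_segment_iff_exists_ray h2]

/-- Near a boundary point a polygonal domain is a connected sector. -/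
theorem IsPolygonalDomain.exists_sector (hΩ : IsPolygonalDomain Ω V) {x : Plane}
    (hx : x ∈ frontier Ω) : ∃ R > 0, ∀ r, 0 < r → r ≤ R → IsPreconnected (Ω ∩ ball x r) ∧
      ∀ y ∈ Ω ∩ ball x r, ∀ s ∈ Set.Ioc (0 : ℝ) 1, x + s • (y - x) ∈ Ω := by
  obtain ⟨d₁, d₂, hd₁, hd₂, hray, hev⟩ := hΩ.exists_rays hx
  obtain ⟨R, hR, hf⟩ := Metric.eventually_nhds_iff_ball.1 hev
  refine ⟨R, hR, fun r hr hrR => ⟨?_, ?_⟩⟩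
  · replace hf := fun y (hy : y ∈ ball x r) => hf y (ball_subset_ball hrR hy)
    have hball := convex_ball x r
    by_cases hdet : det2 d₁ d₂ = 0
    · -- the two rays form a line
      obtain ⟨c, hc, hcd⟩ : ∃ c : ℝ, c < 0 ∧ d₂ = c • d₁ := by
        have hnn : 0 < d₁ 0 ^ 2 + d₁ 1 ^ 2 := by
          by_contra! h
          apply hd₁
          have h0 : d₁ 0 = 0 := by nlinarith [sq_nonneg (d₁ 0), sq_nonneg (d₁ 1)]
          have h1 : d₁ 1 = 0 := by nlinarith [sq_nonneg (d₁ 0), sq_nonneg (d₁ 1)]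
          ext j
          fin_cases j
          · simpa using h0
          · simpa using h1
        set c := (d₁ 0 * d₂ 0 + d₁ 1 * d₂ 1) / (d₁ 0 ^ 2 + d₁ 1 ^ 2) with hc
        have hcd : d₂ = c • d₁ := by
          rw [det2] at hdet
          ext j
          fin_cases j
          · simp only [Fin.zero_eta, PiLp.smul_apply, smul_eq_mul, hc]
            field_simp
            linear_combination (-d₁ 1) * hdet
          · simp only [Fin.mk_one, PiLp.smul_apply, smul_eq_mul, hc]
            field_simp
            linear_combination (d₁ 0) * hdet
        refine ⟨c, ?_, hcd⟩
        by_contra! h0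
        exact hray (hcd ▸ SameRay.sameRay_nonneg_smul_right d₁ h0)
      have hline : ∀ y, det2 d₁ (y - x) = 0 →
          (∃ s : ℝ, 0 ≤ s ∧ y = x + s • d₁) ∨ ∃ s : ℝ, 0 ≤ s ∧ y = x + s • d₂ := by
        intro y hy
        obtain ⟨t, ht⟩ : ∃ t : ℝ, y - x = t • d₁ := by
          rw [det2] at hy
          by_cases h0 : d₁ 0 = 0
          · have h1 : d₁ 1 ≠ 0 := fun h1 => hd₁ (by ext j; fin_cases j <;> simp [h0, h1])
            refine ⟨(y - x) 1 / d₁ 1, ?_⟩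
            have h2 : (y - x) 0 = 0 := by
              have : d₁ 1 * (y - x) 0 = 0 := by rw [h0] at hy; linarith
              exact (mul_eq_zero.1 this).resolve_left h1
            ext j
            fin_cases j
            · simp only [Fin.zero_eta, PiLp.smul_apply, smul_eq_mul, h0, mul_zero, h2]
            · simp only [Fin.mk_one, PiLp.smul_apply, smul_eq_mul, div_mul_cancel₀ _ h1]
          · refine ⟨(y - x) 0 / d₁ 0, ?_⟩
            ext j
            fin_cases j
            · simp only [Fin.zero_eta, PiLp.smul_apply, smul_eq_mul, div_mul_cancel₀ _ h0]
            · simp only [Fin.mk_one, PiLp.smul_apply, smul_eq_mul]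
              field_simp
              linarith
        rcases le_total 0 t with h0 | h0
        · exact Or.inl ⟨t, h0, by rw [← ht]; abel⟩
        · refine Or.inr ⟨t / c, div_nonneg_of_nonpos h0 hc.le, ?_⟩
          rw [hcd, smul_smul, div_mul_cancel₀ _ hc.ne, ← ht]
          abel
      have hzero : ∀ y, ((∃ s : ℝ, 0 ≤ s ∧ y = x + s • d₁) ∨ ∃ s : ℝ, 0 ≤ s ∧ y = x + s • d₂) →
          det2 d₁ (y - x) = 0 := by
        rintro y (⟨s, -, rfl⟩ | ⟨s, -, rfl⟩)
        · simp only [det2, add_sub_cancel_left, PiLp.smul_apply, smul_eq_mul]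
          ring
        · simp only [det2, hcd, add_sub_cancel_left, PiLp.smul_apply, smul_eq_mul]
          ring
      have hcomb : ∀ y z : Plane, ∀ a b : ℝ, a + b = 1 → det2 d₁ (a • y + b • z - x) =
          a * det2 d₁ (y - x) + b * det2 d₁ (z - x) := fun y z a b hab => by
        simp only [det2, PiLp.sub_apply, PiLp.add_apply, PiLp.smul_apply, smul_eq_mul]
        linear_combination (d₁ 0 * x 1 - d₁ 1 * x 0) * hab
      refine isPreconnected_inter_of_two_sides (A := {y ∈ ball x r | 0 < det2 d₁ (y - x)})
        (B := {y ∈ ball x r | det2 d₁ (y - x) < 0}) hΩ.isOpen hΩ.interior_closure hx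
        (ball_mem_nhds x hr) (Convex.isPreconnected ?_) (Convex.isPreconnected ?_)
        (fun y hy => hy.1) (fun y hy => hy.1) ?_ ?_ ?_
      · rintro y ⟨hy, hy'⟩ z ⟨hz, hz'⟩ a b ha hb hab
        refine ⟨hball hy hz ha hb hab, ?_⟩
        rw [hcomb y z a b hab]
        rcases ha.eq_or_lt with rfl | ha
        · rw [zero_add] at hab
          simpa [hab] using hz'
        · have := mul_pos ha hy'
          have := mul_nonneg hb hz'.le
          linarith
      · rintro y ⟨hy, hy'⟩ z ⟨hz, hz'⟩ a b ha hb hab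
        refine ⟨hball hy hz ha hb hab, ?_⟩
        rw [hcomb y z a b hab]
        rcases ha.eq_or_lt with rfl | ha
        · rw [zero_add] at hab
          simpa [hab] using hz'
        · have := mul_neg_of_pos_of_neg ha hy'
          have := mul_nonpos_of_nonneg_of_nonpos hb hz'.le
          linarith
      · exact Set.disjoint_left.2 fun y hy hyf => hy.2.ne' (hzero y ((hf y hy.1).1 hyf))
      · exact Set.disjoint_left.2 fun y hy hyf => hy.2.ne (hzero y ((hf y hy.1).1 hyf))
      · intro y hy
        rcases lt_trichotomy (det2 d₁ (y - x)) 0 with h | h | h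
        · exact Or.inl (Or.inr ⟨hy, h⟩)
        · exact Or.inr ((hf y hy).2 (hline y h))
        · exact Or.inl (Or.inl ⟨hy, h⟩)
    · -- coordinates `α`, `β` with respect to the directions of the two rays
      set α : Plane → ℝ := fun y => det2 (y - x) d₂ / det2 d₁ d₂ with hα
      set β : Plane → ℝ := fun y => det2 d₁ (y - x) / det2 d₁ d₂ with hβ
      have hrep : ∀ y, y = x + α y • d₁ + β y • d₂ := fun y => by
        obtain ⟨D, hD⟩ : ∃ D, D = det2 d₁ d₂ := ⟨_, rfl⟩
        have hD0 : D ≠ 0 := hD ▸ hdet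
        simp only [hα, hβ, ← hD]
        rw [det2] at hD
        ext j
        fin_cases j
        · simp only [Fin.zero_eta, PiLp.add_apply, PiLp.smul_apply, smul_eq_mul, det2,
            PiLp.sub_apply]
          field_simp
          linear_combination (y 0 - x 0) * hD
        · simp only [Fin.mk_one, PiLp.add_apply, PiLp.smul_apply, smul_eq_mul, det2,
            PiLp.sub_apply]
          field_simp
          linear_combination (y 1 - x 1) * hD
      have hαe : ∀ a b : ℝ, α (x + a • d₁ + b • d₂) = a := fun a b => by
        rw [hα]
        simp only
        rw [div_eq_iff hdet]
        simp only [det2, PiLp.add_apply, PiLp.smul_apply, smul_eq_mul, PiLp.sub_apply]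
        ring
      have hβe : ∀ a b : ℝ, β (x + a • d₁ + b • d₂) = b := fun a b => by
        rw [hβ]
        simp only
        rw [div_eq_iff hdet]
        simp only [det2, PiLp.add_apply, PiLp.smul_apply, smul_eq_mul, PiLp.sub_apply]
        ring
      have hαc : ∀ y z : Plane, ∀ a b : ℝ, a + b = 1 →
          α (a • y + b • z) = a * α y + b * α z := fun y z a b hab => by
        simp only [hα, mul_div_assoc', ← add_div]
        congr 1
        simp only [det2, PiLp.sub_apply, PiLp.add_apply, PiLp.smul_apply, smul_eq_mul]
        linear_combination (x 0 * d₂ 1 - x 1 * d₂ 0) * hab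
      have hβc : ∀ y z : Plane, ∀ a b : ℝ, a + b = 1 →
          β (a • y + b • z) = a * β y + b * β z := fun y z a b hab => by
        simp only [hβ, mul_div_assoc', ← add_div]
        congr 1
        simp only [det2, PiLp.sub_apply, PiLp.add_apply, PiLp.smul_apply, smul_eq_mul]
        linear_combination (d₁ 0 * x 1 - d₁ 1 * x 0) * hab
      have hrays : ∀ y, ((∃ s : ℝ, 0 ≤ s ∧ y = x + s • d₁) ∨ ∃ s : ℝ, 0 ≤ s ∧ y = x + s • d₂) ↔
          (0 ≤ α y ∧ β y = 0) ∨ (α y = 0 ∧ 0 ≤ β y) := by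
        intro y
        constructor
        · rintro (⟨s, hs, rfl⟩ | ⟨s, hs, rfl⟩)
          · left
            have h1 := hαe s 0
            have h2 := hβe s 0
            rw [zero_smul, add_zero] at h1 h2
            rw [h1, h2]
            exact ⟨hs, rfl⟩
          · right
            have h1 := hαe 0 s
            have h2 := hβe 0 s
            rw [zero_smul, add_zero] at h1 h2
            rw [h1, h2]
            exact ⟨rfl, hs⟩
        · have h := hrep y
          rintro (⟨h1, h2⟩ | ⟨h1, h2⟩)
          · exact Or.inl ⟨α y, h1, by rwa [h2, zero_smul, add_zero] at h⟩
          · exact Or.inr ⟨β y, h2, by rwa [h1, zero_smul, add_zero] at h⟩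
      have hneg : ∀ {γ : Plane → ℝ}, (∀ y z : Plane, ∀ a b : ℝ, a + b = 1 →
          γ (a • y + b • z) = a * γ y + b * γ z) → Convex ℝ {y ∈ ball x r | γ y < 0} := by
        rintro γ hγ y ⟨hy, hy'⟩ z ⟨hz, hz'⟩ a b ha hb hab
        refine ⟨hball hy hz ha hb hab, ?_⟩
        rw [hγ y z a b hab]
        rcases ha.eq_or_lt with rfl | ha
        · rw [zero_add] at hab
          simpa [hab] using hz'
        · have := mul_neg_of_pos_of_neg ha hy'
          have := mul_nonpos_of_nonneg_of_nonpos hb hz'.le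
          linarith
      have hpos : Convex ℝ {y ∈ ball x r | 0 < α y ∧ 0 < β y} := by
        rintro y ⟨hy, hy1, hy2⟩ z ⟨hz, hz1, hz2⟩ a b ha hb hab
        refine ⟨hball hy hz ha hb hab, ?_⟩
        rw [hαc y z a b hab, hβc y z a b hab]
        rcases ha.eq_or_lt with rfl | ha
        · rw [zero_add] at hab
          simpa [hab] using ⟨hz1, hz2⟩
        · have h1 := mul_pos ha hy1
          have h2 := mul_nonneg hb hz1.le
          have h3 := mul_pos ha hy2
          have h4 := mul_nonneg hb hz2.le
          exact ⟨by linarith, by linarith⟩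
      refine isPreconnected_inter_of_two_sides (A := {y ∈ ball x r | 0 < α y ∧ 0 < β y})
        (B := {y ∈ ball x r | α y < 0} ∪ {y ∈ ball x r | β y < 0}) hΩ.isOpen hΩ.interior_closure hx
        (ball_mem_nhds x hr) hpos.isPreconnected ?_
        (fun y hy => hy.1) (fun y hy => hy.elim And.left And.left) ?_ ?_ ?_
      · -- the two half discs share a point on the ray opposite to `d₁ + d₂`
        set ε := r / (‖d₁ + d₂‖ + 1) with hε
        have hε0 : 0 < ε := by positivity
        have hzb : x + (-ε) • d₁ + (-ε) • d₂ ∈ ball x r := by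
          rw [mem_ball, dist_eq_norm, show x + (-ε) • d₁ + (-ε) • d₂ - x = (-ε) • (d₁ + d₂) by
            module, norm_smul, norm_neg, Real.norm_of_nonneg hε0.le, hε, div_mul_eq_mul_div,
            div_lt_iff₀ (by positivity)]
          nlinarith [norm_nonneg (d₁ + d₂)]
        refine IsPreconnected.union (x + (-ε) • d₁ + (-ε) • d₂) ⟨hzb, ?_⟩ ⟨hzb, ?_⟩
          (hneg hαc).isPreconnected (hneg hβc).isPreconnected
        · rw [hαe]
          linarith
        · rw [hβe]
          linarith
      · refine Set.disjoint_left.2 fun y hy hyf => ?_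
        rcases (hrays y).1 ((hf y hy.1).1 hyf) with ⟨-, h⟩ | ⟨h, -⟩
        · exact hy.2.2.ne' h
        · exact hy.2.1.ne' h
      · refine Set.disjoint_left.2 fun y hy hyf => ?_
        have hyb : y ∈ ball x r := hy.elim And.left And.left
        rcases (hrays y).1 ((hf y hyb).1 hyf) with ⟨h1, h2⟩ | ⟨h1, h2⟩ <;>
          rcases hy with ⟨-, h3⟩ | ⟨-, h3⟩ <;> linarith
      · intro y hy
        by_cases h1 : α y < 0
        · exact Or.inl (Or.inr (Or.inl ⟨hy, h1⟩))
        by_cases h2 : β y < 0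
        · exact Or.inl (Or.inr (Or.inr ⟨hy, h2⟩))
        push Not at h1 h2
        by_cases h3 : 0 < α y ∧ 0 < β y
        · exact Or.inl (Or.inl ⟨hy, h3⟩)
        · refine Or.inr ((hf y hy).2 ((hrays y).2 ?_))
          rcases h1.eq_or_lt with h1' | h1'
          · exact Or.inr ⟨h1'.symm, h2⟩
          · rcases h2.eq_or_lt with h2' | h2'
            · exact Or.inl ⟨h1, h2'.symm⟩
            · exact absurd ⟨h1', h2'⟩ h3
  · -- the boundary near `x` is a cone, so an open segment from `x` to `y ∈ Ω` does not meet it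
    rintro y ⟨hyΩ, hyb⟩ s ⟨hs0, hs1⟩
    have hsub : segment ℝ (x + s • (y - x)) y ⊆ {z | ∃ σ : ℝ, 0 < σ ∧ σ ≤ 1 ∧ z = x + σ • (y - x)} := by
      rw [segment_eq_image]
      rintro z ⟨t, ht, rfl⟩
      refine ⟨(1 - t) * s + t, ?_, ?_, ?_⟩
      · rcases ht.1.eq_or_lt with h | h
        · rw [← h]
          linarith
        · have := mul_nonneg (sub_nonneg.2 ht.2) hs0.le
          linarith
      · nlinarith [ht.1, ht.2]
      · module
    have hdisj : Disjoint (segment ℝ (x + s • (y - x)) y) (frontier Ω) := by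
      refine Set.disjoint_left.2 fun z hz hzf => ?_
      obtain ⟨σ, hσ0, hσ1, rfl⟩ := hsub hz
      have hzb : x + σ • (y - x) ∈ ball x R := by
        have hyb' : ‖y - x‖ < r := by rwa [← dist_eq_norm]
        rw [mem_ball, dist_eq_norm, add_sub_cancel_left, norm_smul, Real.norm_of_nonneg hσ0.le]
        nlinarith [norm_nonneg (y - x)]
      have hyf : y ∈ frontier Ω := by
        rw [hf y (ball_subset_ball hrR hyb)]
        have hdiv : ∀ {t : ℝ} {d : Plane}, x + σ • (y - x) = x + t • d →
            y = x + (t / σ) • d := fun {t d} h => by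
          have h1 : y - x = (t / σ) • d := by
            rw [div_eq_inv_mul, mul_smul, ← add_left_cancel h, smul_smul, inv_mul_cancel₀ hσ0.ne',
              one_smul]
          rw [← h1]
          abel
        rcases (hf _ hzb).1 hzf with ⟨t, ht, h⟩ | ⟨t, ht, h⟩
        · exact Or.inl ⟨t / σ, by positivity, hdiv h⟩
        · exact Or.inr ⟨t / σ, by positivity, hdiv h⟩
      rw [frontier, hΩ.isOpen.interior_eq] at hyf
      exact hyf.2 hyΩ
    rcases subset_or_disjoint_of_disjoint_frontier hΩ.isOpen
      (convex_segment (x + s • (y - x)) y).isPreconnected hdisj with h | h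
    · exact h (left_mem_segment ℝ _ _)
    · exact absurd hyΩ (Set.disjoint_left.1 h (right_mem_segment ℝ _ _))

end Polygon

/-! ### Continuous representatives up to the boundary -/

section Extension

variable {n : ℕ} [NeZero n] {Ω : Set Plane} {V : Fin n → Plane} {T : Finset (Finset Plane)}
  {P : Finset Plane → MvPolynomial (Fin 2) ℝ}

/-- Polynomials on the triangles that agree at the points of `Ω` agree on `closure Ω`. Along the
connected sector `Ω ∩ ball x r` at a boundary point `x`, the value at `x` of the polynomial
belonging to the triangle around the current point is locally constant. -/
theorem polyFun_eq_of_agree (hΩ : IsPolygonalDomain Ω V) (hT : IsMesh T Ω)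
    (h : ∀ K ∈ T, ∀ K' ∈ T, ∀ x ∈ Ω, x ∈ tri K → x ∈ tri K' → polyFun (P K) x = polyFun (P K') x)
    {K K' : Finset Plane} (hK : K ∈ T) (hK' : K' ∈ T) {x : Plane} (hxK : x ∈ tri K)
    (hxK' : x ∈ tri K') : polyFun (P K) x = polyFun (P K') x := by
  by_cases hxΩ : x ∈ Ω
  · exact h K hK K' hK' x hxΩ hxK hxK'
  have hxf : x ∈ frontier Ω := by
    rw [frontier, hΩ.isOpen.interior_eq]
    exact ⟨hT.tri_subset hK hxK, hxΩ⟩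
  obtain ⟨R, hR, hsec⟩ := hΩ.exists_sector hxf
  obtain ⟨R', hR', hloc⟩ := Metric.eventually_nhds_iff_ball.1
    (eventually_mem_imp_mem (C := tri) (T := T) (fun K _ => isClosed_tri K) x)
  set r := min R R' with hr
  have hr0 : 0 < r := lt_min hR hR'
  obtain ⟨hconn, hcone⟩ := hsec r hr0 (min_le_left _ _)
  have hloc' : ∀ y ∈ Ω ∩ ball x r, ∀ K ∈ T, y ∈ tri K → x ∈ tri K := fun y hy =>
    hloc y (ball_subset_ball (min_le_right _ _) hy.2)
  have hex : ∀ y ∈ Ω ∩ ball x r, ∃ K ∈ T, y ∈ tri K := fun y hy =>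
    hT.exists_mem (subset_closure hy.1)
  choose! κ hκT hκ using hex
  have hwd : ∀ y ∈ Ω ∩ ball x r, ∀ K ∈ T, y ∈ tri K →
      polyFun (P (κ y)) x = polyFun (P K) x := by
    intro y hy K hK hyK
    have hcont : ∀ K : Finset Plane, Tendsto (fun s : ℝ => polyFun (P K) (x + s • (y - x)))
        (𝓝[>] 0) (𝓝 (polyFun (P K) x)) := fun K => by
      have h1 : Continuous fun s : ℝ => polyFun (P K) (x + s • (y - x)) :=
        (continuous_polyFun _).comp (by fun_prop)
      have h2 := (h1.tendsto 0).mono_left (nhdsWithin_le_nhds (s := Set.Ioi 0))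
      simpa using h2
    have hmem : ∀ K ∈ T, y ∈ tri K → ∀ s ∈ Set.Ioc (0 : ℝ) 1, x + s • (y - x) ∈ tri K :=
      fun K hK hyK s hs => (convex_tri K).add_smul_sub_mem (hloc' y hy K hK hyK) hyK ⟨hs.1.le, hs.2⟩
    refine tendsto_nhds_unique_of_eventuallyEq (hcont _) (hcont K) ?_
    filter_upwards [Ioc_mem_nhdsGT zero_lt_one] with s hs
    exact h _ (hκT y hy) _ hK _ (hcone y hy s hs) (hmem _ (hκT y hy) (hκ y hy) s hs)
      (hmem K hK hyK s hs)
  have hfin : ((fun y => polyFun (P (κ y)) x) '' (Ω ∩ ball x r)).Finite := by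
    refine (T.finite_toSet.image fun K => polyFun (P K) x).subset ?_
    rintro _ ⟨y, hy, rfl⟩
    exact ⟨κ y, hκT y hy, rfl⟩
  have hcont : ContinuousOn (fun y => polyFun (P (κ y)) x) (Ω ∩ ball x r) := by
    intro y hy
    refine (continuousWithinAt_const (b := polyFun (P (κ y)) x)).congr_of_eventuallyEq ?_ rfl
    have h1 := (eventually_mem_imp_mem (C := tri) (T := T) (fun K _ => isClosed_tri K) y)
    filter_upwards [nhdsWithin_le_nhds h1, self_mem_nhdsWithin] with z hz hzS
    exact (hwd y hy _ (hκT z hzS) (hz _ (hκT z hzS) (hκ z hzS))).symm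
  have hval : ∀ K ∈ T, x ∈ tri K → ∃ y ∈ Ω ∩ ball x r, polyFun (P (κ y)) x = polyFun (P K) x := by
    intro K hK hxK
    have hxc : x ∈ closure (interior (tri K)) := by rwa [hT.closure_interior hK]
    obtain ⟨y, hy, hyx⟩ := Metric.mem_closure_iff.1 hxc r hr0
    have hyS : y ∈ Ω ∩ ball x r := ⟨hT.interior_subset hΩ.interior_closure hK hy, by rwa [mem_ball']⟩
    exact ⟨y, hyS, hwd y hyS K hK (interior_subset hy)⟩
  obtain ⟨y, hy, hyK⟩ := hval K hK hxK
  obtain ⟨z, hz, hzK⟩ := hval K' hK' hxK'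
  rw [← hyK, ← hzK]
  exact eq_of_isPreconnected_of_finite_image hconn hcont hfin hy hz

theorem exists_isPiecewise_of_agree (hΩ : IsPolygonalDomain Ω V) (hT : IsMesh T Ω)
    (h : ∀ K ∈ T, ∀ K' ∈ T, ∀ x ∈ Ω, x ∈ tri K → x ∈ tri K' →
      polyFun (P K) x = polyFun (P K') x) : ∃ f, IsPiecewise T P f := by
  have hex : ∀ x ∈ closure Ω, ∃ K ∈ T, x ∈ tri K := fun x hx => hT.exists_mem hx
  choose! κ hκT hκ using hex
  refine ⟨fun x => polyFun (P (κ x)) x, fun K hK x hx => ?_⟩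
  have hxc := hT.tri_subset hK hx
  exact polyFun_eq_of_agree hΩ hT h (hκT x hxc) hK (hκ x hxc) hx

/-- A piecewise polynomial function in `H¹(Ω)` has a representative that is continuous on
`closure Ω`. -/
theorem exists_isPiecewise_of_mem_H1 (hΩ : IsPolygonalDomain Ω V) (hT : IsMesh T Ω) {u : L2 Ω}
    (hu : u ∈ H1 Ω) (hP : IsPiecewiseAE T Ω P u) :
    ∃ f, IsPiecewise T P f ∧ u =ᵐ[volume.restrict Ω] f := by
  obtain ⟨f, hf⟩ := exists_isPiecewise_of_agree (P := P) hΩ hT fun K hK K' hK' x hx h1 h2 =>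
    polyFun_eq_of_mem_H1 hT hΩ.interior_closure hu hP hK hK' hx h1 h2
  refine ⟨f, hf, ?_⟩
  filter_upwards [(Filter.eventually_all_finset T).2 hP, ae_restrict_mem hΩ.isOpen.measurableSet]
    with x hx hxΩ
  obtain ⟨K, hK, hxK⟩ := hT.exists_mem (subset_closure hxΩ)
  rw [hx K hK hxK, hf K hK x hxK]

end Extension

/-! ### Potentials on simply connected domains -/

/-- The real numbers with the discrete topology, which makes a fiber bundle with this fiber a
covering space. -/
def DiscreteReal : Type := ℝ

instance : AddCommGroup DiscreteReal := inferInstanceAs (AddCommGroup ℝ)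

instance : TopologicalSpace DiscreteReal := ⊥

instance : DiscreteTopology DiscreteReal := ⟨rfl⟩

section Cocycle

variable {X : Type*} [TopologicalSpace X]

/-- The bundle of germs of functions that differ from the local functions `g x` by constants. In the
chart of index `i`, the element `v` of the fiber over `x` stands for the germ of `g i + v`. -/
def germCore (U : X → Set X) (hU : ∀ x, IsOpen (U x)) (hxU : ∀ x, x ∈ U x) (g : X → X → ℝ)
    (hg : ∀ x y, ∀ z ∈ U x ∩ U y, ∀ᶠ w in 𝓝 z, g x w - g y w = g x z - g y z) :
    FiberBundleCore X X DiscreteReal where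
  baseSet := U
  isOpen_baseSet := hU
  indexAt := id
  mem_baseSet_at := hxU
  coordChange i j x v := v + (show DiscreteReal from g i x - g j x)
  coordChange_self i x _ v := by
    rw [sub_self]
    exact add_zero (M := ℝ) v
  continuousOn_coordChange i j := by
    rintro ⟨z, v⟩ ⟨hz, -⟩
    refine ContinuousAt.continuousWithinAt ?_
    refine (continuousAt_const (y := v + (show DiscreteReal from g i z - g j z))).congr ?_
    have h1 : ∀ᶠ p : X × DiscreteReal in 𝓝 (z, v), p.2 = v :=
      (continuous_snd.tendsto (z, v)) ((isOpen_discrete {v}).mem_nhds rfl)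
    have h2 : ∀ᶠ p : X × DiscreteReal in 𝓝 (z, v), g i p.1 - g j p.1 = g i z - g j z :=
      (continuous_fst.tendsto (z, v)).eventually (hg i j z hz)
    filter_upwards [h1, h2] with p hp1 hp2
    rw [hp1, hp2]
  coordChange_comp i j k x _ v := by
    have : ∀ a b c d : ℝ, d + (a - b) + (b - c) = d + (a - c) := fun a b c d => by ring
    exact this _ _ _ v

/-- On a simply connected space local functions that differ by locally constant functions can be
glued, up to locally constant functions: the germs form a covering space, and it has a section. -/
theorem exists_glue [SimplyConnectedSpace X] [LocallyPathConnectedSpace X]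
    (U : X → Set X) (hU : ∀ x, IsOpen (U x)) (hxU : ∀ x, x ∈ U x) (g : X → X → ℝ)
    (hg : ∀ x y, ∀ z ∈ U x ∩ U y, ∀ᶠ w in 𝓝 z, g x w - g y w = g x z - g y z) :
    ∃ f : X → ℝ, ∀ x, ∀ z ∈ U x, ∀ᶠ w in 𝓝 z, f w - g x w = f z - g x z := by
  set Z := germCore U hU hxU g hg with hZ
  have hcov : IsCoveringMap (Bundle.TotalSpace.proj : Bundle.TotalSpace DiscreteReal Z.Fiber → X) :=
    FiberBundle.isCoveringMap
  obtain ⟨x₀⟩ : Nonempty X := inferInstance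
  obtain ⟨s, ⟨-, hs⟩, -⟩ := hcov.existsUnique_continuousMap_lifts (ContinuousMap.id X) x₀
    ⟨x₀, (0 : DiscreteReal)⟩ rfl
  have hs' : ∀ z, (s z).proj = z := fun z => congrFun hs z
  refine ⟨fun z => g (s z).proj z + (show ℝ from (s z).2), fun x z hz => ?_⟩
  -- in the chart of index `x`, the section `s` is the difference of the glued function and `g x`
  have hcoord : ∀ w, (show ℝ from (Z.localTriv x (s w)).2) =
      (g (s w).proj w + (show ℝ from (s w).2)) - g x w := fun w => by
    have h1 : (Z.localTriv x (s w)).2 = Z.coordChange (Z.indexAt (s w).proj) x (s w).proj (s w).2 :=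
      rfl
    have h2 : (show ℝ from (Z.localTriv x (s w)).2) =
        (show ℝ from (s w).2) + (g (s w).proj (s w).proj - g x (s w).proj) := h1
    rw [h2, hs' w]
    ring
  have hcont : ContinuousAt (fun w => (Z.localTriv x (s w)).2) z := by
    refine continuousAt_snd.comp (ContinuousAt.comp ?_ s.continuous.continuousAt)
    refine (Z.localTriv x).continuousAt ?_
    rw [Z.mem_localTriv_source, hs' z]
    exact hz
  have hconst : ∀ᶠ w in 𝓝 z, (Z.localTriv x (s w)).2 = (Z.localTriv x (s z)).2 :=
    hcont.preimage_mem_nhds ((isOpen_discrete {(Z.localTriv x (s z)).2}).mem_nhds rfl)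
  filter_upwards [hconst] with w hw
  have h1 := hcoord w
  have h2 := hcoord z
  rw [hw] at h1
  exact h1.symm.trans h2

end Cocycle

section Potential

variable {n : ℕ} [NeZero n] {Ω : Set Plane} {V : Fin n → Plane} {T : Finset (Finset Plane)}
  {Q : Finset Plane → MvPolynomial (Fin 2) ℝ}

/-- Local potentials: near `x` subtract from each polynomial its value at `x`. -/
theorem exists_local_potential (hΩo : IsOpen Ω) (hT : IsMesh T Ω)
    (hQ : ∀ K ∈ T, ∀ K' ∈ T, ∀ x ∈ Ω, x ∈ tri K → x ∈ tri K' → polyDiff (Q K) x = polyDiff (Q K') x)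
    {x : Plane} (hx : x ∈ Ω) : ∃ r > 0, ball x r ⊆ Ω ∧ ∃ g : Plane → ℝ,
      ∀ y ∈ ball x r, ∀ K ∈ T, y ∈ tri K → HasFDerivAt g (polyDiff (Q K) y) y := by
  obtain ⟨R, hR, hRΩ⟩ := Metric.isOpen_iff.1 hΩo x hx
  obtain ⟨R', hR', hloc⟩ := Metric.eventually_nhds_iff_ball.1
    (eventually_mem_imp_mem (C := tri) (T := T) (fun K _ => isClosed_tri K) x)
  set r := min R R' with hr
  have hr0 : 0 < r := lt_min hR hR'
  have hrΩ : ball x r ⊆ Ω := (ball_subset_ball (min_le_left _ _)).trans hRΩ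
  have hex : ∀ y ∈ Ω, ∃ K ∈ T, y ∈ tri K := fun y hy => hT.exists_mem (subset_closure hy)
  choose! κ hκT hκ using hex
  have hwd : ∀ y ∈ ball x r, ∀ K ∈ T, y ∈ tri K →
      polyFun (Q (κ y)) y - polyFun (Q (κ y)) x = polyFun (Q K) y - polyFun (Q K) x := by
    intro y hy K hK hyK
    have hyΩ := hrΩ hy
    have hy' := hloc y (ball_subset_ball (min_le_right _ _) hy)
    have hxK := hy' K hK hyK
    have hxκ := hy' _ (hκT y hyΩ) (hκ y hyΩ)
    have hder : ∀ z ∈ segment ℝ x y, HasFDerivWithinAt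
        (fun z => polyFun (Q (κ y)) z - polyFun (Q K) z) (0 : Plane →L[ℝ] ℝ) (segment ℝ x y) z := by
      intro z hz
      have h1 := hQ _ (hκT y hyΩ) K hK z
        (hrΩ ((convex_ball x r).segment_subset (mem_ball_self hr0) hy hz))
        ((convex_tri _).segment_subset hxκ (hκ y hyΩ) hz)
        ((convex_tri _).segment_subset hxK hyK hz)
      have h2 := (hasFDerivAt_polyFun (Q (κ y)) z).sub (hasFDerivAt_polyFun (Q K) z)
      rw [h1, sub_self] at h2
      exact h2.hasFDerivWithinAt
    have h3 := (convex_segment x y).norm_image_sub_le_of_norm_hasFDerivWithin_le (C := 0) hder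
      (fun _ _ => by simp) (left_mem_segment ℝ x y) (right_mem_segment ℝ x y)
    rw [zero_mul, norm_le_zero_iff] at h3
    linarith
  refine ⟨r, hr0, hrΩ, fun y => polyFun (Q (κ y)) y - polyFun (Q (κ y)) x, fun y hy K hK hyK => ?_⟩
  have hnhds : closure Ω ∈ 𝓝 y := mem_of_superset (hΩo.mem_nhds (hrΩ hy)) subset_closure
  refine HasFDerivWithinAt.hasFDerivAt ?_ hnhds
  rw [← hT.cover]
  refine hasFDerivWithinAt_biUnion_finset (fun K _ => isClosed_tri K) fun K' hK' hyK' => ?_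
  rw [hQ K hK K' hK' y (hrΩ hy) hyK hyK']
  refine (((hasFDerivAt_polyFun (Q K') y).sub_const
    (polyFun (Q K') x)).hasFDerivWithinAt).congr_of_eventuallyEq ?_ (hwd y hy K' hK' hyK')
  filter_upwards [nhdsWithin_le_nhds (isOpen_ball.mem_nhds hy), self_mem_nhdsWithin] with z hz hzK
  exact hwd z hz K' hK' hzK

/-- Polynomial potentials on the triangles whose gradients agree at the points of the simply
connected domain `Ω` come from one function on `Ω`, up to constants on the triangles. -/
theorem exists_potential (hΩo : IsOpen Ω) (hΩs : SimplyConnectedSpace Ω) (hT : IsMesh T Ω)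
    (hQ : ∀ K ∈ T, ∀ K' ∈ T, ∀ x ∈ Ω, x ∈ tri K → x ∈ tri K' →
      polyDiff (Q K) x = polyDiff (Q K') x) :
    ∃ f : Plane → ℝ, ∀ x ∈ Ω, ∀ K ∈ T, x ∈ tri K → HasFDerivAt f (polyDiff (Q K) x) x := by
  have hlp : LocallyPathConnectedSpace Ω := hΩo.locallyPathConnectedSpace
  have hloc : ∀ x : Ω, ∃ r > 0, ball (x : Plane) r ⊆ Ω ∧ ∃ g : Plane → ℝ,
      ∀ y ∈ ball (x : Plane) r, ∀ K ∈ T, y ∈ tri K → HasFDerivAt g (polyDiff (Q K) y) y :=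
    fun x => exists_local_potential hΩo hT hQ x.2
  choose r hr hrΩ g hg using hloc
  have hdiff : ∀ x y : Ω, ∀ z ∈ ball (x : Plane) (r x) ∩ ball (y : Plane) (r y),
      ∀ w ∈ ball (x : Plane) (r x) ∩ ball (y : Plane) (r y), g x w - g y w = g x z - g y z := by
    intro x y z hz w hw
    have hder : ∀ v ∈ ball (x : Plane) (r x) ∩ ball (y : Plane) (r y), HasFDerivWithinAt
        (fun v => g x v - g y v) (0 : Plane →L[ℝ] ℝ)
        (ball (x : Plane) (r x) ∩ ball (y : Plane) (r y)) v := by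
      intro v hv
      obtain ⟨K, hK, hvK⟩ := hT.exists_mem (subset_closure (hrΩ x hv.1))
      have := (hg x v hv.1 K hK hvK).sub (hg y v hv.2 K hK hvK)
      rw [sub_self] at this
      exact this.hasFDerivWithinAt
    have h3 := ((convex_ball (x : Plane) (r x)).inter
      (convex_ball (y : Plane) (r y))).norm_image_sub_le_of_norm_hasFDerivWithin_le (C := 0) hder
      (fun _ _ => by simp) hz hw
    rw [zero_mul, norm_le_zero_iff] at h3
    linarith
  set U : Ω → Set Ω := fun x => Subtype.val ⁻¹' ball (x : Plane) (r x) with hU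
  have hUo : ∀ x, IsOpen (U x) := fun x => isOpen_ball.preimage continuous_subtype_val
  obtain ⟨f, hf⟩ := exists_glue U hUo
    (fun x => mem_ball_self (hr x)) (fun x y => g x y) fun x y z hz => by
      filter_upwards [((hUo x).inter (hUo y)).mem_nhds hz] with w hw
      exact hdiff x y z hz w hw
  classical
  refine ⟨fun y => if h : y ∈ Ω then f ⟨y, h⟩ else 0, fun x hx K hK hxK => ?_⟩
  set x' : Ω := ⟨x, hx⟩ with hx'
  have h1 := hf x' x' (mem_ball_self (hr x'))
  rw [nhds_subtype_eq_comap, eventually_comap] at h1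
  refine ((hg x' x (mem_ball_self (hr x')) K hK hxK).add_const (f x' - g x' x)).congr_of_eventuallyEq
    ?_
  filter_upwards [h1, hΩo.mem_nhds hx] with y hy hyΩ
  have h2 := hy ⟨y, hyΩ⟩ rfl
  simp only at h2
  rw [dif_pos hyΩ]
  linarith

end Potential

/-! ### Boundary traces -/

section Trace

variable {Ω : Set Plane} {u w : Plane → ℝ} {S : Set Plane}

theorem HasTraceOn.mono {g : Plane → ℝ} {S' : Set Plane} (h : HasTraceOn Ω u S g) (hS : S' ⊆ S) :
    HasTraceOn Ω u S' g :=
  ae_restrict_of_ae_restrict_of_subset hS h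

theorem hasTraceOn_iUnion {ι : Type*} [Countable ι] {S : ι → Set Plane} {g : Plane → ℝ}
    (h : ∀ i, HasTraceOn Ω u (S i) g) : HasTraceOn Ω u (⋃ i, S i) g :=
  (ae_restrict_iUnion_iff S _).2 h

theorem hasTraceOn_union {S' : Set Plane} {g : Plane → ℝ} (h : HasTraceOn Ω u S g)
    (h' : HasTraceOn Ω u S' g) : HasTraceOn Ω u (S ∪ S') g := by
  rw [HasTraceOn, ae_restrict_union_iff]
  exact ⟨h, h'⟩

theorem HasTraceOn.congr {g : Plane → ℝ} (h : HasTraceOn Ω u S g)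
    (huw : w =ᵐ[volume.restrict Ω] u) : HasTraceOn Ω w S g := by
  filter_upwards [h] with x hx
  refine hx.congr fun r => ?_
  refine laverage_congr ?_
  filter_upwards [ae_restrict_of_ae_restrict_of_subset Set.inter_subset_right huw] with y hy
  rw [hy]

theorem HasTraceOn.linear_comb (hu : AEStronglyMeasurable u (volume.restrict Ω))
    (h : HasTraceOn Ω u S 0) (h' : HasTraceOn Ω w S 0) (a b : ℝ) :
    HasTraceOn Ω (fun y => a * u y + b * w y) S 0 := by
  filter_upwards [h, h'] with x hx hx'
  have hlim : Tendsto (fun r : ℝ =>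
      ‖a‖ₑ * (⨍⁻ y, ‖u y - (0 : Plane → ℝ) x‖ₑ ∂(volume.restrict (ball x r ∩ Ω))) +
      ‖b‖ₑ * ⨍⁻ y, ‖w y - (0 : Plane → ℝ) x‖ₑ ∂(volume.restrict (ball x r ∩ Ω))) (𝓝[>] 0)
      (𝓝 0) := by
    have h1 := (ENNReal.Tendsto.const_mul hx (Or.inr (enorm_ne_top (x := a)))).add
      (ENNReal.Tendsto.const_mul hx' (Or.inr (enorm_ne_top (x := b))))
    simpa using h1
  refine tendsto_of_tendsto_of_tendsto_of_le_of_le tendsto_const_nhds hlim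
    (fun _ => zero_le) fun r => ?_
  have hum : AEStronglyMeasurable u (volume.restrict (ball x r ∩ Ω)) :=
    hu.mono_measure (Measure.restrict_mono Set.inter_subset_right le_rfl)
  simp only [laverage_eq, Pi.zero_apply, sub_zero, ← mul_div_assoc, ENNReal.div_add_div_same]
  refine ENNReal.div_le_div_right ?_ _
  rw [← lintegral_const_mul' _ _ enorm_ne_top, ← lintegral_const_mul' _ _ enorm_ne_top,
    ← lintegral_add_left' (hum.enorm.const_mul _)]
  refine lintegral_mono fun y => ?_
  refine (enorm_add_le _ _).trans ?_
  rw [enorm_mul, enorm_mul]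

/-- A function that becomes uniformly small near each point of `S` has zero trace on `S`; finitely
many further points have arc length zero. -/
theorem hasTraceOn_zero_of_small
    (h : ∀ x ∈ S, ∀ ε > 0, ∃ δ > 0, ∀ᵐ y ∂(volume.restrict Ω), y ∈ ball x δ → |u y| ≤ ε)
    {N : Set Plane} (hS : MeasurableSet (S ∪ N)) (hN : N.Finite) : HasTraceOn Ω u (S ∪ N) 0 := by
  have hN0 : (Measure.hausdorffMeasure 1 : Measure Plane) N = 0 := by
    have := Measure.nullSingletonClass_hausdorff Plane (d := 1) one_pos
    exact hN.measure_zero _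
  filter_upwards [ae_restrict_mem hS, ae_restrict_of_ae (measure_eq_zero_iff_ae_notMem.1 hN0)]
    with x hx hxN
  have hxS := hx.resolve_right hxN
  rw [ENNReal.tendsto_nhds_zero]
  intro ε hε
  obtain ⟨ε', hε', hεε'⟩ : ∃ ε' : ℝ, 0 < ε' ∧ ENNReal.ofReal ε' ≤ ε := by
    rcases eq_or_ne ε ⊤ with rfl | ht
    · exact ⟨1, one_pos, le_top⟩
    · exact ⟨ε.toReal, ENNReal.toReal_pos hε.ne' ht, (ENNReal.ofReal_toReal ht).le⟩
  obtain ⟨δ, hδ, hδ'⟩ := h x hxS ε' hε'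
  filter_upwards [Ioo_mem_nhdsGT hδ] with r hr
  refine le_trans ?_ hεε'
  rw [laverage_eq]
  refine ENNReal.div_le_of_le_mul ?_
  rw [← lintegral_const]
  refine lintegral_mono_ae ?_
  filter_upwards [ae_restrict_of_ae_restrict_of_subset (Set.inter_subset_right
    (s := ball x r)) hδ', ae_restrict_of_ae_restrict_of_subset Set.inter_subset_left
      (ae_restrict_mem measurableSet_ball)] with y hy hyr
  rw [Pi.zero_apply, sub_zero, Real.enorm_eq_ofReal_abs]
  exact ENNReal.ofReal_le_ofReal (hy (ball_subset_ball hr.2.le hyr))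

/-- A function continuous on `closure Ω` is almost everywhere equal to its zero trace. -/
theorem HasTraceOn.ae_eq_zero (hΩo : IsOpen Ω) {f : Plane → ℝ} (hf : ContinuousOn f (closure Ω))
    (huf : u =ᵐ[volume.restrict Ω] f) (h : HasTraceOn Ω u S 0) :
    ∀ᵐ x ∂((Measure.hausdorffMeasure 1 : Measure Plane).restrict S), x ∈ closure Ω → f x = 0 := by
  filter_upwards [h] with x hx hxΩ
  by_contra hne
  set c := |f x| / 2 with hc
  have hc0 : 0 < c := by positivity
  have hnear : ∀ᶠ y in 𝓝[closure Ω] x, c < |f y| := by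
    have h1 : ContinuousWithinAt (fun y => |f y|) (closure Ω) x := (hf x hxΩ).abs
    exact h1.eventually (lt_mem_nhds (half_lt_self (abs_pos.2 hne)))
  obtain ⟨δ, hδ, hδ'⟩ := Metric.eventually_nhds_iff_ball.1 (eventually_nhdsWithin_iff.1 hnear)
  have hge : ∀ᶠ r in 𝓝[>] (0 : ℝ), ENNReal.ofReal c ≤
      ⨍⁻ y, ‖u y - (0 : Plane → ℝ) x‖ₑ ∂(volume.restrict (ball x r ∩ Ω)) := by
    filter_upwards [Ioo_mem_nhdsGT hδ] with r hr
    have hne' : (ball x r ∩ Ω).Nonempty := by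
      obtain ⟨y, hy, hyr⟩ := Metric.mem_closure_iff.1 hxΩ r hr.1
      exact ⟨y, by rwa [mem_ball'], hy⟩
    have hpos : volume (ball x r ∩ Ω) ≠ 0 := ((isOpen_ball.inter hΩo).measure_pos _ hne').ne'
    have hfin : volume (ball x r ∩ Ω) ≠ ⊤ :=
      ((measure_mono Set.inter_subset_left).trans_lt measure_ball_lt_top).ne
    rw [laverage_eq, Measure.restrict_apply_univ, ENNReal.le_div_iff_mul_le (Or.inl hpos)
      (Or.inl hfin), ← setLIntegral_const]
    refine lintegral_mono_ae ?_
    filter_upwards [ae_restrict_of_ae_restrict_of_subset Set.inter_subset_right huf,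
      ae_restrict_mem (isOpen_ball.inter hΩo).measurableSet] with y hy hyb
    rw [hy, Pi.zero_apply, sub_zero, Real.enorm_eq_ofReal_abs]
    exact ENNReal.ofReal_le_ofReal
      (hδ' y (ball_subset_ball hr.2.le hyb.1) (subset_closure hyb.2)).le
  have := ge_of_tendsto hx hge
  rw [nonpos_iff_eq_zero, ENNReal.ofReal_eq_zero] at this
  linarith

end Trace

/-- A function that is continuous on a segment and vanishes almost everywhere on it vanishes
identically. -/
theorem eq_zero_on_segment {a b : Plane} (hab : a ≠ b) {f : Plane → ℝ}
    (hf : ContinuousOn f (segment ℝ a b))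
    (hae : (Measure.hausdorffMeasure 1 : Measure Plane) {x ∈ openSegment ℝ a b | f x ≠ 0} = 0) :
    ∀ x ∈ segment ℝ a b, f x = 0 := by
  set γ : ℝ → Plane := ⇑(AffineMap.lineMap (k := ℝ) a b) with hγ
  have hγc : Continuous γ := AffineMap.lineMap_continuous
  have hγi : Function.Injective γ := AffineMap.lineMap_injective ℝ hab
  have hseg : segment ℝ a b = γ '' Set.Icc 0 1 := segment_eq_image_lineMap ℝ a b
  have hoseg : openSegment ℝ a b = γ '' Set.Ioo 0 1 := openSegment_eq_image_lineMap ℝ a b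
  have hfγ : ContinuousOn (fun s => f (γ s)) (Set.Icc 0 1) :=
    hf.comp hγc.continuousOn fun s hs => hseg ▸ ⟨s, hs, rfl⟩
  have hIoo : Set.EqOn (fun s => f (γ s)) (fun _ => 0) (Set.Ioo 0 1) := by
    intro s hs
    by_contra hne
    have h1 : ∀ᶠ t in 𝓝 s, t ∈ Set.Ioo (0 : ℝ) 1 ∧ f (γ t) ≠ 0 :=
      (isOpen_Ioo.eventually_mem hs).and
        ((hfγ.continuousAt (Icc_mem_nhds hs.1 hs.2)).eventually_ne hne)
    -- `f` would be nonzero on a segment of positive length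
    obtain ⟨δ, hδ, hb⟩ := Metric.eventually_nhds_iff_ball.1 h1
    have hsub : segment ℝ (γ s) (γ (s + δ / 2)) ⊆ {x ∈ openSegment ℝ a b | f x ≠ 0} := by
      rw [← image_segment ℝ (AffineMap.lineMap a b) s (s + δ / 2),
        segment_eq_Icc (by linarith : s ≤ s + δ / 2)]
      rintro _ ⟨t, ht, rfl⟩
      have hts : t ∈ ball s δ := by
        rw [Real.ball_eq_Ioo]
        exact ⟨by linarith [ht.1], by linarith [ht.2]⟩
      exact ⟨hoseg ▸ ⟨t, (hb t hts).1, rfl⟩, (hb t hts).2⟩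
    have h2 := measure_mono_null hsub hae
    rw [hausdorffMeasure_segment, edist_eq_zero] at h2
    have := hγi h2
    linarith
  have hIcc := hIoo.of_subset_closure hfγ continuousOn_const Set.Ioo_subset_Icc_self
    (by rw [closure_Ioo zero_ne_one])
  intro x hx
  rw [hseg] at hx
  obtain ⟨s, hs, rfl⟩ := hx
  exact hIcc hs

section Edge

variable {n : ℕ} [NeZero n] {Ω : Set Plane} {V : Fin n → Plane} {T : Finset (Finset Plane)}
  {P : Finset Plane → MvPolynomial (Fin 2) ℝ}

theorem IsPolygonalDomain.segment_subset (hΩ : IsPolygonalDomain Ω V) (i : Fin n) :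
    segment ℝ (V i) (V (i + 1)) ⊆ closure Ω := by
  refine Set.Subset.trans ?_ frontier_subset_closure
  rw [hΩ.frontier_eq]
  exact Set.subset_iUnion (fun i => segment ℝ (V i) (V (i + 1))) i

theorem isClosed_segment (a b : Plane) : IsClosed (segment ℝ a b) := by
  rw [← convexHull_pair]
  exact ((Set.toFinite _).isCompact_convexHull ℝ).isClosed

/-- A zero trace on an edge is attained pointwise by the continuous representative. -/
theorem IsPiecewise.eq_zero_of_hasTraceOn (hΩ : IsPolygonalDomain Ω V) (hT : IsMesh T Ω)
    {f : Plane → ℝ} (hf : IsPiecewise T P f) {u : Plane → ℝ} (hu : u =ᵐ[volume.restrict Ω] f)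
    {i : Fin n} (h : HasTraceOn Ω u (edge V i) 0) :
    ∀ x ∈ segment ℝ (V i) (V (i + 1)), f x = 0 := by
  have hc := hf.continuousOn hT
  refine eq_zero_on_segment (hΩ.vertex_ne i).symm (hc.mono (hΩ.segment_subset i)) ?_
  have h1 := h.ae_eq_zero hΩ.isOpen hc hu
  rw [ae_iff] at h1
  refine measure_mono_null ?_ (le_antisymm ((Measure.le_restrict_apply _ _).trans h1.le) zero_le)
  rintro x ⟨hx, hx0⟩
  exact ⟨fun h2 => hx0 (h2 (hΩ.segment_subset i (openSegment_subset_segment ℝ _ _ hx))), hx⟩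

theorem hasTraceOn_of_eq_zero (hT : IsMesh T Ω) {f : Plane → ℝ} (hf : IsPiecewise T P f)
    {u : Plane → ℝ} (hu : u =ᵐ[volume.restrict Ω] f) {a b : Plane}
    (hab : segment ℝ a b ⊆ closure Ω) (h : ∀ x ∈ segment ℝ a b, f x = 0) :
    HasTraceOn Ω u (segment ℝ a b) 0 := by
  rw [← Set.union_empty (segment ℝ a b)]
  refine hasTraceOn_zero_of_small (fun x hx ε hε => ?_)
    (by rw [Set.union_empty]; exact (isClosed_segment a b).measurableSet) Set.finite_empty
  have h1 := Metric.continuousWithinAt_iff.1 (hf.continuousOn hT x (hab hx)) ε hε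
  obtain ⟨δ, hδ, hδ'⟩ := h1
  refine ⟨δ, hδ, ?_⟩
  have hΩm : ∀ᵐ y ∂(volume.restrict Ω), y ∈ closure Ω :=
    ae_restrict_of_ae_restrict_of_subset subset_closure
      (ae_restrict_mem isClosed_closure.measurableSet)
  filter_upwards [hu, hΩm] with y hy hyΩ hyδ
  have := hδ' hyΩ hyδ
  rw [h x hx, dist_zero_right, Real.norm_eq_abs] at this
  rw [hy]
  exact this.le

theorem sum_tangent_mul (V : Fin n → Plane) (i : Fin n) (c : Fin 2 → ℝ) :
    ∑ j, tangent V i j * c j = ‖V (i + 1) - V i‖⁻¹ * covec c (V (i + 1) - V i) := by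
  rw [covec_apply, Finset.mul_sum]
  refine Finset.sum_congr rfl fun j _ => ?_
  rw [tangent, PiLp.smul_apply, smul_eq_mul]
  ring

/-- If `f` vanishes on an edge, then its tangential derivative has zero trace there: a triangle
meets the edge in a nondegenerate segment, along which its polynomial vanishes, or in at most one
point, and finitely many points do not matter. -/
theorem hasTraceOn_tangent_of_eq_zero (hΩ : IsPolygonalDomain Ω V) (hT : IsMesh T Ω)
    {f : Plane → ℝ} (hf : IsPiecewise T P f) {i : Fin n}
    (h : ∀ x ∈ segment ℝ (V i) (V (i + 1)), f x = 0) {g : Fin 2 → Plane → ℝ}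
    (hg : ∀ j, IsPiecewiseAE T Ω (fun K => MvPolynomial.pderiv j (P K)) (g j)) :
    HasTraceOn Ω (fun y => ∑ j, tangent V i j * g j y) (edge V i) 0 := by
  set a := V i with ha
  set d := V (i + 1) - V i with hd
  -- the points in which some triangle touches the edge
  set N : Set Plane := {x | ∃ K ∈ T, tri K ∩ segment ℝ (V i) (V (i + 1)) = {x}} with hN
  have hNfin : N.Finite := by
    have : N = ⋃ K ∈ (T : Set (Finset Plane)),
        {x | tri K ∩ segment ℝ (V i) (V (i + 1)) = {x}} := by
      ext x
      simp [hN]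
    rw [this]
    refine T.finite_toSet.biUnion fun K _ => Set.Subsingleton.finite fun x hx y hy => ?_
    exact Set.singleton_eq_singleton_iff.1 (hx.symm.trans hy)
  have hsegm : MeasurableSet (segment ℝ (V i) (V (i + 1))) := (isClosed_segment _ _).measurableSet
  have hcover : segment ℝ (V i) (V (i + 1)) \ N ∪ N = segment ℝ (V i) (V (i + 1)) ∪ N :=
    Set.sdiff_union_self
  have hdir : ∀ x ∈ segment ℝ (V i) (V (i + 1)) \ N, ∀ K ∈ T, x ∈ tri K →
      polyDiff (P K) x d = 0 := by
    rintro x ⟨hx, hxN⟩ K hK hxK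
    obtain ⟨x', hx', hne⟩ : ∃ x' ∈ tri K ∩ segment ℝ (V i) (V (i + 1)), x' ≠ x := by
      by_contra! hcon
      exact hxN ⟨K, hK, Set.Subset.antisymm (fun y hy => hcon y hy)
        (Set.singleton_subset_iff.2 ⟨hxK, hx⟩)⟩
    have hder : HasDerivWithinAt (fun s : ℝ => polyFun (P K) (x + s • (x' - x)))
        (polyDiff (P K) x (x' - x)) (Set.Icc 0 1) 0 := by
      have h1 : HasFDerivAt (polyFun (P K)) (polyDiff (P K) x) (x + (0 : ℝ) • (x' - x)) := by
        rw [zero_smul, add_zero]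
        exact hasFDerivAt_polyFun _ _
      have h2 : HasDerivAt (fun s : ℝ => x + s • (x' - x)) (x' - x) 0 := by
        simpa using ((hasDerivAt_id (0 : ℝ)).smul_const (x' - x)).const_add x
      exact (h1.comp_hasDerivAt 0 h2).hasDerivWithinAt
    have hzero : HasDerivWithinAt (fun s : ℝ => polyFun (P K) (x + s • (x' - x)))
        0 (Set.Icc 0 1) 0 := by
      have h1 : ∀ s ∈ Set.Icc (0 : ℝ) 1, polyFun (P K) (x + s • (x' - x)) = 0 := fun s hs => by
        rw [← hf K hK _ ((convex_tri K).add_smul_sub_mem hxK hx'.1 hs)]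
        exact h _ ((convex_segment _ _).add_smul_sub_mem hx hx'.2 hs)
      exact (hasDerivWithinAt_const (0 : ℝ) _ (0 : ℝ)).congr h1 (h1 0 (by simp))
    have h0 := (uniqueDiffOn_Icc zero_lt_one (0 : ℝ) (by simp)).eq_deriv _ hder hzero
    rw [segment_eq_image'] at hx
    rw [segment_eq_image'] at hx'
    obtain ⟨s, -, rfl⟩ := hx
    obtain ⟨-, s', -, rfl⟩ := hx'
    have hdiff : V i + s' • (V (i + 1) - V i) - (V i + s • (V (i + 1) - V i)) =
        (s' - s) • d := by
      rw [hd]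
      module
    simp only at h0 hne ⊢
    rw [hdiff, map_smul, smul_eq_mul] at h0
    refine (mul_eq_zero.1 h0).resolve_left fun hs => hne ?_
    rw [sub_eq_zero.1 hs]
  have main : HasTraceOn Ω (fun y => ∑ j, tangent V i j * g j y)
      (segment ℝ (V i) (V (i + 1)) \ N ∪ N) 0 := by
    refine hasTraceOn_zero_of_small (fun x hx ε hε => ?_)
      (by rw [hcover]; exact hsegm.union hNfin.measurableSet) hNfin
    have h1 : ∀ᶠ y in 𝓝 x, ∀ K ∈ T, x ∈ tri K → |‖d‖⁻¹ * polyDiff (P K) y d| ≤ ε := by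
      rw [Filter.eventually_all_finset]
      intro K hK
      by_cases hxK : x ∈ tri K
      · have hcont : Continuous fun y => |‖d‖⁻¹ * polyDiff (P K) y d| :=
          (continuous_const.mul ((continuous_polyDiff (P K)).clm_apply continuous_const)).abs
        have hlt : |‖d‖⁻¹ * polyDiff (P K) x d| < ε := by
          rw [hdir x hx K hK hxK, mul_zero, abs_zero]
          exact hε
        filter_upwards [(hcont.tendsto x).eventually (gt_mem_nhds hlt)] with y hy _
        exact hy.le
      · exact Eventually.of_forall fun _ h => absurd h hxK
    obtain ⟨δ, hδ, hδ'⟩ := Metric.eventually_nhds_iff_ball.1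
      (h1.and (eventually_mem_imp_mem (C := tri) (T := T) (fun K _ => isClosed_tri K) x))
    refine ⟨δ, hδ, ?_⟩
    have hg' : ∀ᵐ y ∂(volume.restrict Ω), ∀ K ∈ T, y ∈ tri K → ∀ j,
        g j y = polyFun (MvPolynomial.pderiv j (P K)) y := by
      rw [Filter.eventually_all_finset]
      intro K hK
      filter_upwards [hg 0 K hK, hg 1 K hK] with y h0 h1 hyK j
      fin_cases j
      · exact h0 hyK
      · exact h1 hyK
    filter_upwards [hg', ae_restrict_mem hΩ.isOpen.measurableSet] with y hy hyΩ hyδ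
    obtain ⟨K, hK, hyK⟩ := hT.exists_mem (subset_closure hyΩ)
    rw [sum_tangent_mul]
    have h2 : (fun j => g j y) = fun j => polyFun (MvPolynomial.pderiv j (P K)) y :=
      funext fun j => hy K hK hyK j
    rw [h2]
    exact (hδ' y hyδ).1 K hK ((hδ' y hyδ).2 K hK hyK)
  rw [hcover] at main
  exact main.mono ((openSegment_subset_segment ℝ _ _).trans Set.subset_union_left)

/-- If the tangential derivatives of the pieces vanish along an edge, then `f` is constant on
that edge. -/
theorem IsPiecewise.eq_on_segment (hΩ : IsPolygonalDomain Ω V) (hT : IsMesh T Ω)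
    {f : Plane → ℝ} (hf : IsPiecewise T P f) {i : Fin n}
    (h : ∀ x ∈ segment ℝ (V i) (V (i + 1)), ∀ K ∈ T, x ∈ tri K →
      polyDiff (P K) x (V (i + 1) - V i) = 0) :
    ∀ x ∈ segment ℝ (V i) (V (i + 1)), f x = f (V i) := by
  set d := V (i + 1) - V i with hd
  set γ : ℝ → Plane := fun s => V i + s • d with hγ
  have hγc : Continuous γ := by fun_prop
  have hseg : segment ℝ (V i) (V (i + 1)) = γ '' Set.Icc 0 1 := segment_eq_image' ℝ _ _
  have hder : ∀ s ∈ Set.Icc (0 : ℝ) 1, HasDerivWithinAt (fun s => f (γ s)) 0 (Set.Icc 0 1) s := by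
    intro s hs
    have hcov : Set.Icc (0 : ℝ) 1 ⊆ ⋃ K ∈ T, γ ⁻¹' tri K := fun t ht => by
      have hm : γ t ∈ segment ℝ (V i) (V (i + 1)) := by
        rw [hseg]
        exact ⟨t, ht, rfl⟩
      obtain ⟨K, hK, hKt⟩ := hT.exists_mem (hΩ.segment_subset i hm)
      exact Set.mem_biUnion hK hKt
    rw [hasDerivWithinAt_iff_hasFDerivWithinAt]
    refine HasFDerivWithinAt.mono ?_ hcov
    refine hasFDerivWithinAt_biUnion_finset (fun K _ => (isClosed_tri K).preimage hγc)
      fun K hK hsK => ?_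
    have h2 : HasDerivAt γ d s := by
      simpa [hγ] using ((hasDerivAt_id s).smul_const d).const_add (V i)
    have h3 := (hasFDerivAt_polyFun (P K) (γ s)).comp_hasDerivAt s h2
    rw [h (γ s) (by rw [hseg]; exact ⟨s, hs, rfl⟩) K hK hsK] at h3
    rw [← hasDerivWithinAt_iff_hasFDerivWithinAt]
    exact h3.hasDerivWithinAt.congr (fun t ht => hf K hK _ ht) (hf K hK _ hsK)
  intro x hx
  rw [hseg] at hx
  obtain ⟨s, hs, rfl⟩ := hx
  have := constant_of_derivWithin_zero (fun t ht => (hder t ht).differentiableWithinAt)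
    (fun t ht => (hder t (Set.Ico_subset_Icc_self ht)).derivWithin
      (uniqueDiffOn_Icc zero_lt_one t (Set.Ico_subset_Icc_self ht))) s hs
  simpa [hγ] using this

variable {bc : Fin n → BoundaryType}

theorem gammaCS_subset : gammaCS V bc ⊆ ⋃ i, ⋃ _ : bc i = .clamped ∨ bc i = .simplySupported,
    segment ℝ (V i) (V (i + 1)) := by
  have hcl : IsClosed (⋃ i, ⋃ _ : bc i = .clamped ∨ bc i = .simplySupported,
      segment ℝ (V i) (V (i + 1))) :=
    isClosed_iUnion_of_finite fun i => isClosed_iUnion_of_finite fun _ => isClosed_segment _ _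
  refine Set.union_subset (closure_minimal ?_ hcl) (closure_minimal ?_ hcl)
  · exact Set.iUnion_mono fun i => Set.iUnion_subset fun h =>
      (openSegment_subset_segment ℝ _ _).trans (Set.subset_iUnion_of_subset (Or.inl h) subset_rfl)
  · exact Set.iUnion_mono fun i => Set.iUnion_subset fun h =>
      (openSegment_subset_segment ℝ _ _).trans (Set.subset_iUnion_of_subset (Or.inr h) subset_rfl)

theorem segment_subset_gammaCS {i : Fin n} (h : bc i = .clamped ∨ bc i = .simplySupported) :
    segment ℝ (V i) (V (i + 1)) ⊆ gammaCS V bc := by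
  rw [← closure_openSegment]
  rcases h with h | h
  · exact (closure_mono (Set.subset_biUnion_of_mem (u := fun i => edge V i) h)).trans
      Set.subset_union_left
  · exact (closure_mono (Set.subset_biUnion_of_mem (u := fun i => edge V i) h)).trans
      Set.subset_union_right

theorem gammaCS_subset_closure (hΩ : IsPolygonalDomain Ω V) : gammaCS V bc ⊆ closure Ω :=
  gammaCS_subset.trans (Set.iUnion_subset fun i => Set.iUnion_subset fun _ => hΩ.segment_subset i)

end Edge

/-! ### Weak derivatives as linear maps -/

section WeakPartial

variable {Ω : Set Plane}

theorem hasWeakPartial_weakPartial {u : L2 Ω} (hu : u ∈ H1 Ω) (i : Fin 2) :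
    HasWeakPartial Ω i u (weakPartial i u) := by
  rw [weakPartial, dif_pos (hu i)]
  exact (hu i).choose_spec

theorem HasWeakPartial.weakPartial_eq (hΩo : IsOpen Ω) {i : Fin 2} {u g : L2 Ω}
    (h : HasWeakPartial Ω i u g) : weakPartial i u = g := by
  have hex : ∃ g, HasWeakPartial Ω i u g := ⟨g, h⟩
  rw [weakPartial, dif_pos hex]
  exact hex.choose_spec.unique hΩo h

/-- The weak partial derivative as a linear map on `H¹(Ω)`. -/
def weakPartialLin (hΩo : IsOpen Ω) (i : Fin 2) : H1 Ω →ₗ[ℝ] L2 Ω where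
  toFun u := weakPartial i (u : L2 Ω)
  map_add' u v := ((hasWeakPartial_weakPartial u.2 i).add
    (hasWeakPartial_weakPartial v.2 i)).weakPartial_eq hΩo
  map_smul' c u := ((hasWeakPartial_weakPartial u.2 i).smul c).weakPartial_eq hΩo

/-- The rotation as a linear map on `H¹(Ω)²`. -/
def rotLin (hΩo : IsOpen Ω) : VecH1 Ω →ₗ[ℝ] L2 Ω :=
  weakPartialLin hΩo 0 ∘ₗ LinearMap.proj 1 - weakPartialLin hΩo 1 ∘ₗ LinearMap.proj 0

theorem rotLin_apply (hΩo : IsOpen Ω) (θ : VecH1 Ω) : rotLin hΩo θ = rot θ := rfl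

end WeakPartial

/-! ### The finite element spaces -/

section PiecewiseL2

variable {Ω : Set Plane} {T : Finset (Finset Plane)} {P : Finset Plane → MvPolynomial (Fin 2) ℝ}

theorem IsMesh.polynomial_unique (hT : IsMesh T Ω) (hΩ : interior (closure Ω) = Ω)
    {K : Finset Plane} (hK : K ∈ T) {P Q : MvPolynomial (Fin 2) ℝ} {u : Plane → ℝ}
    (hP : ∀ᵐ x ∂(volume.restrict Ω), x ∈ tri K → u x = polyFun P x)
    (hQ : ∀ᵐ x ∂(volume.restrict Ω), x ∈ tri K → u x = polyFun Q x) : P = Q := by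
  refine polynomial_eq_of_eqOn_open isOpen_interior (hT.interior_nonempty hK) ?_
  refine Measure.eqOn_open_of_ae_eq (μ := volume) ?_ isOpen_interior
    (continuous_polyFun P).continuousOn (continuous_polyFun Q).continuousOn
  have hsub := hT.interior_subset hΩ hK
  filter_upwards [ae_restrict_of_ae_restrict_of_subset hsub hP,
    ae_restrict_of_ae_restrict_of_subset hsub hQ,
    ae_restrict_mem isOpen_interior.measurableSet] with x h1 h2 hx
  rw [← h1 (_root_.interior_subset hx), ← h2 (_root_.interior_subset hx)]

theorem IsPiecewiseAE.ext (hT : IsMesh T Ω) (hΩo : IsOpen Ω) {u v : L2 Ω}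
    (hu : IsPiecewiseAE T Ω P u) (hv : IsPiecewiseAE T Ω P v) : u = v := by
  refine Lp.ext ?_
  filter_upwards [(Filter.eventually_all_finset T).2 hu, (Filter.eventually_all_finset T).2 hv,
    ae_restrict_mem hΩo.measurableSet] with x h1 h2 hx
  obtain ⟨K, hK, hxK⟩ := hT.exists_mem (subset_closure hx)
  rw [h1 K hK hxK, h2 K hK hxK]

theorem IsPiecewiseAE.add {Q : Finset Plane → MvPolynomial (Fin 2) ℝ} {u v : L2 Ω}
    (hu : IsPiecewiseAE T Ω P u) (hv : IsPiecewiseAE T Ω Q v) :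
    IsPiecewiseAE T Ω (fun K => P K + Q K) (u + v : L2 Ω) := by
  intro K hK
  filter_upwards [hu K hK, hv K hK, Lp.coeFn_add u v] with x h1 h2 h3 hx
  rw [h3, Pi.add_apply, h1 hx, h2 hx, polyFun_add]

theorem IsPiecewiseAE.smul {u : L2 Ω} (hu : IsPiecewiseAE T Ω P u) (c : ℝ) :
    IsPiecewiseAE T Ω (fun K => c • P K) (c • u : L2 Ω) := by
  intro K hK
  filter_upwards [hu K hK, Lp.coeFn_smul c u] with x h1 h2 hx
  rw [h2, Pi.smul_apply, h1 hx, polyFun_smul, smul_eq_mul]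

theorem isPiecewiseAE_zero : IsPiecewiseAE T Ω 0 (0 : L2 Ω) := by
  intro K _
  filter_upwards [Lp.coeFn_zero ℝ 2 (volume.restrict Ω)] with x h1 _
  rw [h1]
  simp [polyFun]

/-- The functions in `L²(Ω)` that are polynomials of degree at most `k` on each triangle. -/
def piecewiseSpace (T : Finset (Finset Plane)) (Ω : Set Plane) (k : ℕ) : Submodule ℝ (L2 Ω) where
  carrier := {u | ∃ P : Finset Plane → MvPolynomial (Fin 2) ℝ,
    (∀ K ∈ T, P K ∈ MvPolynomial.restrictTotalDegree (Fin 2) ℝ k) ∧ IsPiecewiseAE T Ω P u}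
  add_mem' := by
    rintro u v ⟨P, hP, hu⟩ ⟨Q, hQ, hv⟩
    exact ⟨_, fun K hK => add_mem (hP K hK) (hQ K hK), hu.add hv⟩
  zero_mem' := ⟨0, fun _ _ => zero_mem _, isPiecewiseAE_zero⟩
  smul_mem' := by
    rintro c u ⟨P, hP, hu⟩
    exact ⟨_, fun K hK => Submodule.smul_mem _ c (hP K hK), hu.smul c⟩

theorem finiteDimensional_piecewiseSpace (hT : IsMesh T Ω) (hΩ : interior (closure Ω) = Ω) (k : ℕ) :
    FiniteDimensional ℝ (piecewiseSpace T Ω k) := by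
  have hΩo : IsOpen Ω := hΩ ▸ isOpen_interior
  have hex : ∀ u : piecewiseSpace T Ω k, ∃ P : Finset Plane → MvPolynomial (Fin 2) ℝ,
      (∀ K ∈ T, P K ∈ MvPolynomial.restrictTotalDegree (Fin 2) ℝ k) ∧
        IsPiecewiseAE T Ω P (u : L2 Ω) := fun u => u.2
  choose P hP hu using hex
  -- the polynomials on the triangles are determined by `u`, so that choosing them is linear
  let Φ : piecewiseSpace T Ω k →ₗ[ℝ] (T → MvPolynomial.restrictTotalDegree (Fin 2) ℝ k) :=
    { toFun := fun u K => ⟨P u K, hP u K K.2⟩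
      map_add' := fun u v => funext fun K => Subtype.ext <|
        hT.polynomial_unique hΩ K.2 (hu (u + v) K K.2) ((hu u).add (hu v) K K.2)
      map_smul' := fun c u => funext fun K => Subtype.ext <|
        hT.polynomial_unique hΩ K.2 (hu (c • u) K K.2) ((hu u).smul c K K.2) }
  have hinj : Function.Injective Φ := fun u v huv => by
    refine Subtype.ext (IsPiecewiseAE.ext hT hΩo (hu u) fun K hK => ?_)
    have h1 : P u K = P v K := congrArg Subtype.val (congrFun huv ⟨K, hK⟩)
    rw [h1]
    exact hu v K hK
  exact FiniteDimensional.of_injective Φ hinj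

end PiecewiseL2

section Spaces

variable {n : ℕ} [NeZero n] {Ω : Set Plane} {V : Fin n → Plane} {bc : Fin n → BoundaryType}
  {T : Finset (Finset Plane)} {p k : ℕ}

theorem mem_WTilde_iff (hT : IsMesh T Ω) {v : L2 Ω} : v ∈ WTilde Ω V bc T p ↔
    ∃ (P : Finset Plane → MvPolynomial (Fin 2) ℝ) (f : Plane → ℝ),
      (∀ K ∈ T, P K ∈ MvPolynomial.restrictTotalDegree (Fin 2) ℝ p) ∧ IsPiecewise T P f ∧
        v =ᵐ[volume.restrict Ω] f ∧ ∀ x ∈ gammaCS V bc, f x = 0 := by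
  constructor
  · rintro ⟨f, hvf, -, hP, h0⟩
    choose! P hdeg hP using hP
    exact ⟨P, f, fun K hK => (MvPolynomial.mem_restrictTotalDegree _ _ _).2 (hdeg K hK), hP,
      hvf, h0⟩
  · rintro ⟨P, f, hdeg, hP, hvf, h0⟩
    exact ⟨f, hvf, hP.continuousOn hT, fun K hK =>
      ⟨P K, (MvPolynomial.mem_restrictTotalDegree _ _ _).1 (hdeg K hK), hP K hK⟩, h0⟩

/-- `W̃^p_Γ` as a subspace of `L²(Ω)`. -/
def WTildeSub (V : Fin n → Plane) (bc : Fin n → BoundaryType) (hT : IsMesh T Ω) (p : ℕ) :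
    Submodule ℝ (L2 Ω) where
  carrier := WTilde Ω V bc T p
  add_mem' := by
    intro u v hu hv
    obtain ⟨P, f, hP, hf, huf, hf0⟩ := (mem_WTilde_iff hT).1 hu
    obtain ⟨Q, g, hQ, hg, hvg, hg0⟩ := (mem_WTilde_iff hT).1 hv
    refine (mem_WTilde_iff hT).2 ⟨fun K => P K + Q K, fun x => f x + g x,
      fun K hK => add_mem (hP K hK) (hQ K hK), fun K hK x hx => ?_, ?_, fun x hx => ?_⟩
    · beta_reduce
      rw [polyFun_add, hf K hK x hx, hg K hK x hx]
    · filter_upwards [huf, hvg, Lp.coeFn_add u v] with x h1 h2 h3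
      rw [h3, Pi.add_apply, h1, h2]
    · beta_reduce
      rw [hf0 x hx, hg0 x hx, add_zero]
  zero_mem' := (mem_WTilde_iff hT).2 ⟨0, 0, fun _ _ => zero_mem _,
    fun K _ x _ => by simp [polyFun], Lp.coeFn_zero ℝ 2 _, fun _ _ => rfl⟩
  smul_mem' := by
    intro c u hu
    obtain ⟨P, f, hP, hf, huf, hf0⟩ := (mem_WTilde_iff hT).1 hu
    refine (mem_WTilde_iff hT).2 ⟨fun K => c • P K, fun x => c * f x,
      fun K hK => Submodule.smul_mem _ c (hP K hK), fun K hK x hx => ?_, ?_, fun x hx => ?_⟩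
    · beta_reduce
      rw [polyFun_smul, hf K hK x hx]
    · filter_upwards [huf, Lp.coeFn_smul c u] with x h1 h2
      rw [h2, Pi.smul_apply, h1, smul_eq_mul]
    · beta_reduce
      rw [hf0 x hx, mul_zero]

theorem finiteDimensional_WTildeSub (hΩ : IsPolygonalDomain Ω V) (hT : IsMesh T Ω) :
    FiniteDimensional ℝ (WTildeSub V bc hT p) := by
  have hfin := finiteDimensional_piecewiseSpace hT hΩ.interior_closure p
  refine Submodule.finiteDimensional_of_le (S₂ := piecewiseSpace T Ω p) fun v hv => ?_
  obtain ⟨P, f, hP, hf, hvf, -⟩ := (mem_WTilde_iff hT).1 hv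
  exact ⟨P, hP, hf.isPiecewiseAE hvf⟩

theorem mem_H1_of_mem_WTilde (hΩ : IsPolygonalDomain Ω V) (hT : IsMesh T Ω) {v : L2 Ω}
    (hv : v ∈ WTilde Ω V bc T p) : v ∈ H1 Ω := by
  obtain ⟨P, f, -, hf, hvf, -⟩ := (mem_WTilde_iff hT).1 hv
  exact fun i => hf.exists_hasWeakPartial hT hΩ.isOpen hΩ.isBounded hvf i

/-- A discrete Poincaré property: a function in `W̃^p_Γ` with vanishing gradient is constant on
each triangle, hence takes finitely many values on the connected set `closure Ω`, hence is
constant, and it vanishes on `Γ_cs`. -/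
theorem eq_zero_of_weakPartial_eq_zero (hΩ : IsPolygonalDomain Ω V) (hT : IsMesh T Ω)
    (hcs : (gammaCS V bc).Nonempty) {v : L2 Ω} (hv : v ∈ WTilde Ω V bc T p)
    (h : ∀ i, weakPartial i v = 0) : v = 0 := by
  have hvH := mem_H1_of_mem_WTilde hΩ hT hv
  obtain ⟨P, f, -, hf, hvf, hf0⟩ := (mem_WTilde_iff hT).1 hv
  have hP0 : ∀ K ∈ T, ∀ i, MvPolynomial.pderiv i (P K) = 0 := fun K hK i => by
    have h1 := (hasWeakPartial_weakPartial hvH i).isPiecewiseAE hT hΩ.interior_closure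
      (hf.isPiecewiseAE hvf)
    rw [h i] at h1
    exact hT.polynomial_unique hΩ.interior_closure hK (h1 K hK) (isPiecewiseAE_zero K hK)
  have hconst : ∀ K ∈ T, ∀ x y, polyFun (P K) x = polyFun (P K) y := fun K hK x y => by
    refine is_const_of_fderiv_eq_zero (𝕜 := ℝ) (f := polyFun (P K))
      (fun z => (hasFDerivAt_polyFun (P K) z).differentiableAt) (fun z => ?_) x y
    rw [fderiv_polyFun]
    ext w
    rw [polyDiff, covec_apply]
    simp [hP0 K hK, polyFun]
  have hfin : (f '' closure Ω).Finite := by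
    refine (T.finite_toSet.image fun K => polyFun (P K) 0).subset ?_
    rintro _ ⟨x, hx, rfl⟩
    obtain ⟨K, hK, hxK⟩ := hT.exists_mem hx
    exact ⟨K, hK, by rw [hf K hK x hxK]; exact hconst K hK 0 x⟩
  have hsc := hΩ.simplyConnected
  have hconn : IsPreconnected (closure Ω) :=
    (isPreconnected_iff_preconnectedSpace.2 inferInstance : IsPreconnected Ω).closure
  obtain ⟨x₀, hx₀⟩ := hcs
  refine Lp.ext ?_
  filter_upwards [hvf, Lp.coeFn_zero ℝ 2 (volume.restrict Ω), ae_restrict_mem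
    hΩ.isOpen.measurableSet] with x h1 h2 hx
  rw [h1, h2, Pi.zero_apply, ← hf0 x₀ hx₀]
  exact eq_of_isPreconnected_of_finite_image hconn (hf.continuousOn hT) hfin (subset_closure hx)
    (gammaCS_subset_closure hΩ hx₀)

theorem HasTraceOn.add_L2 {S : Set Plane} {u v : L2 Ω} (hu : HasTraceOn Ω u S 0)
    (hv : HasTraceOn Ω v S 0) : HasTraceOn Ω (u + v : L2 Ω) S 0 := by
  refine (HasTraceOn.linear_comb (Lp.aestronglyMeasurable u) hu hv 1 1).congr ?_
  filter_upwards [Lp.coeFn_add u v] with x hx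
  rw [hx, Pi.add_apply]
  ring

theorem HasTraceOn.smul_L2 {S : Set Plane} {u : L2 Ω} (hu : HasTraceOn Ω u S 0) (c : ℝ) :
    HasTraceOn Ω (c • u : L2 Ω) S 0 := by
  refine (HasTraceOn.linear_comb (Lp.aestronglyMeasurable u) hu hu c 0).congr ?_
  filter_upwards [Lp.coeFn_smul c u] with x hx
  rw [hx, Pi.smul_apply, smul_eq_mul]
  ring

theorem hasTraceOn_zero_L2 {S : Set Plane} : HasTraceOn Ω (0 : L2 Ω) S 0 := by
  have h : HasTraceOn Ω (0 : Plane → ℝ) S 0 := by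
    refine Eventually.of_forall fun x => ?_
    simp only [Pi.zero_apply, sub_zero, enorm_zero, laverage_eq, lintegral_zero, ENNReal.zero_div]
    exact tendsto_const_nhds
  exact h.congr (Lp.coeFn_zero ℝ 2 _)

theorem coeFn_linear_comb (c : Fin 2 → ℝ) (g : Fin 2 → L2 Ω) :
    (∑ j, c j • g j : L2 Ω) =ᵐ[volume.restrict Ω] fun y => ∑ j, c j * g j y := by
  rw [Fin.sum_univ_two]
  filter_upwards [Lp.coeFn_add (c 0 • g 0) (c 1 • g 1), Lp.coeFn_smul (c 0) (g 0),
    Lp.coeFn_smul (c 1) (g 1)] with y h1 h2 h3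
  rw [h1, Pi.add_apply, h2, h3, Fin.sum_univ_two]
  rfl

/-- The trace condition on a linear combination of components, expressed in `L²(Ω)`. -/
theorem hasTraceOn_linear_comb_iff {S : Set Plane} (c : Fin 2 → ℝ) (g : Fin 2 → L2 Ω) :
    HasTraceOn Ω (fun y => ∑ j, c j * g j y) S 0 ↔ HasTraceOn Ω (∑ j, c j • g j : L2 Ω) S 0 :=
  ⟨fun h => h.congr (coeFn_linear_comb c g), fun h => h.congr (coeFn_linear_comb c g).symm⟩

/-- `Θ_Γ(Ω)` as a subspace of `H¹(Ω)²`. -/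
def thetaSub (Ω : Set Plane) (V : Fin n → Plane) (bc : Fin n → BoundaryType) :
    Submodule ℝ (VecH1 Ω) where
  carrier := ThetaGamma Ω V bc
  add_mem' := by
    rintro θ ψ ⟨h1, h2⟩ ⟨h3, h4⟩
    refine ⟨fun j => (h1 j).add_L2 (h3 j), fun i hi => ?_⟩
    have := ((hasTraceOn_linear_comb_iff _ _).1 (h2 i hi)).add_L2
      ((hasTraceOn_linear_comb_iff _ _).1 (h4 i hi))
    refine (hasTraceOn_linear_comb_iff _ fun j => (((θ + ψ) j : H1 Ω) : L2 Ω)).2 ?_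
    rw [← Finset.sum_add_distrib] at this
    simpa only [Pi.add_apply, Submodule.coe_add, smul_add] using this
  zero_mem' := by
    refine ⟨fun j => hasTraceOn_zero_L2, fun i _ => ?_⟩
    refine (hasTraceOn_linear_comb_iff _ fun j => (((0 : VecH1 Ω) j : H1 Ω) : L2 Ω)).2 ?_
    simpa using hasTraceOn_zero_L2
  smul_mem' := by
    rintro c θ ⟨h1, h2⟩
    refine ⟨fun j => (h1 j).smul_L2 c, fun i hi => ?_⟩
    have := ((hasTraceOn_linear_comb_iff _ _).1 (h2 i hi)).smul_L2 c
    refine (hasTraceOn_linear_comb_iff _ fun j => (((c • θ) j : H1 Ω) : L2 Ω)).2 ?_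
    rw [Finset.smul_sum] at this
    simpa only [Pi.smul_apply, Submodule.coe_smul, smul_comm c] using this

/-- `G^k_Γ` as a subspace of `H¹(Ω)²`. -/
def GSub (Ω : Set Plane) (V : Fin n → Plane) (bc : Fin n → BoundaryType)
    (T : Finset (Finset Plane)) (k : ℕ) : Submodule ℝ (VecH1 Ω) :=
  thetaSub Ω V bc ⊓ ⨅ j, (piecewiseSpace T Ω k).comap ((H1 Ω).subtype ∘ₗ LinearMap.proj j)

theorem mem_GSub_iff {θ : VecH1 Ω} : θ ∈ GSub Ω V bc T k ↔
    θ ∈ ThetaGamma Ω V bc ∧ ∀ j, ((θ j : H1 Ω) : L2 Ω) ∈ piecewiseSpace T Ω k := by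
  rw [GSub, Submodule.mem_inf, Submodule.mem_iInf]
  exact Iff.rfl

theorem mem_piecewiseSpace_iff {u : L2 Ω} : u ∈ piecewiseSpace T Ω k ↔
    ∀ K ∈ T, ∃ P : MvPolynomial (Fin 2) ℝ, P.totalDegree ≤ k ∧
      u =ᵐ[(volume.restrict Ω).restrict (tri K)] polyFun P := by
  constructor
  · rintro ⟨P, hdeg, hP⟩ K hK
    exact ⟨P K, (MvPolynomial.mem_restrictTotalDegree _ _ _).1 (hdeg K hK),
      (ae_restrict_iff' (isClosed_tri K).measurableSet).2 (hP K hK)⟩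
  · intro h
    choose! P hdeg hP using h
    exact ⟨P, fun K hK => (MvPolynomial.mem_restrictTotalDegree _ _ _).2 (hdeg K hK),
      fun K hK => (ae_restrict_iff' (isClosed_tri K).measurableSet).1 (hP K hK)⟩

theorem mem_GSub {θ : VecH1 Ω} : θ ∈ GSub Ω V bc T k ↔ θ ∈ GGamma Ω V bc T k := by
  rw [mem_GSub_iff]
  simp only [mem_piecewiseSpace_iff]
  exact and_congr_right fun _ => ⟨fun h K hK j => h j K hK, fun h j K hK => h K hK j⟩

theorem finiteDimensional_GSub (hΩ : IsPolygonalDomain Ω V) (hT : IsMesh T Ω) :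
    FiniteDimensional ℝ (GSub Ω V bc T k) := by
  have hfin := finiteDimensional_piecewiseSpace hT hΩ.interior_closure k
  let Φ : GSub Ω V bc T k →ₗ[ℝ] (Fin 2 → piecewiseSpace T Ω k) :=
    { toFun := fun θ j => ⟨((θ : VecH1 Ω) j : L2 Ω), (mem_GSub_iff.1 θ.2).2 j⟩
      map_add' := fun _ _ => rfl
      map_smul' := fun _ _ => rfl }
  have hinj : Function.Injective Φ := fun θ ψ h => by
    refine Subtype.ext (funext fun j => Subtype.ext ?_)
    have h1 : Φ θ j = Φ ψ j := congrFun h j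
    exact congrArg (fun w : piecewiseSpace T Ω k => (w : L2 Ω)) h1
  exact FiniteDimensional.of_injective Φ hinj

end Spaces

/-! ### Gradients of Morgan-Scott functions -/

theorem pderiv_zero_one_comm (P : MvPolynomial (Fin 2) ℝ) :
    MvPolynomial.pderiv 0 (MvPolynomial.pderiv 1 P) =
      MvPolynomial.pderiv 1 (MvPolynomial.pderiv 0 P) := by
  ext m
  simp only [MvPolynomial.coeff_pderiv]
  rw [add_right_comm]
  simp
  ring

section MorganScottGradient

variable {n : ℕ} [NeZero n] {Ω : Set Plane} {V : Fin n → Plane} {bc : Fin n → BoundaryType}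
  {T : Finset (Finset Plane)} {p : ℕ}

theorem boundaryPart_eq (b : BoundaryType) :
    boundaryPart V bc b = ⋃ i : {i // bc i = b}, edge V i := by
  rw [boundaryPart, Set.iUnion_subtype]

theorem edge_subset_boundaryPart {i : Fin n} {b : BoundaryType} (h : bc i = b) :
    edge V i ⊆ boundaryPart V bc b :=
  Set.subset_biUnion_of_mem (u := fun i => edge V i) h

/-- The data of a function in `W^p_Γ`: a continuous piecewise polynomial representative that
vanishes on `Γ_cs`. -/
theorem exists_isPiecewise_of_mem_WGamma (hΩ : IsPolygonalDomain Ω V) (hT : IsMesh T Ω) {v : H2 Ω}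
    (hv : v ∈ WGamma Ω V bc T p) : ∃ (P : Finset Plane → MvPolynomial (Fin 2) ℝ) (f : Plane → ℝ),
      (∀ K ∈ T, P K ∈ MvPolynomial.restrictTotalDegree (Fin 2) ℝ p) ∧ IsPiecewise T P f ∧
        (v : L2 Ω) =ᵐ[volume.restrict Ω] f ∧
        ∀ i, bc i = .clamped ∨ bc i = .simplySupported →
          ∀ x ∈ segment ℝ (V i) (V (i + 1)), f x = 0 := by
  obtain ⟨⟨f, hvf, -, hP⟩, htr, -⟩ := hv
  choose! P hdeg hP using hP
  have hf : IsPiecewise T P f := hP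
  refine ⟨P, f, fun K hK => (MvPolynomial.mem_restrictTotalDegree _ _ _).2 (hdeg K hK), hf, hvf,
    fun i hi => hf.eq_zero_of_hasTraceOn hΩ hT hvf (htr.mono ?_)⟩
  rcases hi with hi | hi
  · exact (edge_subset_boundaryPart hi).trans Set.subset_union_left
  · exact (edge_subset_boundaryPart hi).trans Set.subset_union_right

theorem mem_WTilde_of_mem_WGamma (hΩ : IsPolygonalDomain Ω V) (hT : IsMesh T Ω) {v : H2 Ω}
    (hv : v ∈ WGamma Ω V bc T p) : (v : L2 Ω) ∈ WTilde Ω V bc T p := by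
  obtain ⟨P, f, hdeg, hf, hvf, h0⟩ := exists_isPiecewise_of_mem_WGamma hΩ hT hv
  refine (mem_WTilde_iff hT).2 ⟨P, f, hdeg, hf, hvf, fun x hx => ?_⟩
  obtain ⟨i, hi, hxi⟩ := Set.mem_iUnion₂.1 (gammaCS_subset hx)
  exact h0 i hi x hxi

theorem tangent_sq_add_sq (hΩ : IsPolygonalDomain Ω V) (i : Fin n) :
    tangent V i 0 ^ 2 + tangent V i 1 ^ 2 = 1 := by
  have h1 : ‖tangent V i‖ = 1 := by
    rw [tangent, norm_smul, norm_inv, norm_norm,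
      inv_mul_cancel₀ (norm_ne_zero_iff.2 (sub_ne_zero.2 (hΩ.vertex_ne i)))]
  have h2 := EuclideanSpace.real_norm_sq_eq (tangent V i)
  rw [h1, Fin.sum_univ_two] at h2
  linarith

theorem grad_isPiecewiseAE (hΩ : IsPolygonalDomain Ω V) (hT : IsMesh T Ω) {v : H2 Ω}
    {P : Finset Plane → MvPolynomial (Fin 2) ℝ} (hP : IsPiecewiseAE T Ω P (v : L2 Ω)) (i : Fin 2) :
    IsPiecewiseAE T Ω (fun K => MvPolynomial.pderiv i (P K)) (grad v i : L2 Ω) :=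
  (hasWeakPartial_weakPartial v.2.1 i).isPiecewiseAE hT hΩ.interior_closure hP

theorem grad_mem_GGamma (hΩ : IsPolygonalDomain Ω V) (hT : IsMesh T Ω) {v : H2 Ω}
    (hv : v ∈ WGamma Ω V bc T p) : grad v ∈ GGamma Ω V bc T (p - 1) := by
  obtain ⟨P, f, hdeg, hf, hvf, h0⟩ := exists_isPiecewise_of_mem_WGamma hΩ hT hv
  have hg := grad_isPiecewiseAE hΩ hT (hf.isPiecewiseAE hvf)
  have htan : ∀ i, bc i = .clamped ∨ bc i = .simplySupported →
      HasTraceOn Ω (fun y => ∑ j, tangent V i j * (grad v j : L2 Ω) y) (edge V i) 0 := fun i hi =>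
    hasTraceOn_tangent_of_eq_zero hΩ hT hf (h0 i hi) hg
  rw [← mem_GSub, mem_GSub_iff]
  refine ⟨⟨fun j => ?_, fun i hi => htan i (Or.inr hi)⟩, fun j => ?_⟩
  · rw [boundaryPart_eq]
    refine hasTraceOn_iUnion fun ⟨i, hi⟩ => ?_
    -- recover the components from the tangential and the normal component
    have h1 := htan i (Or.inl hi)
    have h2 := hv.2.2 i hi
    have hmeas : AEStronglyMeasurable (fun y => ∑ j, tangent V i j * (grad v j : L2 Ω) y)
        (volume.restrict Ω) :=
      (Lp.aestronglyMeasurable _).congr (coeFn_linear_comb (fun j => tangent V i j)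
        fun j => ((grad v j : H1 Ω) : L2 Ω))
    have h3 := HasTraceOn.linear_comb hmeas h1 h2 (tangent V i j) (normal V i j)
    refine h3.congr (Eventually.of_forall fun y => ?_)
    have hsq := tangent_sq_add_sq hΩ i
    simp only [Fin.sum_univ_two, normal]
    fin_cases j
    · simp only [Fin.zero_eta, Matrix.cons_val_zero, Matrix.cons_val_one]
      linear_combination (-((grad v 0 : L2 Ω) y)) * hsq
    · simp only [Fin.mk_one, Matrix.cons_val_zero, Matrix.cons_val_one]
      linear_combination (-((grad v 1 : L2 Ω) y)) * hsq
  · exact ⟨_, fun K hK => (MvPolynomial.mem_restrictTotalDegree _ _ _).2 (totalDegree_pderiv_le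
      ((MvPolynomial.mem_restrictTotalDegree _ _ _).1 (hdeg K hK)) j), hg j⟩

theorem rot_grad_eq_zero (hΩ : IsPolygonalDomain Ω V) (hT : IsMesh T Ω) {v : H2 Ω}
    (hv : v ∈ WGamma Ω V bc T p) : rot (grad v) = 0 := by
  obtain ⟨P, f, -, hf, hvf, -⟩ := exists_isPiecewise_of_mem_WGamma hΩ hT hv
  have hg := grad_isPiecewiseAE hΩ hT (hf.isPiecewiseAE hvf)
  have h1 := (hasWeakPartial_weakPartial (v.2.2 1) 0).isPiecewiseAE hT hΩ.interior_closure (hg 1)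
  have h2 := (hasWeakPartial_weakPartial (v.2.2 0) 1).isPiecewiseAE hT hΩ.interior_closure (hg 0)
  refine sub_eq_zero.2 (h1.ext hT hΩ.isOpen ?_)
  simp only [pderiv_zero_one_comm]
  exact h2

/-- Along an edge that is not free, the continuous representative of a field in `Θ_Γ(Ω)` has
vanishing tangential component. -/
theorem tangential_eq_zero (hΩ : IsPolygonalDomain Ω V) (hT : IsMesh T Ω) {θ : VecH1 Ω}
    (hθ : θ ∈ ThetaGamma Ω V bc) {P : Fin 2 → Finset Plane → MvPolynomial (Fin 2) ℝ}
    {f : Fin 2 → Plane → ℝ} (hf : ∀ j, IsPiecewise T (P j) (f j))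
    (hθf : ∀ j, (θ j : L2 Ω) =ᵐ[volume.restrict Ω] f j) {i : Fin n}
    (hi : bc i = .clamped ∨ bc i = .simplySupported) :
    ∀ x ∈ segment ℝ (V i) (V (i + 1)), covec (fun j => f j x) (V (i + 1) - V i) = 0 := by
  have htr : HasTraceOn Ω (fun y => ∑ j, tangent V i j * (θ j : L2 Ω) y) (edge V i) 0 := by
    rcases hi with hi | hi
    · have h1 := (HasTraceOn.linear_comb (Lp.aestronglyMeasurable _) (hθ.1 0) (hθ.1 1)
        (tangent V i 0) (tangent V i 1)).mono (edge_subset_boundaryPart hi)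
      simpa only [Fin.sum_univ_two] using h1
    · exact hθ.2 i hi
  have hpw : IsPiecewise T (fun K => tangent V i 0 • P 0 K + tangent V i 1 • P 1 K)
      (fun x => ∑ j, tangent V i j * f j x) := fun K hK x hx => by
    beta_reduce
    rw [polyFun_add, polyFun_smul, polyFun_smul, Fin.sum_univ_two, hf 0 K hK x hx, hf 1 K hK x hx]
  have h0 := hpw.eq_zero_of_hasTraceOn hΩ hT (u := fun y => ∑ j, tangent V i j * (θ j : L2 Ω) y)
    (by
      filter_upwards [hθf 0, hθf 1] with x h1 h2
      rw [Fin.sum_univ_two, Fin.sum_univ_two, h1, h2]) htr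
  intro x hx
  have h1 := h0 x hx
  rw [sum_tangent_mul] at h1
  exact (mul_eq_zero.1 h1).resolve_left
    (inv_ne_zero (norm_ne_zero_iff.2 (sub_ne_zero.2 (hΩ.vertex_ne i))))

/-- A rotation-free field in `G^k_Γ` has, up to constants on the triangles, polynomial potentials
that fit together to a continuously differentiable function on `Ω` with a continuous extension to
`closure Ω`. -/
theorem exists_C1_potential (hΩ : IsPolygonalDomain Ω V) (hT : IsMesh T Ω) {k : ℕ} {θ : VecH1 Ω}
    (hθ : ∀ j, (θ j : L2 Ω) ∈ piecewiseSpace T Ω k) (hrot : rot θ = 0) :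
    ∃ (Q : Finset Plane → MvPolynomial (Fin 2) ℝ) (f : Plane → ℝ) (g : Fin 2 → Plane → ℝ),
      (∀ K ∈ T, (Q K).totalDegree ≤ k + 1) ∧ IsPiecewise T Q f ∧
      (∀ j, IsPiecewise T (fun K => MvPolynomial.pderiv j (Q K)) (g j)) ∧
      (∀ j, (θ j : L2 Ω) =ᵐ[volume.restrict Ω] g j) ∧
      ∀ x ∈ Ω, HasFDerivAt f (covec fun j => g j x) x := by
  choose P hdeg hP using hθ
  have hclosed : ∀ K ∈ T, MvPolynomial.pderiv 0 (P 1 K) = MvPolynomial.pderiv 1 (P 0 K) := by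
    intro K hK
    have h1 := (hasWeakPartial_weakPartial (θ 1).2 0).isPiecewiseAE hT hΩ.interior_closure (hP 1)
    have h2 := (hasWeakPartial_weakPartial (θ 0).2 1).isPiecewiseAE hT hΩ.interior_closure (hP 0)
    rw [← sub_eq_zero.1 hrot] at h2
    exact hT.polynomial_unique hΩ.interior_closure hK (h1 K hK) (h2 K hK)
  have hpot : ∀ K ∈ T, ∃ Q : MvPolynomial (Fin 2) ℝ, Q.totalDegree ≤ k + 1 ∧
      ∀ i, MvPolynomial.pderiv i Q = P i K := fun K hK =>
    exists_polynomial_potential (P := fun i => P i K)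
      (fun i => (MvPolynomial.mem_restrictTotalDegree _ _ _).1 (hdeg i K hK)) (hclosed K hK)
  choose! Q hQdeg hQ using hpot
  choose g hg hθg using fun j => exists_isPiecewise_of_mem_H1 hΩ hT (θ j).2 (hP j)
  have hQg : ∀ K ∈ T, ∀ x ∈ tri K, polyDiff (Q K) x = covec fun j => g j x := by
    intro K hK x hx
    rw [polyDiff]
    congr 1
    ext j
    rw [hQ K hK j, hg j K hK x hx]
  obtain ⟨F, hF⟩ := exists_potential hΩ.isOpen hΩ.simplyConnected hT (Q := Q)
    fun K hK K' hK' x _ hxK hxK' => by rw [hQg K hK x hxK, hQg K' hK' x hxK']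
  -- on each triangle `F` differs from the polynomial potential by a constant
  have hc : ∀ K ∈ T, ∃ c : ℝ, ∀ x ∈ Ω, x ∈ tri K → F x = polyFun (Q K) x + c := by
    intro K hK
    have hsub := hT.interior_subset hΩ.interior_closure hK
    have hder : ∀ x ∈ interior (tri K), HasFDerivAt (fun x => F x - polyFun (Q K) x)
        (0 : Plane →L[ℝ] ℝ) x := fun x hx => by
      have := (hF x (hsub hx) K hK (interior_subset hx)).sub (hasFDerivAt_polyFun (Q K) x)
      rwa [sub_self] at this
    obtain ⟨c, hc⟩ := isOpen_interior.exists_is_const_of_fderiv_eq_zero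
      (convex_tri K).interior.isPreconnected
      (fun x hx => (hder x hx).differentiableAt.differentiableWithinAt)
      (fun x hx => (hder x hx).fderiv)
    refine ⟨c, fun x hx hxK => ?_⟩
    have hcont : ContinuousAt (fun x => F x - polyFun (Q K) x) x :=
      (hF x hx K hK hxK).continuousAt.sub (continuous_polyFun _).continuousAt
    have hxc : x ∈ closure (interior (tri K)) := by rwa [hT.closure_interior hK]
    have hne : (𝓝[interior (tri K)] x).NeBot := mem_closure_iff_nhdsWithin_neBot.1 hxc
    have h1 := tendsto_nhds_unique (hcont.tendsto.mono_left nhdsWithin_le_nhds)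
      ((tendsto_const_nhds (x := c)).congr' (by
        filter_upwards [self_mem_nhdsWithin (a := x) (s := interior (tri K))] with y hy
        exact (hc y hy).symm))
    linarith
  choose! c hc using hc
  have hQ' : ∀ K ∈ T, ∀ x ∈ Ω, x ∈ tri K → F x = polyFun (Q K + MvPolynomial.C (c K)) x :=
    fun K hK x hx hxK => by rw [polyFun_add, polyFun_C, hc K hK x hx hxK]
  obtain ⟨f, hf⟩ := exists_isPiecewise_of_agree hΩ hT
    (P := fun K => Q K + MvPolynomial.C (c K)) fun K hK K' hK' x hx hxK hxK' => by
      rw [← hQ' K hK x hx hxK, ← hQ' K' hK' x hx hxK']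
  have hpd : ∀ K j, MvPolynomial.pderiv j (Q K + MvPolynomial.C (c K)) =
      MvPolynomial.pderiv j (Q K) := fun K j => by
    rw [map_add, MvPolynomial.pderiv_C, add_zero]
  refine ⟨_, f, g, fun K hK => ?_, hf, fun j K hK x hx => ?_, hθg, fun x hx => ?_⟩
  · refine (MvPolynomial.totalDegree_add _ _).trans (max_le (hQdeg K hK) ?_)
    rw [MvPolynomial.totalDegree_C]
    exact Nat.zero_le _
  · beta_reduce
    rw [hpd, hQ K hK j, hg j K hK x hx]
  · refine hf.hasFDerivAt hT (mem_of_superset (hΩ.isOpen.mem_nhds hx) subset_closure)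
      fun K hK hxK => ?_
    rw [← hQg K hK x hxK]
    simp only [polyDiff, hpd]

/-- Every rotation-free field in `G^{p-1}_Γ` is the gradient of a function in `W^p_Γ`. Its potential
is constant on each edge of `Γ_cs`, hence on `Γ_cs`, which is connected. -/
theorem exists_grad_eq (hΩ : IsPolygonalDomain Ω V) (hT : IsMesh T Ω)
    (hconn : IsConnected (gammaCS V bc)) (hp : 1 ≤ p) {θ : VecH1 Ω}
    (hθ : θ ∈ GGamma Ω V bc T (p - 1)) (hrot : rot θ = 0) :
    ∃ v ∈ WGamma Ω V bc T p, grad v = θ := by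
  rw [← mem_GSub, mem_GSub_iff] at hθ
  obtain ⟨Q, f, g, hQdeg, hf, hg, hθg, hder⟩ := exists_C1_potential hΩ hT hθ.2 hrot
  rw [Nat.sub_add_cancel hp] at hQdeg
  have hedge : ∀ i, bc i = .clamped ∨ bc i = .simplySupported →
      ∀ x ∈ segment ℝ (V i) (V (i + 1)), f x = f (V i) := fun i hi =>
    hf.eq_on_segment hΩ hT fun x hx K hK hxK => by
      have h1 := tangential_eq_zero hΩ hT hθ.1 hg hθg hi x hx
      rw [polyDiff]
      simpa only [hg _ K hK x hxK] using h1
  obtain ⟨x₀, hx₀⟩ := hconn.nonempty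
  have hconst : ∀ x ∈ gammaCS V bc, f x = f x₀ := by
    have hfin : (f '' gammaCS V bc).Finite := by
      refine (Set.finite_range fun i => f (V i)).subset ?_
      rintro _ ⟨x, hx, rfl⟩
      obtain ⟨i, hi, hxi⟩ := Set.mem_iUnion₂.1 (gammaCS_subset hx)
      exact ⟨i, (hedge i hi x hxi).symm⟩
    exact fun x hx => eq_of_isPreconnected_of_finite_image hconn.isPreconnected
      ((hf.continuousOn hT).mono (gammaCS_subset_closure hΩ)) hfin hx hx₀
  -- normalize the potential to vanish on `Γ_cs`
  set F : Plane → ℝ := fun x => f x - f x₀ with hF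
  set R : Finset Plane → MvPolynomial (Fin 2) ℝ := fun K => Q K - MvPolynomial.C (f x₀) with hR
  have hFR : IsPiecewise T R F := fun K hK x hx => by
    rw [hR, hF]
    beta_reduce
    rw [polyFun_sub, polyFun_C, hf K hK x hx]
  have hRpd : ∀ K j, MvPolynomial.pderiv j (R K) = MvPolynomial.pderiv j (Q K) := fun K j => by
    rw [hR]
    beta_reduce
    rw [map_sub, MvPolynomial.pderiv_C, sub_zero]
  have hRdeg : ∀ K ∈ T, (R K).totalDegree ≤ p := fun K hK =>
    (MvPolynomial.totalDegree_sub _ _).trans (max_le (hQdeg K hK) (by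
      rw [MvPolynomial.totalDegree_C]
      exact Nat.zero_le _))
  have hFder : ∀ x ∈ Ω, HasFDerivAt F (covec fun j => g j x) x := fun x hx =>
    (hder x hx).sub_const (f x₀)
  have hmem : MemLp F 2 (volume.restrict Ω) := by
    have hfin : IsFiniteMeasure (volume.restrict Ω : Measure Plane) :=
      ⟨by rw [Measure.restrict_apply_univ]; exact hΩ.isBounded.measure_lt_top⟩
    obtain ⟨C, hC0, hC⟩ := exists_abs_le_on_tri T (G := fun K => polyFun (R K))
      fun K _ => continuous_polyFun _
    refine MemLp.of_bound (((hFR.continuousOn hT).mono subset_closure).aestronglyMeasurable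
      hΩ.isOpen.measurableSet) C ?_
    filter_upwards [ae_restrict_mem hΩ.isOpen.measurableSet] with x hx
    obtain ⟨K, hK, hxK⟩ := hT.exists_mem (subset_closure hx)
    rw [hFR K hK x hxK]
    exact hC K hK x hxK
  set v : L2 Ω := hmem.toLp F with hv
  have hvF : v =ᵐ[volume.restrict Ω] F := hmem.coeFn_toLp
  have hweak : ∀ i, HasWeakPartial Ω i v (θ i) := fun i => by
    obtain ⟨w, hw⟩ := hFR.exists_hasWeakPartial hT hΩ.isOpen hΩ.isBounded hvF i
    have h1 := hw.isPiecewiseAE hT hΩ.interior_closure (hFR.isPiecewiseAE hvF)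
    simp only [hRpd] at h1
    rwa [h1.ext hT hΩ.isOpen ((hg i).isPiecewiseAE (hθg i))] at hw
  have hwp : ∀ i, weakPartial i v = (θ i : L2 Ω) := fun i => (hweak i).weakPartial_eq hΩ.isOpen
  have hvH2 : v ∈ H2 Ω := ⟨fun i => ⟨_, hweak i⟩, fun i => by
    rw [hwp i]
    exact (θ i).2⟩
  have hgrad : grad (⟨v, hvH2⟩ : H2 Ω) = θ := funext fun i => Subtype.ext (hwp i)
  have htrace : ∀ i, bc i = .clamped ∨ bc i = .simplySupported → HasTraceOn Ω v (edge V i) 0 :=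
    fun i hi => (hasTraceOn_of_eq_zero hT hFR hvF (hΩ.segment_subset i) fun x hx => by
      rw [hF]
      beta_reduce
      rw [hconst x (segment_subset_gammaCS hi hx), sub_self]).mono
        (openSegment_subset_segment ℝ _ _)
  refine ⟨⟨v, hvH2⟩, ⟨⟨F, hvF, ?_, fun K hK => ⟨R K, hRdeg K hK, hFR K hK⟩⟩, ?_, fun i hi => ?_⟩,
    hgrad⟩
  · rw [← zero_add (1 : WithTop ℕ∞), contDiffOn_succ_iff_fderiv_of_isOpen hΩ.isOpen]
    refine ⟨fun x hx => (hFder x hx).differentiableAt.differentiableWithinAt, by simp,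
      contDiffOn_zero.2 ?_⟩
    have hcont : ContinuousOn (fun x => covec fun j => g j x) Ω :=
      continuous_covec.comp_continuousOn (continuousOn_pi.2 fun j =>
        ((hg j).continuousOn hT).mono subset_closure)
    exact hcont.congr fun x hx => (hFder x hx).fderiv
  · refine hasTraceOn_union ?_ ?_
    · rw [boundaryPart_eq]
      exact hasTraceOn_iUnion fun i => htrace i (Or.inl i.2)
    · rw [boundaryPart_eq]
      exact hasTraceOn_iUnion fun i => htrace i (Or.inr i.2)
  · rw [hgrad]
    have h1 := (HasTraceOn.linear_comb (Lp.aestronglyMeasurable _) (hθ.1.1 0) (hθ.1.1 1)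
        (normal V i 0) (normal V i 1)).mono (edge_subset_boundaryPart hi)
    simpa only [Fin.sum_univ_two] using h1

end MorganScottGradient

/-! ### Solvability of the discrete problems -/

/-- The form need not be symmetric: definiteness makes `B` injective as a map to the dual space, and
the dimensions agree. -/
theorem exists_of_definite {E : Type*} [AddCommGroup E] [Module ℝ E] [FiniteDimensional ℝ E]
    (B : LinearMap.BilinForm ℝ E) (hB : ∀ x, B x x = 0 → x = 0) (l : E →ₗ[ℝ] ℝ) :
    ∃ x, ∀ y, B x y = l y := by
  have hinj : Function.Injective (B : E →ₗ[ℝ] Module.Dual ℝ E) :=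
    (injective_iff_map_eq_zero B).2 fun x hx => hB x (by rw [hx]; rfl)
  obtain ⟨x, hx⟩ := (LinearMap.injective_iff_surjective_of_finrank_eq_finrank
    (Subspace.dual_finrank_eq (K := ℝ) (V := E)).symm).1 hinj l
  exact ⟨x, fun y => by rw [hx]⟩

/-- A functional that vanishes on the kernel of `R` is represented by an element of the range
of `R`. -/
theorem exists_multiplier {E H : Type*} [AddCommGroup E] [Module ℝ E] [FiniteDimensional ℝ E]
    [NormedAddCommGroup H] [InnerProductSpace ℝ H] (R : E →ₗ[ℝ] H) (l : E →ₗ[ℝ] ℝ)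
    (hl : ∀ x, R x = 0 → l x = 0) : ∃ x, ∀ y, inner ℝ (R y) (R x) = l y := by
  obtain ⟨s, hs⟩ := R.rangeRestrict.exists_rightInverse_of_surjective R.range_rangeRestrict
  obtain ⟨⟨_, x, rfl⟩, hx⟩ := exists_of_definite
    ((innerₗ H).compl₁₂ R.range.subtype R.range.subtype)
    (fun x hx => Subtype.ext (inner_self_eq_zero.1 hx)) (l ∘ₗ s)
  refine ⟨x, fun y => ?_⟩
  have h1 : inner ℝ (R x) (R y) = l (s (R.rangeRestrict y)) := hx (R.rangeRestrict y)
  rw [real_inner_comm, h1]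
  have h2 : R (s (R.rangeRestrict y)) = R y := congrArg Subtype.val (LinearMap.congr_fun hs
    (R.rangeRestrict y))
  have h3 := hl (s (R.rangeRestrict y) - y) (by rw [map_sub, h2, sub_self])
  rw [map_sub] at h3
  linarith

section Schemes

variable {n : ℕ} [NeZero n] {Ω : Set Plane} {V : Fin n → Plane} {bc : Fin n → BoundaryType}
  {T : Finset (Finset Plane)} {p : ℕ}

/-- The gradient components as linear maps on `W̃^p_Γ`, which is contained in `H¹(Ω)`. -/
def wtildePartial (hΩ : IsPolygonalDomain Ω V) (bc : Fin n → BoundaryType) (hT : IsMesh T Ω) (p : ℕ)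
    (i : Fin 2) : WTildeSub V bc hT p →ₗ[ℝ] L2 Ω :=
  weakPartialLin hΩ.isOpen i ∘ₗ
    Submodule.inclusion (fun _ hv => mem_H1_of_mem_WTilde hΩ hT hv)

/-- The form `(grad u, grad v)` on `W̃^p_Γ`. -/
def gradForm (hΩ : IsPolygonalDomain Ω V) (bc : Fin n → BoundaryType) (hT : IsMesh T Ω) (p : ℕ) :
    LinearMap.BilinForm ℝ (WTildeSub V bc hT p) :=
  ∑ i, (innerₗ (L2 Ω)).compl₁₂ (wtildePartial hΩ bc hT p i) (wtildePartial hΩ bc hT p i)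

theorem gradForm_apply (hΩ : IsPolygonalDomain Ω V) (hT : IsMesh T Ω)
    (u v : WTildeSub V bc hT p) : gradForm hΩ bc hT p u v = gradInner (u : L2 Ω) v := by
  rw [gradForm, LinearMap.sum_apply, LinearMap.sum_apply]
  rfl

theorem gradForm_definite (hΩ : IsPolygonalDomain Ω V) (hT : IsMesh T Ω)
    (hcs : (gammaCS V bc).Nonempty) (u : WTildeSub V bc hT p) (hu : gradForm hΩ bc hT p u u = 0) :
    u = 0 := by
  rw [gradForm_apply, gradInner, Finset.sum_eq_zero_iff_of_nonneg
    fun _ _ => real_inner_self_nonneg] at hu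
  exact Subtype.ext (eq_zero_of_weakPartial_eq_zero hΩ hT hcs u.2 fun i =>
    inner_self_eq_zero.1 (hu i (Finset.mem_univ i)))

/-- A function in `W̃^p_Γ` is determined by its products with gradients of `W̃^p_Γ`. -/
theorem eq_of_gradInner_eq (hΩ : IsPolygonalDomain Ω V) (hT : IsMesh T Ω)
    (hcs : (gammaCS V bc).Nonempty) {u w : L2 Ω} (hu : u ∈ WTilde Ω V bc T p)
    (hw : w ∈ WTilde Ω V bc T p)
    (h : ∀ v ∈ WTilde Ω V bc T p, gradInner u v = gradInner w v) : u = w := by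
  set u' : WTildeSub V bc hT p := ⟨u, hu⟩
  set w' : WTildeSub V bc hT p := ⟨w, hw⟩
  have h1 : gradForm hΩ bc hT p (u' - w') (u' - w') = 0 := by
    rw [LinearMap.BilinForm.sub_left, gradForm_apply, gradForm_apply, sub_eq_zero]
    exact h _ (u' - w').2
  exact congrArg Subtype.val (sub_eq_zero.1 (gradForm_definite hΩ hT hcs _ h1))

/-- The functional `ψ ↦ (ψ, grad z)` on `H¹(Ω)²`. -/
def vecInnerGradLin (z : L2 Ω) : VecH1 Ω →ₗ[ℝ] ℝ :=
  ∑ i, (innerₗ (L2 Ω)).flip (weakPartial i z) ∘ₗ (H1 Ω).subtype ∘ₗ LinearMap.proj i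

theorem vecInnerGradLin_apply (z : L2 Ω) (ψ : VecH1 Ω) :
    vecInnerGradLin z ψ = vecInnerGrad ψ z := by
  rw [vecInnerGradLin, LinearMap.sum_apply]
  rfl

theorem vecInnerGrad_grad (v : H2 Ω) (z : L2 Ω) : vecInnerGrad (grad v) z = gradInner z v := by
  rw [vecInnerGrad, gradInner]
  exact Finset.sum_congr rfl fun i _ => real_inner_comm _ _

theorem grad_eq_zero_of_normH2_eq_zero {v : H2 Ω} (h : normH2 v = 0) : grad v = 0 := by
  have key : ∀ A B C : ℝ, 0 ≤ A → 0 ≤ B → 0 ≤ C → √(A + B + C) = 0 → B = 0 := by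
    intro A B C hA hB hC h
    rw [Real.sqrt_eq_zero (add_nonneg (add_nonneg hA hB) hC)] at h
    linarith
  have h1 := key _ _ _ (sq_nonneg _) (Finset.sum_nonneg fun _ _ => sq_nonneg _)
    (Finset.sum_nonneg fun _ _ => Finset.sum_nonneg fun _ _ => sq_nonneg _) h
  rw [Finset.sum_eq_zero_iff_of_nonneg fun _ _ => sq_nonneg _] at h1
  exact funext fun i => Subtype.ext
    (norm_eq_zero.1 (pow_eq_zero_iff two_ne_zero |>.1 (h1 i (Finset.mem_univ i))))

/-- The rotation-free fields in `G^{p-1}_Γ`. -/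
def rotFree (hΩ : IsPolygonalDomain Ω V) (bc : Fin n → BoundaryType) (T : Finset (Finset Plane))
    (k : ℕ) : Submodule ℝ (VecH1 Ω) :=
  GSub Ω V bc T k ⊓ (rotLin hΩ.isOpen).ker

theorem mem_rotFree (hΩ : IsPolygonalDomain Ω V) {k : ℕ} {θ : VecH1 Ω} :
    θ ∈ rotFree hΩ bc T k ↔ θ ∈ GGamma Ω V bc T k ∧ rot θ = 0 := by
  rw [rotFree, Submodule.mem_inf, mem_GSub]
  exact Iff.rfl

theorem grad_mem_rotFree (hΩ : IsPolygonalDomain Ω V) (hT : IsMesh T Ω) {v : H2 Ω}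
    (hv : v ∈ WGamma Ω V bc T p) : grad v ∈ rotFree hΩ bc T (p - 1) :=
  (mem_rotFree hΩ).2 ⟨grad_mem_GGamma hΩ hT hv, rot_grad_eq_zero hΩ hT hv⟩

section Main

variable {a : LinearMap.BilinForm ℝ (VecH1 Ω)} {α : ℝ}

/-- Coercivity on gradients of `H²_Γ(Ω)` suffices, since rotation-free fields in `G^{p-1}_Γ` are
gradients of functions in `W^p_Γ`. -/
theorem definite_on_rotFree (hΩ : IsPolygonalDomain Ω V) (hT : IsMesh T Ω)
    (hconn : IsConnected (gammaCS V bc)) (hp : 1 ≤ p) (hα : 0 < α)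
    (hcoer : ∀ u ∈ H2Gamma Ω V bc, α * normH2 u ^ 2 ≤ a (grad u) (grad u)) {θ : VecH1 Ω}
    (hθ : θ ∈ rotFree hΩ bc T (p - 1)) (h : a θ θ = 0) : θ = 0 := by
  obtain ⟨hθG, hrot⟩ := (mem_rotFree hΩ).1 hθ
  obtain ⟨v, hv, rfl⟩ := exists_grad_eq hΩ hT hconn hp hθG hrot
  have h1 := hcoer v hv.2
  rw [h] at h1
  refine grad_eq_zero_of_normH2_eq_zero (pow_eq_zero_iff two_ne_zero |>.1 ?_)
  nlinarith [sq_nonneg (normH2 v)]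

variable {D : Submodule ℝ (L2 Ω)} {F : D →ₗ[ℝ] ℝ}
  {hD : ∀ v ∈ H2Gamma Ω V bc, (v : L2 Ω) ∈ D} {hD' : ∀ v ∈ WTilde Ω V bc T p, v ∈ D}

theorem galerkin_unique (hΩ : IsPolygonalDomain Ω V) (hT : IsMesh T Ω)
    (hconn : IsConnected (gammaCS V bc)) (hp : 1 ≤ p) (hα : 0 < α)
    (hcoer : ∀ u ∈ H2Gamma Ω V bc, α * normH2 u ^ 2 ≤ a (grad u) (grad u)) {w w' : H2 Ω}
    (hw : IsGalerkinSolution Ω V bc T p a D F hD w)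
    (hw' : IsGalerkinSolution Ω V bc T p a D F hD w') : w = w' := by
  have hmem := sub_mem (grad_mem_rotFree hΩ hT hw.1) (grad_mem_rotFree hΩ hT hw'.1)
  have hgrad : grad w - grad w' = 0 := by
    refine definite_on_rotFree hΩ hT hconn hp hα hcoer hmem ?_
    obtain ⟨hG, hrot⟩ := (mem_rotFree hΩ).1 hmem
    obtain ⟨v, hv, hv'⟩ := exists_grad_eq hΩ hT hconn hp hG hrot
    rw [LinearMap.BilinForm.sub_left, ← hv', hw.2 v hv, hw'.2 v hv, sub_self]
  have hwp : ∀ i, weakPartial i (w : L2 Ω) = weakPartial i (w' : L2 Ω) := fun i =>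
    congrArg (fun θ : VecH1 Ω => (θ i : L2 Ω)) (sub_eq_zero.1 hgrad)
  refine Subtype.ext (eq_of_gradInner_eq hΩ hT hconn.nonempty (mem_WTilde_of_mem_WGamma hΩ hT hw.1)
    (mem_WTilde_of_mem_WGamma hΩ hT hw'.1) fun v _ => ?_)
  simp only [gradInner, hwp]

/-- A solution of the three-step scheme comes from a solution of the Galerkin problem. -/
theorem IsSchemeSolution.exists_galerkin (hΩ : IsPolygonalDomain Ω V) (hT : IsMesh T Ω)
    (hconn : IsConnected (gammaCS V bc)) (hp : 1 ≤ p) {z : L2 Ω} {θ : VecH1 Ω} {r w : L2 Ω}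
    (h : IsSchemeSolution Ω V bc T p a D F hD' z θ r w) :
    ∃ u : H2 Ω, IsGalerkinSolution Ω V bc T p a D F hD u ∧ grad u = θ ∧ w = (u : L2 Ω) := by
  have hrot : rot θ = 0 := inner_self_eq_zero.1 (h.rot_free (rot θ) ⟨θ, h.θ_mem, rfl⟩)
  obtain ⟨u, hu, rfl⟩ := exists_grad_eq hΩ hT hconn hp h.θ_mem hrot
  refine ⟨u, ⟨hu, fun v hv => ?_⟩, rfl, ?_⟩
  · have hvW := mem_WTilde_of_mem_WGamma hΩ hT hv
    have h1 := h.stokes (grad v) (grad_mem_GGamma hΩ hT hv)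
    rw [rot_grad_eq_zero hΩ hT hv, inner_zero_left, add_zero, vecInnerGrad_grad,
      h.poisson v hvW] at h1
    exact h1
  · exact eq_of_gradInner_eq hΩ hT hconn.nonempty h.w_mem (mem_WTilde_of_mem_WGamma hΩ hT hu)
      fun v hv => h.projection v hv

/-- The field `θ` solves the second step on the rotation-free fields; the residual then vanishes on
the kernel of `rot` and is represented by the multiplier. The function whose gradient is `θ` solves
the third step. -/
theorem exists_schemeSolution (hΩ : IsPolygonalDomain Ω V) (hT : IsMesh T Ω)
    (hconn : IsConnected (gammaCS V bc)) (hp : 1 ≤ p) (hα : 0 < α)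
    (hcoer : ∀ u ∈ H2Gamma Ω V bc, α * normH2 u ^ 2 ≤ a (grad u) (grad u)) :
    ∃ (z : L2 Ω) (θ : VecH1 Ω) (r w : L2 Ω), IsSchemeSolution Ω V bc T p a D F hD' z θ r w := by
  have hWfin : FiniteDimensional ℝ (WTildeSub V bc hT p) := finiteDimensional_WTildeSub hΩ hT
  have hGfin : FiniteDimensional ℝ (GSub Ω V bc T (p - 1)) := finiteDimensional_GSub hΩ hT
  have hZfin : FiniteDimensional ℝ (rotFree hΩ bc T (p - 1)) :=
    Submodule.finiteDimensional_of_le (S₂ := GSub Ω V bc T (p - 1)) inf_le_left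
  obtain ⟨z, hz⟩ := exists_of_definite (gradForm hΩ bc hT p)
    (gradForm_definite hΩ hT hconn.nonempty)
    (F ∘ₗ Submodule.inclusion (p := WTildeSub V bc hT p) hD')
  obtain ⟨θ, hθ⟩ := exists_of_definite (a.restrict (rotFree hΩ bc T (p - 1)))
    (fun θ hθ => Subtype.ext (definite_on_rotFree hΩ hT hconn hp hα hcoer θ.2 hθ))
    (vecInnerGradLin (z : L2 Ω) ∘ₗ (rotFree hΩ bc T (p - 1)).subtype)
  obtain ⟨hθG, hθrot⟩ := (mem_rotFree hΩ).1 θ.2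
  obtain ⟨⟨ψ₀, hψ₀⟩, hr⟩ := exists_multiplier (rotLin hΩ.isOpen ∘ₗ (GSub Ω V bc T (p - 1)).subtype)
    ((vecInnerGradLin (z : L2 Ω) - a θ) ∘ₗ (GSub Ω V bc T (p - 1)).subtype) fun ψ hψ => by
      have h1 : a θ ψ = vecInnerGradLin (z : L2 Ω) ψ := hθ ⟨ψ, ψ.2, hψ⟩
      exact sub_eq_zero.2 h1.symm
  obtain ⟨u, hu, hgu⟩ := exists_grad_eq hΩ hT hconn hp hθG hθrot
  refine ⟨z, θ, rot ψ₀, u, z.2, hθG, ⟨ψ₀, mem_GSub.1 hψ₀, rfl⟩, mem_WTilde_of_mem_WGamma hΩ hT hu,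
    fun v hv => ?_, fun ψ hψ => ?_, fun s _ => ?_, fun v _ => ?_⟩
  · have h1 := hz ⟨v, hv⟩
    rw [gradForm_apply] at h1
    exact h1
  · have h1 : inner ℝ (rot ψ) (rot ψ₀) = vecInnerGradLin (z : L2 Ω) ψ - a θ ψ :=
      hr ⟨ψ, mem_GSub.2 hψ⟩
    rw [h1, vecInnerGradLin_apply]
    ring
  · rw [hθrot, inner_zero_left]
  · rw [← hgu]
    rfl

theorem schemeSolution_unique (hΩ : IsPolygonalDomain Ω V) (hT : IsMesh T Ω)
    (hconn : IsConnected (gammaCS V bc)) (hp : 1 ≤ p) (hα : 0 < α)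
    (hcoer : ∀ u ∈ H2Gamma Ω V bc, α * normH2 u ^ 2 ≤ a (grad u) (grad u))
    (hD : ∀ v ∈ H2Gamma Ω V bc, (v : L2 Ω) ∈ D)
    {z z' : L2 Ω} {θ θ' : VecH1 Ω} {r r' w w' : L2 Ω}
    (h : IsSchemeSolution Ω V bc T p a D F hD' z θ r w)
    (h' : IsSchemeSolution Ω V bc T p a D F hD' z' θ' r' w') :
    z = z' ∧ θ = θ' ∧ r = r' ∧ w = w' := by
  obtain ⟨u, hu, rfl, rfl⟩ := h.exists_galerkin (hD := hD) hΩ hT hconn hp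
  obtain ⟨u', hu', rfl, rfl⟩ := h'.exists_galerkin (hD := hD) hΩ hT hconn hp
  obtain rfl := galerkin_unique hΩ hT hconn hp hα hcoer hu hu'
  obtain rfl := eq_of_gradInner_eq hΩ hT hconn.nonempty h.z_mem h'.z_mem fun v hv => by
    rw [h.poisson v hv, h'.poisson v hv]
  refine ⟨rfl, rfl, ?_, rfl⟩
  -- the difference of the multipliers lies in `rot G` and is orthogonal to it
  obtain ⟨ψ, hψ, hr⟩ := h.r_mem
  obtain ⟨ψ', hψ', hr'⟩ := h'.r_mem
  have hG : ψ - ψ' ∈ GGamma Ω V bc T (p - 1) :=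
    mem_GSub.1 (sub_mem (mem_GSub.2 hψ) (mem_GSub.2 hψ'))
  have hsub : rot (ψ - ψ') = r - r' := by
    rw [← rotLin_apply hΩ.isOpen, map_sub, rotLin_apply, rotLin_apply, hr, hr']
  have h1 := h.stokes _ hG
  have h2 := h'.stokes _ hG
  rw [hsub] at h1 h2
  have h3 : inner ℝ (r - r') (r - r') = 0 := by
    rw [inner_sub_right]
    linarith
  exact sub_eq_zero.1 (inner_self_eq_zero.1 h3)

end Main

end Schemes

end MorganScott

end

theorem mainTheorem2 {n : ℕ} [NeZero n] (Ω : Set MorganScott.Plane)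
    (V : Fin n → MorganScott.Plane) (hΩ : MorganScott.IsPolygonalDomain Ω V)
    (bc : Fin n → MorganScott.BoundaryType)
    (hpos : 0 < (MeasureTheory.Measure.hausdorffMeasure 1 :
        MeasureTheory.Measure MorganScott.Plane)
      (MorganScott.boundaryPart V bc .clamped ∪ MorganScott.boundaryPart V bc .simplySupported))
    (hconn : IsConnected (MorganScott.gammaCS V bc))
    (T : Finset (Finset MorganScott.Plane)) (hT : MorganScott.IsMesh T Ω)
    (p : ℕ) (hp : 1 ≤ p)
    (a : LinearMap.BilinForm ℝ (MorganScott.VecH1 Ω)) (M α : ℝ) (hM : 0 < M) (hα : 0 < α)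
    (ha_bounded : ∀ θ ψ : MorganScott.VecH1 Ω,
      |a θ ψ| ≤ M * MorganScott.normVecH1 θ * MorganScott.normVecH1 ψ)
    (ha_nonneg : ∀ θ : MorganScott.VecH1 Ω, 0 ≤ a θ θ)
    (ha_coercive : ∀ u ∈ MorganScott.H2Gamma Ω V bc,
      α * MorganScott.normH2 u ^ 2 ≤ a (MorganScott.grad u) (MorganScott.grad u))
    (D : Submodule ℝ (MorganScott.L2 Ω)) (F : D →ₗ[ℝ] ℝ)
    (hD : ∀ v ∈ MorganScott.H2Gamma Ω V bc, (v : MorganScott.L2 Ω) ∈ D)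
    (hD' : ∀ v ∈ MorganScott.WTilde Ω V bc T p, v ∈ D)
    (hF : ∃ C : ℝ, ∀ (v : MorganScott.H2 Ω) (hv : v ∈ MorganScott.H2Gamma Ω V bc),
      |F ⟨v, hD v hv⟩| ≤ C * MorganScott.normH2 v) :
    (∃! w : MorganScott.H2 Ω, MorganScott.IsGalerkinSolution Ω V bc T p a D F hD w) ∧
    (∃! q : MorganScott.L2 Ω × MorganScott.VecH1 Ω × MorganScott.L2 Ω × MorganScott.L2 Ω,
      MorganScott.IsSchemeSolution Ω V bc T p a D F hD' q.1 q.2.1 q.2.2.1 q.2.2.2) ∧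
    ∀ (z : MorganScott.L2 Ω) (θ : MorganScott.VecH1 Ω) (r w : MorganScott.L2 Ω),
      MorganScott.IsSchemeSolution Ω V bc T p a D F hD' z θ r w →
        (∀ i, MorganScott.weakPartial i w = (θ i : MorganScott.L2 Ω)) ∧
        ∀ wp : MorganScott.H2 Ω, MorganScott.IsGalerkinSolution Ω V bc T p a D F hD wp →
          w = (wp : MorganScott.L2 Ω) := by
  obtain ⟨z, θ, r, w, h⟩ := MorganScott.exists_schemeSolution (F := F) (hD' := hD')
    hΩ hT hconn hp hα ha_coercive
  obtain ⟨u, hu, -, -⟩ := h.exists_galerkin (hD := hD) hΩ hT hconn hp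
  refine ⟨⟨u, hu, fun u' hu' =>
    MorganScott.galerkin_unique hΩ hT hconn hp hα ha_coercive hu' hu⟩,
    ⟨(z, θ, r, w), h, fun q hq => ?_⟩, fun z' θ' r' w' h' => ?_⟩
  · obtain ⟨h1, h2, h3, h4⟩ :=
      MorganScott.schemeSolution_unique hΩ hT hconn hp hα ha_coercive hD hq h
    exact Prod.ext h1 (Prod.ext h2 (Prod.ext h3 h4))
  · obtain ⟨u', hu', rfl, rfl⟩ := h'.exists_galerkin (hD := hD) hΩ hT hconn hp
    exact ⟨fun _ => rfl, fun wp hwp => congrArg Subtype.val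
      (MorganScott.galerkin_unique hΩ hT hconn hp hα ha_coercive hu' hwp)⟩
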